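/- A pseudo-Kähler manifold $(M,g,J)$ is a pseudo-Riemannian manifold with an integrable (i.e. with vanishing Nijenhuis tensor) skew-symmetric almost complex structure $J$ whose fundamental form $\omega=g(J\cdot,\cdot)$ is closed. A conical pseudo-Riemannian manifold $(M,g,\xi)$ is a pseudo-Riemannian manifold with a nowhere null vector field $\xi$ such that $D\xi=\mathrm{Id}$, where $D$ is the Levi-Civita connection of $g$. Let $(M,g,J)$ be a pseudo-Kähler manifold with Kähler form $\omega$ and let $Z$ be a nowhere null Hamiltonian Killing vector field on $M$ with Hamiltonian function $-f$, that is, $f$ is a smooth function with $df=-\omega(Z,\cdot)$. Assume that $f$ and $f_1:=f-\tfrac12 g(Z,Z)$ vanish nowhere, and put $\beta:=g(Z,\cdot)$. Let $\pi:P\to M$ be a principal $S^1$-bundle with fundamental vector field $X_P$, endowed with a principal connection $\eta$ (a real-valued $S^1$-invariant one-form with $\eta(X_P)=1$) whose curvature is $d\eta=\pi^*(\omega-\tfrac12 d\beta)$, and let $T^hP=\ker\eta$ be its horizontal distribution. On $\hat M:=P\times\mathbb R$, with coordinate $t$ on the factor $\mathbb R$ and projection $\hat\pi:\hat M\to M$,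 $\hat\pi(p,t)=\pi(p)$, define (omitting pullbacks) $$\xi:=\partial_t,\quad \hat g:=e^{2t}\Bigl(\tfrac{2}{f_1}\eta^2+\pi^*g+2f\,dt^2+2\,df\,dt\Bigr),\quad \theta:=e^{2t}\bigl(\eta+\tfrac12\beta\bigr),\quad \hat\omega:=d\theta,\quad \hat J:=\hat g^{-1}\hat\omega,$$ where $2\,df\,dt=df\otimes dt+dt\otimes df$ and $\hat J$ is determined by $\hat g(\hat J\cdot,\cdot)=\hat\omega$. Then: 1. $\hat g$ is a pseudo-Riemannian metric and $(\hat M,\hat g,\hat J,\xi)$ is a conical pseudo-Kähler manifold (with Kähler form $\hat\omega$). 2. For every $t\in\mathbb R$, the distribution of the CR structure induced by $\hat J$ on the hypersurface $P\cong P\times\{t\}\subset\hat M$ (the vectors $v$ tangent to the hypersurface such that $\hat Jv$ is tangent to it, too) is $T^hP$, and $\pi:P\to M$ is holomorphic, that is, $d\pi\,\hat J=J\,d\pi$ on $T^hP$. 3. $\ker d\hat\pi=\mathrm{span}\{X_P,\xi\}$ is at no point $\hat J$-invariant; hence $\hat\pi:\hat M\to M$ is not holomorphic: at no point does $d\hat\pi\,\hat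 J=J\,d\hat\pi$ hold. 4. At every point of $\hat M$, $\hat g$ has signature $(2k+2,2\ell)$ if $f_1>0$ and $(2k,2\ell+2)$ if $f_1<0$, where $(2k,2\ell)$ is the signature (number of positive, number of negative directions) of $g$ at the image point in $M$. -/

import Mathlib

open scoped Manifold ContDiff
open Bundle (TotalSpace Trivialization)
open VectorField

noncomputable section

namespace Conification

/-! ### Tensor fields and the exterior derivative -/

section Tensors

variable {E : Type*} [NormedAddCommGroup E] [NormedSpace ℝ E]
  {H : Type*} [TopologicalSpace H] (I : ModelWithCorners ℝ E H)
  {M : Type*} [TopologicalSpace M] [ChartedSpace H M] [IsManifold I ∞ M]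

/-- The vector field `X` is smooth at `x`. -/
def SmoothFieldAt (X : Π x : M, TangentSpace I x) (x : M) : Prop :=
  ContMDiffAt I I.tangent ∞ (fun y ↦ (⟨y, X y⟩ : TangentBundle I M)) x

/-- The vector field `X` is differentiable at `x`. -/
def DiffFieldAt (X : Π x : M, TangentSpace I x) (x : M) : Prop :=
  MDifferentiableAt I I.tangent (fun y ↦ (⟨y, X y⟩ : TangentBundle I M)) x

/-- The one-form `α` is a smooth section of the cotangent bundle. -/
def SmoothOneForm (α : Π x : M, TangentSpace I x →L[ℝ] ℝ) : Prop :=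
  ContMDiff I (I.prod 𝓘(ℝ, E →L[ℝ] ℝ)) ∞
    (fun y ↦ TotalSpace.mk' (E →L[ℝ] ℝ)
      (E := fun y : M ↦ TangentSpace I y →L[ℝ] Bundle.Trivial M ℝ y) y (α y))

/-- The one-form `α` is differentiable at `x`. -/
def DiffOneFormAt (α : Π x : M, TangentSpace I x →L[ℝ] ℝ) (x : M) : Prop :=
  MDifferentiableAt I (I.prod 𝓘(ℝ, E →L[ℝ] ℝ))
    (fun y ↦ TotalSpace.mk' (E →L[ℝ] ℝ)
      (E := fun y : M ↦ TangentSpace I y →L[ℝ] Bundle.Trivial M ℝ y) y (α y)) x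

/-- `b` is a smooth section of the bundle of bilinear forms on the tangent spaces. -/
def SmoothBilin (b : Π x : M, TangentSpace I x →L[ℝ] TangentSpace I x →L[ℝ] ℝ) : Prop :=
  ContMDiff I (I.prod 𝓘(ℝ, E →L[ℝ] E →L[ℝ] ℝ)) ∞
    (fun y ↦ TotalSpace.mk' (E →L[ℝ] E →L[ℝ] ℝ)
      (E := fun y : M ↦ TangentSpace I y →L[ℝ] TangentSpace I y →L[ℝ] Bundle.Trivial M ℝ y)
      y (b y))

/-- `J` is a smooth section of the bundle of endomorphisms of the tangent spaces. -/
def SmoothEndo (J : Π x : M, TangentSpace I x →L[ℝ] TangentSpace I x) : Prop :=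
  ContMDiff I (I.prod 𝓘(ℝ, E →L[ℝ] E)) ∞
    (fun y ↦ TotalSpace.mk' (E →L[ℝ] E)
      (E := fun y : M ↦ TangentSpace I y →L[ℝ] TangentSpace I y) y (J y))

/-- The value at `x` of `X(α(Y)) - Y(α(X)) - α([X, Y])`. -/
def extDerivOneAux (α : Π x : M, TangentSpace I x →L[ℝ] ℝ) (x : M)
    (X Y : Π x : M, TangentSpace I x) : ℝ :=
  mvfderiv I (fun y ↦ α y (Y y)) x (X x) - mvfderiv I (fun y ↦ α y (X y)) x (Y x)
    - α x (mlieBracket I X Y x)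

theorem diffAt_apply {α : Π x : M, TangentSpace I x →L[ℝ] ℝ} {x : M}
    (hα : DiffOneFormAt I α x) {X : Π x : M, TangentSpace I x} (hX : DiffFieldAt I X x) :
    MDifferentiableAt I 𝓘(ℝ, ℝ) (fun y ↦ α y (X y)) x := by
  have h : MDifferentiableAt I (I.prod 𝓘(ℝ, ℝ))
      (fun m ↦ TotalSpace.mk' ℝ (E := Bundle.Trivial M ℝ) m (α m (X m))) x :=
    MDifferentiableAt.clm_bundle_apply (F₁ := E) (F₂ := ℝ) hα hX
  simp only [mdifferentiableAt_totalSpace] at h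
  exact h.2

theorem extDerivOneAux_swap (α : Π x : M, TangentSpace I x →L[ℝ] ℝ) (x : M)
    (X Y : Π x : M, TangentSpace I x) :
    extDerivOneAux I α x X Y = - extDerivOneAux I α x Y X := by
  simp only [extDerivOneAux]
  rw [mlieBracket_swap_apply (V := X), map_neg]
  ring

variable [FiniteDimensional ℝ E]

theorem extDerivOneAux_tensorial₂ {α : Π x : M, TangentSpace I x →L[ℝ] ℝ} {x : M}
    (hα : DiffOneFormAt I α x) (X : Π x : M, TangentSpace I x) (_ : DiffFieldAt I X x) :
    TensorialAt I E (extDerivOneAux I α x X) x where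
  smul {f Y} hf hY := by
    have : CompleteSpace E := FiniteDimensional.complete ℝ E
    have hY' := diffAt_apply I hα hY
    have h1 : (fun y ↦ α y ((f • Y) y)) = fun y ↦ f y * α y (Y y) := by
      funext y; simp
    simp only [extDerivOneAux]
    rw [h1, mvfderiv_fun_mul hf hY', mlieBracket_smul_right hf hY]
    simp
    ring
  add {Y Y'} hY hY' := by
    have : CompleteSpace E := FiniteDimensional.complete ℝ E
    have h1 : (fun y ↦ α y ((Y + Y') y)) = fun y ↦ α y (Y y) + α y (Y' y) := by
      funext y; simp
    simp only [extDerivOneAux]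
    rw [h1, mvfderiv_fun_add (diffAt_apply I hα hY) (diffAt_apply I hα hY'),
      mlieBracket_add_right hY hY']
    simp
    ring

theorem extDerivOneAux_tensorial₁ {α : Π x : M, TangentSpace I x →L[ℝ] ℝ} {x : M}
    (hα : DiffOneFormAt I α x) (Y : Π x : M, TangentSpace I x) (hY : DiffFieldAt I Y x) :
    TensorialAt I E (fun X ↦ extDerivOneAux I α x X Y) x where
  smul {f X} hf hX := by
    have h := (extDerivOneAux_tensorial₂ I hα Y hY).smul hf hX
    simp only [extDerivOneAux_swap I α x _ Y, h, smul_neg]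
  add {X X'} hX hX' := by
    have h := (extDerivOneAux_tensorial₂ I hα Y hY).add hX hX'
    simp only [extDerivOneAux_swap I α x _ Y, h, neg_add]

open Classical in
/-- The exterior derivative of a one-form, `dα(X, Y) = X(α(Y)) - Y(α(X)) - α([X, Y])`. -/
def extDerivOne (α : Π x : M, TangentSpace I x →L[ℝ] ℝ) (x : M) :
    TangentSpace I x →L[ℝ] TangentSpace I x →L[ℝ] ℝ :=
  if hα : DiffOneFormAt I α x then
    TensorialAt.mkHom₂ (extDerivOneAux I α x) x
      (fun Y hY ↦ extDerivOneAux_tensorial₁ I hα Y hY)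
      (fun X hX ↦ extDerivOneAux_tensorial₂ I hα X hX)
  else 0

theorem extDerivOne_apply {α : Π x : M, TangentSpace I x →L[ℝ] ℝ} {x : M}
    (hα : DiffOneFormAt I α x) {X Y : Π x : M, TangentSpace I x}
    (hX : DiffFieldAt I X x) (hY : DiffFieldAt I Y x) :
    extDerivOne I α x (X x) (Y x) =
      mvfderiv I (fun y ↦ α y (Y y)) x (X x) - mvfderiv I (fun y ↦ α y (X y)) x (Y x)
        - α x (mlieBracket I X Y x) := by
  rw [extDerivOne, dif_pos hα]
  exact TensorialAt.mkHom₂_apply _ _ hX hY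

/-- The two-form `σ` is closed: `dσ(X, Y, W) = 0` for all vector fields `X`, `Y`, `W`. -/
def IsClosedTwoForm (σ : Π x : M, TangentSpace I x →L[ℝ] TangentSpace I x →L[ℝ] ℝ) : Prop :=
  ∀ (x : M) (X Y W : Π x : M, TangentSpace I x),
    SmoothFieldAt I X x → SmoothFieldAt I Y x → SmoothFieldAt I W x →
    mvfderiv I (fun y ↦ σ y (Y y) (W y)) x (X x)
      - mvfderiv I (fun y ↦ σ y (X y) (W y)) x (Y x)
      + mvfderiv I (fun y ↦ σ y (X y) (Y y)) x (W x)
      - σ x (mlieBracket I X Y x) (W x)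
      + σ x (mlieBracket I X W x) (Y x)
      - σ x (mlieBracket I Y W x) (X x) = 0

/-! ### Pseudo-Riemannian, pseudo-Kähler and conical structures -/

/-- A pseudo-Riemannian metric: a smooth field of nondegenerate symmetric bilinear forms. -/
structure IsPseudoRiemannian
    (g : Π x : M, TangentSpace I x →L[ℝ] TangentSpace I x →L[ℝ] ℝ) : Prop where
  smooth : SmoothBilin I g
  symm : ∀ (x : M) (v w : TangentSpace I x), g x v w = g x w v
  nondegenerate : ∀ (x : M) (v : TangentSpace I x), (∀ w, g x v w = 0) → v = 0

/-- The fundamental form `ω = g(J ·, ·)`. -/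
def fundamentalForm (g : Π x : M, TangentSpace I x →L[ℝ] TangentSpace I x →L[ℝ] ℝ)
    (J : Π x : M, TangentSpace I x →L[ℝ] TangentSpace I x) (x : M) :
    TangentSpace I x →L[ℝ] TangentSpace I x →L[ℝ] ℝ :=
  (g x).comp (J x)

/-- Integrability of an almost complex structure: the Nijenhuis tensor
`[JX, JY] - J[JX, Y] - J[X, JY] - [X, Y]` vanishes. -/
def IsIntegrable (J : Π x : M, TangentSpace I x →L[ℝ] TangentSpace I x) : Prop :=
  ∀ (x : M) (X Y : Π x : M, TangentSpace I x), SmoothFieldAt I X x → SmoothFieldAt I Y x →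
    mlieBracket I (fun y ↦ J y (X y)) (fun y ↦ J y (Y y)) x
      - J x (mlieBracket I (fun y ↦ J y (X y)) Y x)
      - J x (mlieBracket I X (fun y ↦ J y (Y y)) x)
      - mlieBracket I X Y x = 0

/-- An almost pseudo-Kähler structure: a pseudo-Riemannian metric with a skew-symmetric almost
complex structure whose fundamental form is closed. -/
structure IsAlmostPseudoKahler
    (g : Π x : M, TangentSpace I x →L[ℝ] TangentSpace I x →L[ℝ] ℝ)
    (J : Π x : M, TangentSpace I x →L[ℝ] TangentSpace I x) : Prop where
  metric : IsPseudoRiemannian I g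
  smooth : SmoothEndo I J
  sq_eq_neg : ∀ (x : M) (v : TangentSpace I x), J x (J x v) = -v
  skew : ∀ (x : M) (v w : TangentSpace I x), g x (J x v) w = - g x v (J x w)
  closed : IsClosedTwoForm I (fundamentalForm I g J)

/-- A pseudo-Kähler structure. -/
structure IsPseudoKahler
    (g : Π x : M, TangentSpace I x →L[ℝ] TangentSpace I x →L[ℝ] ℝ)
    (J : Π x : M, TangentSpace I x →L[ℝ] TangentSpace I x) : Prop
    extends IsAlmostPseudoKahler I g J where
  integrable : IsIntegrable I J

/-- The vector field `Z` is a Killing field of `g`: it is smooth and `L_Z g = 0`. -/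
structure IsKilling (g : Π x : M, TangentSpace I x →L[ℝ] TangentSpace I x →L[ℝ] ℝ)
    (Z : Π x : M, TangentSpace I x) : Prop where
  smooth : ∀ x, SmoothFieldAt I Z x
  lie_eq_zero : ∀ (x : M) (X Y : Π x : M, TangentSpace I x),
    SmoothFieldAt I X x → SmoothFieldAt I Y x →
    mvfderiv I (fun y ↦ g y (X y) (Y y)) x (Z x)
      - g x (mlieBracket I Z X x) (Y x) - g x (X x) (mlieBracket I Z Y x) = 0

/-- `D` is the Levi-Civita connection of `g`: it is torsion-free and metric. -/
structure IsLeviCivita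
    (g : Π x : M, TangentSpace I x →L[ℝ] TangentSpace I x →L[ℝ] ℝ)
    (D : CovariantDerivative I E (TangentSpace I : M → Type _)) : Prop where
  torsion_eq_zero :
    haveI : CompleteSpace E := FiniteDimensional.complete ℝ E
    D.torsion = 0
  metric : ∀ (x : M) (v : TangentSpace I x) (X Y : Π x : M, TangentSpace I x),
    DiffFieldAt I X x → DiffFieldAt I Y x →
    mvfderiv I (fun y ↦ g y (X y) (Y y)) x v = g x (D X x v) (Y x) + g x (X x) (D Y x v)

/-- A conical pseudo-Riemannian manifold: a pseudo-Riemannian metric `g` with a smooth nowhere null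
vector field `ξ` such that `D ξ = Id` for the Levi-Civita connection `D` of `g`. -/
structure IsConical
    (g : Π x : M, TangentSpace I x →L[ℝ] TangentSpace I x →L[ℝ] ℝ)
    (ξ : Π x : M, TangentSpace I x) : Prop where
  metric : IsPseudoRiemannian I g
  smooth : ∀ x, SmoothFieldAt I ξ x
  not_null : ∀ x, g x (ξ x) (ξ x) ≠ 0
  deriv_eq_id : ∃ D : CovariantDerivative I E (TangentSpace I : M → Type _),
    IsLeviCivita I g D ∧ ∀ (x : M) (v : TangentSpace I x), D ξ x v = v

/-- The bilinear form `b` has signature `(p, q)`: `p` positive and `q` negative directions. -/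
def HasSignature {V : Type*} [AddCommGroup V] [Module ℝ V] [TopologicalSpace V]
    [IsTopologicalAddGroup V] [ContinuousConstSMul ℝ V]
    (b : V →L[ℝ] V →L[ℝ] ℝ) (p q : ℕ) : Prop :=
  sigPos (LinearMap.BilinMap.toQuadraticMap b.toLinearMap₁₂) = p ∧
    sigNeg (LinearMap.BilinMap.toQuadraticMap b.toLinearMap₁₂) = q

end Tensors

/-! ### Principal circle bundles with connection -/

section Bundles

variable {E : Type*} [NormedAddCommGroup E] [NormedSpace ℝ E]
  {H : Type*} [TopologicalSpace H] (I : ModelWithCorners ℝ E H)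
  {M : Type*} [TopologicalSpace M] [ChartedSpace H M]
  {E' : Type*} [NormedAddCommGroup E'] [NormedSpace ℝ E']
  {H' : Type*} [TopologicalSpace H'] (I' : ModelWithCorners ℝ E' H')
  {P : Type*} [TopologicalSpace P] [ChartedSpace H' P] [MulAction Circle P]

/-- `π : P → M` is a smooth principal circle bundle: the circle acts smoothly on `P` preserving the
fibres of the smooth map `π`, and `π` has smooth equivariant local trivializations. -/
structure IsPrincipalCircleBundle (π : P → M) : Prop where
  contMDiff_proj : ContMDiff I' I ∞ π
  contMDiff_smul : ContMDiff ((𝓡 1).prod I') I' ∞ (fun a : Circle × P ↦ a.1 • a.2)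
  proj_smul : ∀ (z : Circle) (p : P), π (z • p) = π p
  exists_trivialization : ∀ x : M, ∃ e : Trivialization Circle π, x ∈ e.baseSet ∧
    ContMDiffOn I' (I.prod (𝓡 1)) ∞ e e.source ∧
    ContMDiffOn (I.prod (𝓡 1)) I' ∞ e.toOpenPartialHomeomorph.symm e.target ∧
    ∀ (z : Circle), ∀ p ∈ e.source, (e (z • p)).2 = z * (e p).2

/-- The fundamental vector field `X_P` of the circle action, the velocity at `s = 0` of the curve
`s ↦ exp(is) • p`. -/
def fundamentalField (p : P) : TangentSpace I' p :=
  (mfderiv 𝓘(ℝ, ℝ) I' (fun s : ℝ ↦ Circle.exp s • p) 0 : ℝ →L[ℝ] E') 1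

/-- The one-form `η` is a principal connection: it is smooth, invariant under the circle action,
and takes the value `1` on the fundamental vector field. -/
structure IsPrincipalConnection [IsManifold I' ∞ P]
    (η : Π p : P, TangentSpace I' p →L[ℝ] ℝ) : Prop where
  smooth : SmoothOneForm I' η
  invariant : ∀ (z : Circle) (p : P) (v : TangentSpace I' p),
    η (z • p) (mfderiv I' I' (fun q : P ↦ z • q) p v) = η p v
  apply_fundamentalField : ∀ p : P, η p (fundamentalField I' p) = 1

end Bundles

/-! ### Pullbacks and products of forms -/

section Pullback

variable {V W : Type*} [AddCommGroup V] [Module ℝ V] [TopologicalSpace V]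
    [IsTopologicalAddGroup V] [ContinuousSMul ℝ V]
    [AddCommGroup W] [Module ℝ W] [TopologicalSpace W]
    [IsTopologicalAddGroup W] [ContinuousSMul ℝ W]

/-- The pullback `(u, v) ↦ b (A u) (A v)` of a bilinear form. -/
def pullBilin (b : W →L[ℝ] W →L[ℝ] ℝ) (A : V →L[ℝ] W) : V →L[ℝ] V →L[ℝ] ℝ :=
  (ContinuousLinearMap.precomp ℝ A).comp (b.comp A)

/-- The tensor product `(u, v) ↦ a u * b v` of one-forms. -/
def tensorOne (a b : V →L[ℝ] ℝ) : V →L[ℝ] V →L[ℝ] ℝ := a.smulRight b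

end Pullback

/-! ### The conification -/

section Construction

variable {E : Type*} [NormedAddCommGroup E] [NormedSpace ℝ E]
  {H : Type*} [TopologicalSpace H] (I : ModelWithCorners ℝ E H)
  {M : Type*} [TopologicalSpace M] [ChartedSpace H M]
  {E' : Type*} [NormedAddCommGroup E'] [NormedSpace ℝ E']
  {H' : Type*} [TopologicalSpace H'] (I' : ModelWithCorners ℝ E' H')
  {P : Type*} [TopologicalSpace P] [ChartedSpace H' P]

/-- The one-form `β = g(Z, ·)`. -/
def betaForm (g : Π x : M, TangentSpace I x →L[ℝ] TangentSpace I x →L[ℝ] ℝ)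
    (Z : Π x : M, TangentSpace I x) (x : M) : TangentSpace I x →L[ℝ] ℝ := g x (Z x)

/-- The function `f₁ = f - g(Z, Z) / 2`. -/
def fOne (g : Π x : M, TangentSpace I x →L[ℝ] TangentSpace I x →L[ℝ] ℝ)
    (Z : Π x : M, TangentSpace I x) (f : M → ℝ) (x : M) : ℝ := f x - g x (Z x) (Z x) / 2

/-- The projection `π̂ : P × ℝ → M`. -/
def projHat (π : P → M) (q : P × ℝ) : M := π q.1

/-- The differential of `π̂`. -/
def dProjHat (π : P → M) (q : P × ℝ) :
    TangentSpace (I'.prod 𝓘(ℝ, ℝ)) q →L[ℝ] TangentSpace I (projHat π q) :=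
  mfderiv (I'.prod 𝓘(ℝ, ℝ)) I (projHat π) q

/-- The differential of the projection `P × ℝ → P`. -/
def dProjP (q : P × ℝ) : TangentSpace (I'.prod 𝓘(ℝ, ℝ)) q →L[ℝ] TangentSpace I' q.1 :=
  mfderiv (I'.prod 𝓘(ℝ, ℝ)) I' Prod.fst q

/-- The one-form `dt` on `P × ℝ`. -/
def dtForm (q : P × ℝ) : TangentSpace (I'.prod 𝓘(ℝ, ℝ)) q →L[ℝ] ℝ :=
  mvfderiv (I'.prod 𝓘(ℝ, ℝ)) (fun q : P × ℝ ↦ q.2) q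

/-- The vector field `ξ = ∂_t` on `P × ℝ`. -/
def xiField (q : P × ℝ) : TangentSpace (I'.prod 𝓘(ℝ, ℝ)) q :=
  (mfderiv 𝓘(ℝ, ℝ) (I'.prod 𝓘(ℝ, ℝ)) (fun s : ℝ ↦ (q.1, s)) q.2 : ℝ →L[ℝ] E' × ℝ) 1

/-- The differential at `p` of the inclusion `P → P × ℝ`, `p ↦ (p, t)`, of the hypersurface
`P × {t}`. -/
def dIncl (t : ℝ) (p : P) :
    TangentSpace I' p →L[ℝ] TangentSpace (I'.prod 𝓘(ℝ, ℝ)) ((p, t) : P × ℝ) :=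
  mfderiv I' (I'.prod 𝓘(ℝ, ℝ)) (fun p : P ↦ (p, t)) p

/-- The metric `g_P = (2 / f₁) η² + π^* g` on `P`. -/
def metricP (g : Π x : M, TangentSpace I x →L[ℝ] TangentSpace I x →L[ℝ] ℝ)
    (Z : Π x : M, TangentSpace I x) (f : M → ℝ) (π : P → M)
    (η : Π p : P, TangentSpace I' p →L[ℝ] ℝ) (p : P) :
    TangentSpace I' p →L[ℝ] TangentSpace I' p →L[ℝ] ℝ :=
  (2 / fOne I g Z f (π p)) • tensorOne (η p) (η p) + pullBilin (g (π p)) (mfderiv I' I π p)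

/-- The metric `ĝ = exp(2t) (g_P + 2 f dt² + 2 df dt)` on `P × ℝ`, where `2 df dt` is the symmetric
product `df ⊗ dt + dt ⊗ df`. -/
def metricHat (g : Π x : M, TangentSpace I x →L[ℝ] TangentSpace I x →L[ℝ] ℝ)
    (Z : Π x : M, TangentSpace I x) (f : M → ℝ) (π : P → M)
    (η : Π p : P, TangentSpace I' p →L[ℝ] ℝ) (q : P × ℝ) :
    TangentSpace (I'.prod 𝓘(ℝ, ℝ)) q →L[ℝ] TangentSpace (I'.prod 𝓘(ℝ, ℝ)) q →L[ℝ] ℝ :=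
  let α := (mvfderiv I f (projHat π q)).comp (dProjHat I I' π q)
  Real.exp (2 * q.2) •
    (pullBilin (metricP I I' g Z f π η q.1) (dProjP I' q)
      + (2 * f (projHat π q)) • tensorOne (dtForm I' q) (dtForm I' q)
      + (tensorOne α (dtForm I' q) + tensorOne (dtForm I' q) α))

/-- The one-form `θ = exp(2t) (η + β / 2)` on `P × ℝ`. -/
def thetaForm (g : Π x : M, TangentSpace I x →L[ℝ] TangentSpace I x →L[ℝ] ℝ)
    (Z : Π x : M, TangentSpace I x) (π : P → M)
    (η : Π p : P, TangentSpace I' p →L[ℝ] ℝ) (q : P × ℝ) :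
    TangentSpace (I'.prod 𝓘(ℝ, ℝ)) q →L[ℝ] ℝ :=
  Real.exp (2 * q.2) • ((η q.1).comp (dProjP I' q)
    + (1 / 2 : ℝ) • (betaForm I g Z (projHat π q)).comp (dProjHat I I' π q))

variable [IsManifold I' ∞ P] [FiniteDimensional ℝ E']

/-- The two-form `ω̂ = dθ` on `P × ℝ`. -/
def omegaHat (g : Π x : M, TangentSpace I x →L[ℝ] TangentSpace I x →L[ℝ] ℝ)
    (Z : Π x : M, TangentSpace I x) (π : P → M)
    (η : Π p : P, TangentSpace I' p →L[ℝ] ℝ) (q : P × ℝ) :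
    TangentSpace (I'.prod 𝓘(ℝ, ℝ)) q →L[ℝ] TangentSpace (I'.prod 𝓘(ℝ, ℝ)) q →L[ℝ] ℝ :=
  extDerivOne (I'.prod 𝓘(ℝ, ℝ)) (thetaForm I I' g Z π η) q

/-- The endomorphism field `Ĵ = ĝ⁻¹ ω̂` on `P × ℝ`, that is, `ĝ(Ĵ u, v) = ω̂(u, v)`. Here `ĝ` and
`ω̂` are seen as maps from tangent vectors to covectors. -/
def jHat (g : Π x : M, TangentSpace I x →L[ℝ] TangentSpace I x →L[ℝ] ℝ)
    (Z : Π x : M, TangentSpace I x) (f : M → ℝ) (π : P → M)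
    (η : Π p : P, TangentSpace I' p →L[ℝ] ℝ) (q : P × ℝ) :
    TangentSpace (I'.prod 𝓘(ℝ, ℝ)) q →L[ℝ] TangentSpace (I'.prod 𝓘(ℝ, ℝ)) q :=
  (ContinuousLinearMap.inverse (metricHat I I' g Z f π η q)).comp (omegaHat I I' g Z π η q)

/-- The distribution of the CR structure induced on the hypersurface `P × {t}` by the almost complex
structure `J` of `P × ℝ`: the vectors `v` tangent to the hypersurface for which `J v` is tangent to
the hypersurface, too. -/
def crDistribution
    (J : Π q : P × ℝ, TangentSpace (I'.prod 𝓘(ℝ, ℝ)) q →L[ℝ] TangentSpace (I'.prod 𝓘(ℝ, ℝ)) q)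
    (t : ℝ) (p : P) : Submodule ℝ (TangentSpace I' p) :=
  (LinearMap.range (dIncl I' t p).toLinearMap).comap ((J (p, t)).comp (dIncl I' t p)).toLinearMap

end Construction

end Conification

open Conification

/-!
A tangent vector `v` of `M̂ = P × ℝ` is determined by its components `(X, a, τ)`, where
`X = dπ̂(v)`, `a = η(v)`, `τ = dt(v)`, and all components occur: this is
`isVerticalCoframe_projHat`, which uses that `X_P` spans the kernel of `dπ`. Everything is computed
in these components. Two vector fields with components `(X, a, s)` and `(Y, b, r)`, where `a`, `b`
are functions on `M` and `s`, `r` are constants, have the bracket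
`([X, Y], X b - Y a - F(X, Y), 0)` with the curvature form `F = ω - dβ / 2`
(`IsConification.mlieBracket_components`), and this gives `dθ` without choosing coordinates.

The metric `ĝ` is nondegenerate because `df = - g(J Z, ·)` and `f₁ ≠ 0`. Comparing `ĝ` and `dθ`
yields the endomorphism field
`Ĵ (X, a, τ) = (J X + τ Z - (a / f₁) J Z, f₁ τ, - a / f₁)`
(`IsConification.complexStructure_components`), from which `Ĵ² = -1`, the identification of the CR
distribution with `ker η`, the holomorphy of `π` on it and `dπ̂(Ĵ ξ) = Z ≠ 0` are read off.
The form `dθ` is closed as `d ∘ d = 0`. The Nijenhuis tensor is a tensor, and the tangent space is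
spanned by the horizontal vectors, `ξ` and `Ĵ ξ`; so it suffices to evaluate it on pairs of
horizontal lifts, where it vanishes because `J` is integrable and `F` is of type `(1, 1)`
(as `β = - df ∘ J`), and on `ξ` and a horizontal lift, where it vanishes because `Z` is holomorphic
and `df₁ = - F(Z, ·)`.

For `D ξ = Id` the Levi-Civita connection of `ĝ` is constructed from the Koszul formula. The dual
one-form of `ξ` is `d(exp(2t) f)`, hence closed, and `ξ` commutes with the lifts with constant
vertical components while it scales their products by `exp(2t)`; so `2 ĝ(D_u ξ, v) = 2 ĝ(u, v)`.

For the signature, completing the square gives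
`ĝ(v, v) = exp(2t) (g(X - τ J Z, X - τ J Z) + (2 / f₁) a² + 2 f₁ τ²)`; and the signature of `g` is
even, as complex lines on which `g` does not vanish can be split off one by one.
-/


set_option linter.unusedSectionVars false

namespace Conification

open Topology Filter

/-! ### Vector fields as derivations -/

section Derivation

variable {E : Type*} [NormedAddCommGroup E] [NormedSpace ℝ E] [FiniteDimensional ℝ E]
  {H : Type*} [TopologicalSpace H] {I : ModelWithCorners ℝ E H}
  {M : Type*} [TopologicalSpace M] [ChartedSpace H M] [IsManifold I ∞ M]
  {F : Type*} [NormedAddCommGroup F] [NormedSpace ℝ F]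

theorem SmoothFieldAt.contMDiffAt {X : Π x : M, TangentSpace I x} {x : M}
    (hX : SmoothFieldAt I X x) {n : WithTop ℕ∞} (hn : n ≤ ∞) :
    ContMDiffAt I I.tangent n (fun y ↦ (⟨y, X y⟩ : TangentBundle I M)) x :=
  ContMDiffAt.of_le hX hn

theorem SmoothFieldAt.diffFieldAt {X : Π x : M, TangentSpace I x} {x : M}
    (hX : SmoothFieldAt I X x) : DiffFieldAt I X x :=
  ContMDiffAt.mdifferentiableAt hX (by simp)

variable [I.Boundaryless]

/-- The differential of a function, read in a chart. -/
theorem mvfderiv_eq_fderiv_extChartAt_symm {h : M → F} {x : M} {y : E}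
    (hy : y ∈ (extChartAt I x).target)
    (hh : MDifferentiableAt I 𝓘(ℝ, F) h ((extChartAt I x).symm y))
    (v : TangentSpace I ((extChartAt I x).symm y)) :
    mvfderiv I h ((extChartAt I x).symm y) v =
      fderiv ℝ (h ∘ (extChartAt I x).symm) y
        ((mfderiv 𝓘(ℝ, E) I (extChartAt I x).symm y).inverse v) := by
  have hinv : (mfderiv 𝓘(ℝ, E) I (extChartAt I x).symm y).IsInvertible := by
    have := isInvertible_mfderivWithin_extChartAt_symm (I := I) hy
    rwa [I.range_eq_univ, mfderivWithin_univ] at this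
  have hd : MDifferentiableAt 𝓘(ℝ, E) I (extChartAt I x).symm y := by
    have := mdifferentiableWithinAt_extChartAt_symm (I := I) hy
    rwa [I.range_eq_univ, mdifferentiableWithinAt_univ] at this
  have hc := mfderiv_comp_apply y hh hd ((mfderiv 𝓘(ℝ, E) I (extChartAt I x).symm y).inverse v)
  rw [hinv.self_apply_inverse, mfderiv_eq_fderiv] at hc
  exact hc.symm

theorem contMDiffAt_extChartAt_symm (x : M) {n : WithTop ℕ∞} (hn : n ≤ ∞) :
    ContMDiffAt 𝓘(ℝ, E) I n (extChartAt I x).symm (extChartAt I x x) :=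
  ((contMDiffOn_extChartAt_symm (I := I) (n := ∞) x).contMDiffAt
    (extChartAt_target_mem_nhds x)).of_le hn

/-- The vector field `X` read in the chart at `x`. -/
def chartField (x : M) (X : Π x : M, TangentSpace I x) : E → E :=
  fun y ↦ mpullback 𝓘(ℝ, E) I (extChartAt I x).symm X y

theorem DiffFieldAt.differentiableAt_chartField {X : Π x : M, TangentSpace I x} {x : M}
    (hX : DiffFieldAt I X x) :
    DifferentiableAt ℝ (chartField x X)
      (extChartAt I x x) := by
  have : CompleteSpace E := FiniteDimensional.complete ℝ E
  have h := MDifferentiableWithinAt.differentiableWithinAt_mpullbackWithin_vectorField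
    (s := Set.univ) hX.mdifferentiableWithinAt
  simp only [I.range_eq_univ, Set.preimage_univ, Set.inter_univ, mpullbackWithin_univ] at h
  exact h.differentiableAt univ_mem

theorem mdifferentiableAt_of_comp_extChartAt_symm {G : M → F} {x : M}
    (hG : DifferentiableAt ℝ (G ∘ (extChartAt I x).symm) (extChartAt I x x)) :
    MDifferentiableAt I 𝓘(ℝ, F) G x := by
  have h := hG.mdifferentiableAt.comp x (mdifferentiableAt_extChartAt (I := I)
    (mem_chart_source H x))
  refine h.congr_of_eventuallyEq ?_
  filter_upwards [extChartAt_source_mem_nhds (I := I) x] with y hy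
  exact congrArg G ((extChartAt I x).left_inv hy).symm

/-- The bracket of vector fields acts on functions as the commutator of derivations. -/
theorem mvfderiv_mlieBracket {h : M → F} {x : M} {X Y : Π x : M, TangentSpace I x}
    (hh : ContMDiffAt I 𝓘(ℝ, F) 2 h x) (hX : DiffFieldAt I X x) (hY : DiffFieldAt I Y x) :
    mvfderiv I h x (mlieBracket I X Y x) =
      mvfderiv I (fun y ↦ mvfderiv I h y (Y y)) x (X x)
        - mvfderiv I (fun y ↦ mvfderiv I h y (X y)) x (Y x) := by
  have : CompleteSpace E := FiniteDimensional.complete ℝ E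
  have : IsManifold I (minSmoothness ℝ 2) M := by
    rw [minSmoothness_of_isRCLikeNormedField]; infer_instance
  set z := extChartAt I x x with hz
  have hzx : (extChartAt I x).symm z = x := extChartAt_to_inv x
  have hzt : z ∈ (extChartAt I x).target := mem_extChartAt_target x
  set k : E → F := h ∘ (extChartAt I x).symm with hk
  have hkc : ContDiffAt ℝ 2 k z := by
    rw [← contMDiffAt_iff_contDiffAt]
    exact ContMDiffAt.comp_of_eq hh
      (contMDiffAt_extChartAt_symm x (WithTop.coe_le_coe.2 le_top)) hzx
  have hd : ∀ᶠ y in 𝓝 z, y ∈ (extChartAt I x).target ∧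
      MDifferentiableAt I 𝓘(ℝ, F) h ((extChartAt I x).symm y) := by
    have h1 : ∀ᶠ y in 𝓝 x, MDifferentiableAt I 𝓘(ℝ, F) h y := by
      filter_upwards [contMDiffAt_iff_contMDiffAt_nhds (by simp) |>.1 hh] with y hy
      exact hy.mdifferentiableAt (by simp)
    have h2 := continuousAt_extChartAt_symm (I := I) x
    filter_upwards [extChartAt_target_mem_nhds x, h2.eventually (by rwa [hzx])] with y hy hy'
    exact ⟨hy, hy'⟩
  -- the derivative along a field, read in the chart
  have key : ∀ W : Π x : M, TangentSpace I x,
      (fun y ↦ mvfderiv I h y (W y)) ∘ (extChartAt I x).symm =ᶠ[𝓝 z]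
        fun y ↦ fderiv ℝ k y (chartField x W y) := by
    intro W
    filter_upwards [hd] with y hy
    exact mvfderiv_eq_fderiv_extChartAt_symm hy.1 hy.2 _
  have hfk : DifferentiableAt ℝ (fderiv ℝ k) z :=
    (hkc.fderiv_right (m := 1) (by norm_num)).differentiableAt (by simp)
  have hcomp : ∀ G : M → F, (G ∘ (extChartAt I x).symm) z = G x := fun G ↦ congrArg G hzx
  have hval : ∀ W : Π x : M, TangentSpace I x,
      mvfderiv I h x (W x) =
        fderiv ℝ k z (chartField x W z) := fun W ↦
    (hcomp (fun y ↦ mvfderiv I h y (W y))).symm.trans (key W).self_of_nhds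
  have hder : ∀ (W W' : Π x : M, TangentSpace I x), DiffFieldAt I W x →
      mvfderiv I (fun y ↦ mvfderiv I h y (W y)) x (W' x) =
        fderiv ℝ (fderiv ℝ k) z (chartField x W' z)
          (chartField x W z) +
        fderiv ℝ k z (fderiv ℝ (chartField x W) z
          (chartField x W' z)) := by
    intro W W' hW
    have hW1 := hW.differentiableAt_chartField
    have hcd : DifferentiableAt ℝ
        (fun y ↦ fderiv ℝ k y (chartField x W y)) z :=
      hfk.clm_apply hW1
    set G : M → F := fun y ↦ mvfderiv I h y (W y) with hG
    have hmd : MDifferentiableAt I 𝓘(ℝ, F) G x :=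
      mdifferentiableAt_of_comp_extChartAt_symm (hcd.congr_of_eventuallyEq (key W))
    have h1 := mvfderiv_eq_fderiv_extChartAt_symm (h := G) hzt
      (by rwa [hzx]) (W' ((extChartAt I x).symm z))
    have h2 := hcomp (fun y ↦ mvfderiv I G y (W' y))
    rw [← h2]
    refine h1.trans ?_
    rw [(key W).fderiv_eq, fderiv_clm_apply hfk hW1, add_comm]
    rfl
  -- the second derivatives cancel by symmetry, the first ones combine to the bracket in the chart
  have hsym := hkc.isSymmSndFDerivAt (by simp)
  have hbr : chartField x (mlieBracket I X Y) z =
      fderiv ℝ (chartField x Y) z (chartField x X z)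
        - fderiv ℝ (chartField x X) z (chartField x Y z) := by
    have h1 := mpullback_mlieBracket (I := 𝓘(ℝ, E)) (I' := I) (x₀ := z)
      (f := (extChartAt I x).symm) (V := X) (W := Y) (n := 2) (by rw [hzx]; exact hX)
      (by rw [hzx]; exact hY)
      (contMDiffAt_extChartAt_symm x (WithTop.coe_le_coe.2 le_top)) (by simp)
    have h2 := mlieBracketWithin_eq_lieBracketWithin (𝕜 := ℝ) (s := Set.univ)
      (V := chartField x X) (W := chartField x Y)
    rw [lieBracketWithin_univ] at h2
    exact h1.trans (congrFun (mlieBracketWithin_univ.symm.trans h2) z)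
  rw [hder Y X hY, hder X Y hX, hval, hbr, map_sub,
    hsym.eq (chartField x X z)]
  abel

end Derivation

/-! ### Smooth tensor fields and vector fields -/

section Along

variable {E : Type*} [NormedAddCommGroup E] [NormedSpace ℝ E]
  {H : Type*} [TopologicalSpace H] {I : ModelWithCorners ℝ E H}
  {M : Type*} [TopologicalSpace M] [ChartedSpace H M] [IsManifold I ∞ M]
  {E' : Type*} [NormedAddCommGroup E'] [NormedSpace ℝ E']
  {H' : Type*} [TopologicalSpace H'] {I' : ModelWithCorners ℝ E' H'}
  {N : Type*} [TopologicalSpace N] [ChartedSpace H' N] [IsManifold I' ∞ N]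
  {F : Type*} [NormedAddCommGroup F] [NormedSpace ℝ F]
  {n : WithTop ℕ∞}

theorem contMDiffAt_mfderiv_apply {φ : N → M} {q : N} {V : Π q : N, TangentSpace I' q}
    {m : WithTop ℕ∞} (hφ : ContMDiffAt I' I m φ q) (hnm : n + 1 ≤ m)
    (hV : ContMDiffAt I' I'.tangent n (fun y ↦ (⟨y, V y⟩ : TangentBundle I' N)) q) :
    ContMDiffAt I' I.tangent n
      (fun y ↦ (⟨φ y, mfderiv I' I φ y (V y)⟩ : TangentBundle I M)) q :=
  ContMDiffAt.clm_apply_of_inCoordinates (b₁ := id) (hφ.mfderiv_const hnm) hV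
    (hφ.of_le (le_self_add.trans hnm))

theorem contMDiffAt_mvfderiv_apply {h : N → F} {q : N} {V : Π q : N, TangentSpace I' q}
    {m : WithTop ℕ∞} (hh : ContMDiffAt I' 𝓘(ℝ, F) m h q) (hnm : n + 1 ≤ m)
    (hV : ContMDiffAt I' I'.tangent n (fun y ↦ (⟨y, V y⟩ : TangentBundle I' N)) q) :
    ContMDiffAt I' 𝓘(ℝ, F) n (fun y ↦ mvfderiv I' h y (V y)) q :=
  (contMDiff_snd_tangentBundle_modelSpace F 𝓘(ℝ, F)).contMDiffAt.comp q
    (contMDiffAt_mfderiv_apply hh hnm hV)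

theorem SmoothOneForm.contMDiffAt_apply {α : Π x : M, TangentSpace I x →L[ℝ] ℝ}
    (hα : SmoothOneForm I α) {b : N → M} {q : N} (hb : ContMDiffAt I' I n b q) (hn : n ≤ ∞)
    {V : Π y : N, TangentSpace I (b y)}
    (hV : ContMDiffAt I' I.tangent n (fun y ↦ (⟨b y, V y⟩ : TangentBundle I M)) q) :
    ContMDiffAt I' 𝓘(ℝ, ℝ) n (fun y ↦ α (b y) (V y)) q := by
  have h : ContMDiffAt I' (I.prod 𝓘(ℝ, ℝ)) n
      (fun m ↦ TotalSpace.mk' ℝ (E := Bundle.Trivial M ℝ) (b m) (α (b m) (V m))) q :=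
    ContMDiffAt.clm_bundle_apply (F₁ := E) (F₂ := ℝ)
      (((hα (b q)).of_le hn).comp q hb) hV
  rw [Bundle.contMDiffAt_totalSpace] at h
  exact h.2

theorem SmoothBilin.contMDiffAt_apply
    {g : Π x : M, TangentSpace I x →L[ℝ] TangentSpace I x →L[ℝ] ℝ}
    (hg : SmoothBilin I g) {b : N → M} {q : N} (hb : ContMDiffAt I' I n b q) (hn : n ≤ ∞)
    {V W : Π y : N, TangentSpace I (b y)}
    (hV : ContMDiffAt I' I.tangent n (fun y ↦ (⟨b y, V y⟩ : TangentBundle I M)) q)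
    (hW : ContMDiffAt I' I.tangent n (fun y ↦ (⟨b y, W y⟩ : TangentBundle I M)) q) :
    ContMDiffAt I' 𝓘(ℝ, ℝ) n (fun y ↦ g (b y) (V y) (W y)) q := by
  have h : ContMDiffAt I' (I.prod 𝓘(ℝ, ℝ)) n
      (fun m ↦ TotalSpace.mk' ℝ (E := Bundle.Trivial M ℝ) (b m) (g (b m) (V m) (W m))) q :=
    ContMDiffAt.clm_bundle_apply₂ (F₁ := E) (F₂ := E) (F₃ := ℝ)
      (((hg (b q)).of_le hn).comp q hb) hV hW
  rw [Bundle.contMDiffAt_totalSpace] at h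
  exact h.2

theorem SmoothEndo.contMDiffAt_apply {J : Π x : M, TangentSpace I x →L[ℝ] TangentSpace I x}
    (hJ : SmoothEndo I J) {x : M} (hn : n ≤ ∞) {X : Π x : M, TangentSpace I x}
    (hX : ContMDiffAt I I.tangent n (fun y ↦ (⟨y, X y⟩ : TangentBundle I M)) x) :
    ContMDiffAt I I.tangent n (fun y ↦ (⟨y, J y (X y)⟩ : TangentBundle I M)) x :=
  ContMDiffAt.clm_bundle_apply (F₁ := E) (F₂ := E) ((hJ x).of_le hn) hX

theorem SmoothEndo.diffFieldAt_apply {J : Π x : M, TangentSpace I x →L[ℝ] TangentSpace I x}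
    (hJ : SmoothEndo I J) {x : M} {X : Π x : M, TangentSpace I x} (hX : DiffFieldAt I X x) :
    DiffFieldAt I (fun y ↦ J y (X y)) x :=
  MDifferentiableAt.clm_bundle_apply (F₁ := E) (F₂ := E)
    ((hJ x).mdifferentiableAt (by simp)) hX

theorem SmoothOneForm.diffOneFormAt {α : Π x : M, TangentSpace I x →L[ℝ] ℝ}
    (hα : SmoothOneForm I α) (x : M) : DiffOneFormAt I α x :=
  (hα x).mdifferentiableAt (by simp)

theorem SmoothBilin.mdifferentiableAt_apply
    {g : Π x : M, TangentSpace I x →L[ℝ] TangentSpace I x →L[ℝ] ℝ}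
    (hg : SmoothBilin I g) {x : M} {X Y : Π x : M, TangentSpace I x}
    (hX : DiffFieldAt I X x) (hY : DiffFieldAt I Y x) :
    MDifferentiableAt I 𝓘(ℝ, ℝ) (fun y ↦ g y (X y) (Y y)) x := by
  have h : MDifferentiableAt I (I.prod 𝓘(ℝ, ℝ))
      (fun m ↦ TotalSpace.mk' ℝ (E := Bundle.Trivial M ℝ) m (g m (X m) (Y m))) x :=
    MDifferentiableAt.clm_bundle_apply₂ (F₁ := E) (F₂ := E) (F₃ := ℝ)
      ((hg x).mdifferentiableAt (by simp)) hX hY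
  simp only [mdifferentiableAt_totalSpace] at h
  exact h.2

end Along

theorem isInvertible_of_injective_of_finrank_eq {V W : Type*} [NormedAddCommGroup V]
    [NormedSpace ℝ V] [FiniteDimensional ℝ V] [NormedAddCommGroup W] [NormedSpace ℝ W]
    [FiniteDimensional ℝ W] {A : V →L[ℝ] W} (hA : Function.Injective A)
    (h : Module.finrank ℝ V = Module.finrank ℝ W) : A.IsInvertible :=
  ⟨(LinearEquiv.ofInjectiveOfFinrankEq A.toLinearMap hA h).toContinuousLinearEquiv, rfl⟩

section Criterion

variable {E : Type*} [NormedAddCommGroup E] [NormedSpace ℝ E] [FiniteDimensional ℝ E]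
  {H : Type*} [TopologicalSpace H] {I : ModelWithCorners ℝ E H}
  {M : Type*} [TopologicalSpace M] [ChartedSpace H M] [IsManifold I ∞ M]

/-- Smoothness of operators on a finite-dimensional space is tested on vectors. -/
theorem contMDiffAt_clm_of_apply {F : Type*} [NormedAddCommGroup F] [NormedSpace ℝ F]
    {x : M} {n : WithTop ℕ∞} {A : M → E →L[ℝ] F}
    (hA : ∀ v, ContMDiffAt I 𝓘(ℝ, F) n (fun y ↦ A y v) x) :
    ContMDiffAt I 𝓘(ℝ, E →L[ℝ] F) n A x := by
  let b := Module.finBasis ℝ E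
  have h : A = fun y ↦ ∑ i, ContinuousLinearMap.smulRightL ℝ E F
      (LinearMap.toContinuousLinearMap (b.coord i)) (A y (b i)) := by
    funext y
    ext v
    conv_lhs => rw [← b.sum_repr v, map_sum]
    simp
  rw [h]
  refine ContMDiffAt.sum fun i _ ↦ ?_
  exact (ContinuousLinearMap.smulRightL ℝ E F
      (LinearMap.toContinuousLinearMap (b.coord i))).contMDiff.contMDiffAt.comp x (hA (b i))

/-- A smooth field through a given tangent vector. -/
theorem exists_smoothFieldAt (x : M) (v : TangentSpace I x) :
    ∃ X : Π x : M, TangentSpace I x, SmoothFieldAt I X x ∧ X x = v :=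
  ⟨FiberBundle.extend E v, FiberBundle.contMDiffAt_extend .., by simp⟩

variable {F₂ : Type*} [NormedAddCommGroup F₂] [NormedSpace ℝ F₂] {V₂ : M → Type*}
  [TopologicalSpace (TotalSpace F₂ V₂)] [∀ x, AddCommGroup (V₂ x)] [∀ x, Module ℝ (V₂ x)]
  [∀ x, TopologicalSpace (V₂ x)] [∀ x, IsTopologicalAddGroup (V₂ x)]
  [∀ x, ContinuousSMul ℝ (V₂ x)] [FiberBundle F₂ V₂] [VectorBundle ℝ F₂ V₂]

/-- A field of linear maps out of the tangent spaces is smooth as soon as it maps smooth vector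
fields to smooth sections. -/
theorem contMDiffAt_hom_of_apply [ContMDiffVectorBundle ∞ F₂ V₂ I]
    {A : Π x : M, TangentSpace I x →L[ℝ] V₂ x} {x : M}
    (hA : ∀ X : Π x : M, TangentSpace I x, SmoothFieldAt I X x →
      ContMDiffAt I (I.prod 𝓘(ℝ, F₂)) ∞ (fun y ↦ TotalSpace.mk' F₂ (E := V₂) y (A y (X y))) x) :
    ContMDiffAt I (I.prod 𝓘(ℝ, E →L[ℝ] F₂)) ∞
      (fun y ↦ TotalSpace.mk' (E →L[ℝ] F₂) (E := fun y : M ↦ TangentSpace I y →L[ℝ] V₂ y)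
        y (A y)) x := by
  rw [contMDiffAt_hom_bundle]
  refine ⟨contMDiffAt_id, contMDiffAt_clm_of_apply fun v ↦ ?_⟩
  -- test on the fields which are constant in the trivialization at `x`
  let T := trivializationAt E (TangentSpace I : M → Type _) x
  have hx : x ∈ T.baseSet := FiberBundle.mem_baseSet_trivializationAt' x
  have hX : SmoothFieldAt I (fun y ↦ (T.symm y v : TangentSpace I y)) x := by
    refine Bundle.contMDiffAt_section x |>.2 ?_
    refine (contMDiffAt_const (c := v)).congr_of_eventuallyEq ?_
    filter_upwards [T.open_baseSet.mem_nhds hx] with y hy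
    exact congrArg Prod.snd (T.apply_mk_symm hy v)
  have h := hA _ hX
  rw [Bundle.contMDiffAt_totalSpace] at h
  refine h.2.congr_of_eventuallyEq ?_
  filter_upwards [T.open_baseSet.mem_nhds hx, (trivializationAt F₂ V₂ x).open_baseSet.mem_nhds
    (FiberBundle.mem_baseSet_trivializationAt' x)] with y hy hy2
  rw [ContinuousLinearMap.inCoordinates_eq hy hy2]
  simp
  rfl

/-- The preimage of a smooth section under a smooth field of isomorphisms is smooth. -/
theorem contMDiffAt_inverse_apply [ContMDiffVectorBundle ∞ F₂ V₂ I]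
    {A : Π x : M, TangentSpace I x →L[ℝ] V₂ x} {s : Π x : M, V₂ x} {x : M}
    (hA : ContMDiffAt I (I.prod 𝓘(ℝ, E →L[ℝ] F₂)) ∞
      (fun y ↦ TotalSpace.mk' (E →L[ℝ] F₂) (E := fun y : M ↦ TangentSpace I y →L[ℝ] V₂ y)
        y (A y)) x)
    (hinv : ∀ᶠ y in 𝓝 x, (A y).IsInvertible)
    (hs : ContMDiffAt I (I.prod 𝓘(ℝ, F₂)) ∞ (fun y ↦ TotalSpace.mk' F₂ (E := V₂) y (s y)) x) :
    SmoothFieldAt I (fun y ↦ (A y).inverse (s y)) x := by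
  have : CompleteSpace E := FiniteDimensional.complete ℝ E
  rw [contMDiffAt_hom_bundle] at hA
  rw [Bundle.contMDiffAt_section] at hs
  refine Bundle.contMDiffAt_section x |>.2 ?_
  set T := trivializationAt E (TangentSpace I : M → Type _) x with hT
  set T₂ := trivializationAt F₂ V₂ x with hT₂
  have hx : x ∈ T.baseSet := FiberBundle.mem_baseSet_trivializationAt' x
  have hx₂ : x ∈ T₂.baseSet := FiberBundle.mem_baseSet_trivializationAt' x
  set B : M → E →L[ℝ] F₂ := fun y ↦
    ContinuousLinearMap.inCoordinates E (TangentSpace I : M → Type _) F₂ V₂ x y x y (A y) with hB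
  have hB' : ContMDiffAt I 𝓘(ℝ, E →L[ℝ] F₂) ∞ B x := hA.2
  have hBe : ∀ y (hy : y ∈ T.baseSet) (hy₂ : y ∈ T₂.baseSet), B y =
      (T₂.continuousLinearEquivAt ℝ y hy₂ : V₂ y →L[ℝ] F₂).comp ((A y).comp
        ((T.continuousLinearEquivAt ℝ y hy).symm : E →L[ℝ] TangentSpace I y)) :=
    fun y hy hy₂ ↦ ContinuousLinearMap.inCoordinates_eq hy hy₂
  obtain ⟨e, he⟩ := hinv.self_of_nhds
  have hBx : ∃ e' : E ≃L[ℝ] F₂, (e' : E →L[ℝ] F₂) = B x :=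
    ⟨((T.continuousLinearEquivAt ℝ x hx).symm.trans e).trans (T₂.continuousLinearEquivAt ℝ x hx₂),
      by rw [hBe x hx hx₂, ← he]; rfl⟩
  obtain ⟨e', he'⟩ := hBx
  have hinvB : ContMDiffAt I 𝓘(ℝ, F₂ →L[ℝ] E) ∞ (fun y ↦ (B y).inverse) x := by
    have h := contDiffAt_map_inverse (𝕜 := ℝ) (n := ∞) e'
    rw [he'] at h
    exact h.contMDiffAt.comp x hB'
  refine (hinvB.clm_apply hs).congr_of_eventuallyEq ?_
  filter_upwards [T.open_baseSet.mem_nhds hx, T₂.open_baseSet.mem_nhds hx₂, hinv]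
    with y hy hy₂ ⟨a, ha⟩
  have h1 : (B y).inverse = (((T.continuousLinearEquivAt ℝ y hy).symm.trans a).trans
      (T₂.continuousLinearEquivAt ℝ y hy₂)).symm := by
    rw [← ContinuousLinearMap.inverse_equiv]
    congr 1
    rw [hBe y hy hy₂, ← ha]; rfl
  rw [h1, ← ha, ContinuousLinearMap.inverse_equiv]
  have h2 : T₂.symm y (T₂ ⟨y, s y⟩).2 = s y := T₂.symm_apply_apply_mk hy₂ (s y)
  simp [h2]

theorem smoothOneForm_of_apply {α : Π x : M, TangentSpace I x →L[ℝ] ℝ}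
    (hα : ∀ (x : M) (X : Π x : M, TangentSpace I x), SmoothFieldAt I X x →
      ContMDiffAt I 𝓘(ℝ, ℝ) ∞ (fun y ↦ α y (X y)) x) : SmoothOneForm I α := fun x ↦
  contMDiffAt_hom_of_apply (V₂ := Bundle.Trivial M ℝ) fun X hX ↦
    (Bundle.contMDiffAt_section x).2 (hα x X hX)

theorem smoothBilin_of_apply {g : Π x : M, TangentSpace I x →L[ℝ] TangentSpace I x →L[ℝ] ℝ}
    (hg : ∀ (x : M) (X Y : Π x : M, TangentSpace I x), SmoothFieldAt I X x →
      SmoothFieldAt I Y x → ContMDiffAt I 𝓘(ℝ, ℝ) ∞ (fun y ↦ g y (X y) (Y y)) x) :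
    SmoothBilin I g := fun x ↦
  contMDiffAt_hom_of_apply
    (V₂ := fun y : M ↦ TangentSpace I y →L[ℝ] Bundle.Trivial M ℝ y) fun X hX ↦
    contMDiffAt_hom_of_apply (V₂ := Bundle.Trivial M ℝ) fun Y hY ↦
    (Bundle.contMDiffAt_section x).2 (hg x X Y hX hY)

/-- The endomorphism field `g⁻¹ σ` is smooth, for `g` and `σ` seen as maps to covectors. -/
theorem SmoothBilin.smoothEndo_inverse_comp
    {g σ : Π x : M, TangentSpace I x →L[ℝ] TangentSpace I x →L[ℝ] ℝ}
    (hg : SmoothBilin I g) (hinv : ∀ x, (g x).IsInvertible) (hσ : SmoothBilin I σ) :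
    SmoothEndo I (fun x ↦ (g x).inverse.comp (σ x)) := fun x ↦
  contMDiffAt_hom_of_apply (V₂ := (TangentSpace I : M → Type _)) fun _ hX ↦
    contMDiffAt_inverse_apply (V₂ := fun y : M ↦ TangentSpace I y →L[ℝ] Bundle.Trivial M ℝ y)
      (hg x) (Eventually.of_forall hinv)
      (ContMDiffAt.clm_bundle_apply (F₁ := E) (F₂ := E →L[ℝ] ℝ) (hσ x) hX)

theorem isInvertible_of_nondegenerate {b : E →L[ℝ] E →L[ℝ] ℝ}
    (hb : ∀ v, (∀ w, b v w = 0) → v = 0) : b.IsInvertible := by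
  refine isInvertible_of_injective_of_finrank_eq (fun v w hvw ↦ ?_) ?_
  · rw [← sub_eq_zero]
    refine hb _ fun u ↦ ?_
    rw [map_sub, hvw, sub_self, zero_apply]
  · rw [← (LinearMap.toContinuousLinearMap (𝕜 := ℝ) (E := E) (F' := ℝ)).finrank_eq]
    exact (Subspace.dual_finrank_eq (K := ℝ) (V := E)).symm

/-- A field prescribed by its values under a field of isomorphisms to a fixed vector space. -/
theorem contMDiffAt_inverse_apply_const {W : Type*} [NormedAddCommGroup W] [NormedSpace ℝ W]
    {A : Π x : M, TangentSpace I x →L[ℝ] W} {c : M → W} {x : M}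
    (hA : ∀ X : Π x : M, TangentSpace I x, SmoothFieldAt I X x →
      ContMDiffAt I 𝓘(ℝ, W) ∞ (fun y ↦ A y (X y)) x)
    (hinv : ∀ᶠ y in 𝓝 x, (A y).IsInvertible) (hc : ContMDiffAt I 𝓘(ℝ, W) ∞ c x) :
    SmoothFieldAt I (fun y ↦ (A y).inverse (c y)) x :=
  contMDiffAt_inverse_apply (V₂ := Bundle.Trivial M W)
    (contMDiffAt_hom_of_apply (V₂ := Bundle.Trivial M W) fun X hX ↦
      (Bundle.contMDiffAt_section x).2 (hA X hX)) hinv ((Bundle.contMDiffAt_section x).2 hc)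

end Criterion

/-! ### The exterior derivative squares to zero -/

section Exterior

variable {E : Type*} [NormedAddCommGroup E] [NormedSpace ℝ E] [FiniteDimensional ℝ E]
  {H : Type*} [TopologicalSpace H] {I : ModelWithCorners ℝ E H}
  {M : Type*} [TopologicalSpace M] [ChartedSpace H M] [IsManifold I ∞ M]

theorem mvfderiv_congr {F : Type*} [NormedAddCommGroup F] [NormedSpace ℝ F] {h k : M → F} {x : M}
    (e : h =ᶠ[𝓝 x] k) : mvfderiv I h x = mvfderiv I k x :=
  e.mfderiv_eq

theorem SmoothFieldAt.eventually_diffFieldAt {X : Π x : M, TangentSpace I x} {x : M}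
    (hX : SmoothFieldAt I X x) : ∀ᶠ y in 𝓝 x, DiffFieldAt I X y := by
  have h := hX.contMDiffAt (n := 1) (WithTop.coe_le_coe.2 le_top)
  filter_upwards [contMDiffAt_iff_contMDiffAt_nhds (by simp) |>.1 h] with y hy
  exact hy.mdifferentiableAt (by simp)

theorem SmoothFieldAt.mlieBracket {X Y : Π x : M, TangentSpace I x} {x : M}
    (hX : SmoothFieldAt I X x) (hY : SmoothFieldAt I Y x) :
    SmoothFieldAt I (mlieBracket I X Y) x := by
  have : CompleteSpace E := FiniteDimensional.complete ℝ E
  have : IsManifold I (minSmoothness ℝ 2) M := by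
    rw [minSmoothness_of_isRCLikeNormedField]; infer_instance
  have : IsManifold I (((⊤ : ℕ∞) : WithTop ℕ∞) + 1) M := ‹IsManifold I ∞ M›
  exact ContMDiffAt.mlieBracket_vectorField (m := ⊤) (n := ⊤) hX hY
    (by rw [minSmoothness_of_isRCLikeNormedField]; exact le_rfl)

theorem SmoothOneForm.contMDiffAt_apply_field {α : Π x : M, TangentSpace I x →L[ℝ] ℝ}
    (hα : SmoothOneForm I α) {x : M} {X : Π x : M, TangentSpace I x} (hX : SmoothFieldAt I X x) :
    ContMDiffAt I 𝓘(ℝ, ℝ) ∞ (fun y ↦ α y (X y)) x :=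
  hα.contMDiffAt_apply contMDiffAt_id le_rfl hX

theorem SmoothOneForm.extDerivOne {α : Π x : M, TangentSpace I x →L[ℝ] ℝ}
    (hα : SmoothOneForm I α) : SmoothBilin I (extDerivOne I α) := by
  refine smoothBilin_of_apply fun x X Y hX hY ↦ ?_
  have h : ContMDiffAt I 𝓘(ℝ, ℝ) ∞ (fun y ↦ mvfderiv I (fun z ↦ α z (Y z)) y (X y)
      - mvfderiv I (fun z ↦ α z (X z)) y (Y y) - α y (mlieBracket I X Y y)) x :=
    ((contMDiffAt_mvfderiv_apply (hα.contMDiffAt_apply_field hY) le_rfl hX).sub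
      (contMDiffAt_mvfderiv_apply (hα.contMDiffAt_apply_field hX) le_rfl hY)).sub
      (hα.contMDiffAt_apply_field (hX.mlieBracket hY))
  refine h.congr_of_eventuallyEq ?_
  filter_upwards [hX.eventually_diffFieldAt, hY.eventually_diffFieldAt] with y hXy hYy
  exact extDerivOne_apply I (hα.diffOneFormAt y) hXy hYy

theorem extDerivOne_swap {α : Π x : M, TangentSpace I x →L[ℝ] ℝ} (x : M)
    (hα : DiffOneFormAt I α x) (u v : TangentSpace I x) :
    extDerivOne I α x u v = - extDerivOne I α x v u := by
  obtain ⟨X, hX, rfl⟩ := exists_smoothFieldAt x u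
  obtain ⟨Y, hY, rfl⟩ := exists_smoothFieldAt x v
  rw [extDerivOne_apply I hα hX.diffFieldAt hY.diffFieldAt,
    extDerivOne_apply I hα hY.diffFieldAt hX.diffFieldAt]
  exact extDerivOneAux_swap I α x X Y

/-- `d ∘ d = 0` on one-forms. -/
theorem SmoothOneForm.isClosedTwoForm_extDerivOne [I.Boundaryless]
    {α : Π x : M, TangentSpace I x →L[ℝ] ℝ}
    (hα : SmoothOneForm I α) : IsClosedTwoForm I (Conification.extDerivOne I α) := by
  intro x X Y W hX hY hW
  have : CompleteSpace E := FiniteDimensional.complete ℝ E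
  have h3 : IsManifold I (minSmoothness ℝ 3) M := by
    rw [minSmoothness_of_isRCLikeNormedField]
    exact IsManifold.of_le (n := ∞) (WithTop.coe_le_coe.2 le_top)
  -- the derivative of `dα(A, B)` along `C`
  have key : ∀ A B C : Π x : M, TangentSpace I x, SmoothFieldAt I A x → SmoothFieldAt I B x →
      mvfderiv I (fun y ↦ Conification.extDerivOne I α y (A y) (B y)) x (C x) =
        mvfderiv I (fun y ↦ mvfderiv I (fun z ↦ α z (B z)) y (A y)) x (C x)
        - mvfderiv I (fun y ↦ mvfderiv I (fun z ↦ α z (A z)) y (B y)) x (C x)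
        - mvfderiv I (fun y ↦ α y (mlieBracket I A B y)) x (C x) := by
    intro A B C hA hB
    have e : (fun y ↦ Conification.extDerivOne I α y (A y) (B y)) =ᶠ[𝓝 x] fun y ↦
        mvfderiv I (fun z ↦ α z (B z)) y (A y) - mvfderiv I (fun z ↦ α z (A z)) y (B y)
          - α y (mlieBracket I A B y) := by
      filter_upwards [hA.eventually_diffFieldAt, hB.eventually_diffFieldAt] with y hXy hYy
      exact extDerivOne_apply I (hα.diffOneFormAt y) hXy hYy
    have d1 := (contMDiffAt_mvfderiv_apply (hα.contMDiffAt_apply_field hB) le_rfl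
      hA).mdifferentiableAt (by simp)
    have d2 := (contMDiffAt_mvfderiv_apply (hα.contMDiffAt_apply_field hA) le_rfl
      hB).mdifferentiableAt (by simp)
    have d3 := (hα.contMDiffAt_apply_field (hA.mlieBracket hB)).mdifferentiableAt (by simp)
    have d12 : MDifferentiableAt I 𝓘(ℝ, ℝ) (fun y ↦ mvfderiv I (fun z ↦ α z (B z)) y (A y)
      - mvfderiv I (fun z ↦ α z (A z)) y (B y)) x := d1.sub d2
    rw [mvfderiv_congr e, mvfderiv_fun_sub d12 d3, mvfderiv_fun_sub d1 d2]
    rfl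
  have key2 : ∀ A B : Π x : M, TangentSpace I x, ∀ C : Π x : M, TangentSpace I x,
      SmoothFieldAt I A x → SmoothFieldAt I B x → SmoothFieldAt I C x →
      Conification.extDerivOne I α x (mlieBracket I A B x) (C x) =
        mvfderiv I (fun y ↦ α y (C y)) x (mlieBracket I A B x)
        - mvfderiv I (fun y ↦ α y (mlieBracket I A B y)) x (C x)
        - α x (mlieBracket I (mlieBracket I A B) C x) := fun A B C hA hB hC ↦
    extDerivOne_apply I (hα.diffOneFormAt x) (hA.mlieBracket hB).diffFieldAt hC.diffFieldAt
  have key3 : ∀ A B C : Π x : M, TangentSpace I x,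
      SmoothFieldAt I A x → SmoothFieldAt I B x → SmoothFieldAt I C x →
      mvfderiv I (fun y ↦ α y (C y)) x (mlieBracket I A B x) =
        mvfderiv I (fun y ↦ mvfderiv I (fun z ↦ α z (C z)) y (B y)) x (A x)
        - mvfderiv I (fun y ↦ mvfderiv I (fun z ↦ α z (C z)) y (A y)) x (B x) :=
    fun A B C hA hB hC ↦ mvfderiv_mlieBracket ((hα.contMDiffAt_apply_field hC).of_le
      (WithTop.coe_le_coe.2 le_top)) hA.diffFieldAt hB.diffFieldAt
  have jac : mlieBracket I X (mlieBracket I Y W) x =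
      mlieBracket I (mlieBracket I X Y) W x + mlieBracket I Y (mlieBracket I X W) x := by
    refine leibniz_identity_mlieBracket_apply ?_ ?_ ?_ <;>
    · rw [minSmoothness_of_isRCLikeNormedField]
      first
      | exact hX.contMDiffAt (WithTop.coe_le_coe.2 le_top)
      | exact hY.contMDiffAt (WithTop.coe_le_coe.2 le_top)
      | exact hW.contMDiffAt (WithTop.coe_le_coe.2 le_top)
  -- all terms cancel but `α` of the double brackets, whose sum vanishes by the Jacobi identity
  have jac' := congrArg (α x) jac
  rw [map_add, mlieBracket_swap_apply (V := X), mlieBracket_swap_apply (V := Y), map_neg,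
    map_neg] at jac'
  rw [key Y W X hY hW, key X W Y hX hW, key X Y W hX hY, key2 X Y W hX hY hW, key2 X W Y hX hW hY,
    key2 Y W X hY hW hX, key3 X Y W hX hY hW, key3 X W Y hX hW hY, key3 Y W X hY hW hX]
  linarith

end Exterior

/-! ### The Levi-Civita connection of a pseudo-Riemannian metric -/

section LeviCivita

variable {E : Type*} [NormedAddCommGroup E] [NormedSpace ℝ E] [FiniteDimensional ℝ E]
  {H : Type*} [TopologicalSpace H] {I : ModelWithCorners ℝ E H}
  {M : Type*} [TopologicalSpace M] [ChartedSpace H M] [IsManifold I ∞ M]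
  {g : Π x : M, TangentSpace I x →L[ℝ] TangentSpace I x →L[ℝ] ℝ}

theorem IsPseudoRiemannian.isInvertible (hg : IsPseudoRiemannian I g) (x : M) :
    (g x).IsInvertible :=
  isInvertible_of_nondegenerate (E := E) (hg.nondegenerate x)

variable (I g) in
/-- The right-hand side of the Koszul formula for `2 g(D_X Y, W)`. -/
def koszul (Y : Π x : M, TangentSpace I x) (x : M) (X W : Π x : M, TangentSpace I x) : ℝ :=
  mvfderiv I (fun y ↦ g y (Y y) (W y)) x (X x) + mvfderiv I (fun y ↦ g y (X y) (W y)) x (Y x)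
    - mvfderiv I (fun y ↦ g y (X y) (Y y)) x (W x) + g x (mlieBracket I X Y x) (W x)
    - g x (mlieBracket I X W x) (Y x) - g x (mlieBracket I Y W x) (X x)

theorem koszul_tensorial_left (hg : IsPseudoRiemannian I g) {Y W : Π x : M, TangentSpace I x}
    {x : M} (hY : DiffFieldAt I Y x) (hW : DiffFieldAt I W x) :
    TensorialAt I E (fun X ↦ koszul I g Y x X W) x where
  smul {f X} hf hX := by
    have : CompleteSpace E := FiniteDimensional.complete ℝ E
    have hXW := hg.smooth.mdifferentiableAt_apply hX hW
    have hXY := hg.smooth.mdifferentiableAt_apply hX hY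
    have h1 : (fun y ↦ g y ((f • X) y) (W y)) = fun y ↦ f y * g y (X y) (W y) := by
      funext y; simp
    have h2 : (fun y ↦ g y ((f • X) y) (Y y)) = fun y ↦ f y * g y (X y) (Y y) := by
      funext y; simp
    simp only [koszul]
    rw [h1, h2, mvfderiv_fun_mul hf hXW, mvfderiv_fun_mul hf hXY, mlieBracket_smul_left hf hX,
      mlieBracket_smul_left hf hX]
    simp
    ring
  add {X X'} hX hX' := by
    have : CompleteSpace E := FiniteDimensional.complete ℝ E
    have h1 : (fun y ↦ g y ((X + X') y) (W y)) = fun y ↦ g y (X y) (W y) + g y (X' y) (W y) := by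
      funext y; simp
    have h2 : (fun y ↦ g y ((X + X') y) (Y y)) = fun y ↦ g y (X y) (Y y) + g y (X' y) (Y y) := by
      funext y; simp
    simp only [koszul]
    rw [h1, h2, mvfderiv_fun_add (hg.smooth.mdifferentiableAt_apply hX hW)
      (hg.smooth.mdifferentiableAt_apply hX' hW),
      mvfderiv_fun_add (hg.smooth.mdifferentiableAt_apply hX hY)
      (hg.smooth.mdifferentiableAt_apply hX' hY), mlieBracket_add_left hX hX',
      mlieBracket_add_left hX hX']
    simp
    ring

theorem koszul_tensorial_right (hg : IsPseudoRiemannian I g) {Y X : Π x : M, TangentSpace I x}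
    {x : M} (hY : DiffFieldAt I Y x) (hX : DiffFieldAt I X x) :
    TensorialAt I E (koszul I g Y x X) x where
  smul {f W} hf hW := by
    have : CompleteSpace E := FiniteDimensional.complete ℝ E
    have h1 : (fun y ↦ g y (Y y) ((f • W) y)) = fun y ↦ f y * g y (Y y) (W y) := by
      funext y; simp
    have h2 : (fun y ↦ g y (X y) ((f • W) y)) = fun y ↦ f y * g y (X y) (W y) := by
      funext y; simp
    simp only [koszul]
    rw [h1, h2, mvfderiv_fun_mul hf (hg.smooth.mdifferentiableAt_apply hY hW),
      mvfderiv_fun_mul hf (hg.smooth.mdifferentiableAt_apply hX hW), mlieBracket_smul_right hf hW,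
      mlieBracket_smul_right hf hW]
    simp [hg.symm x (W x)]
    ring
  add {W W'} hW hW' := by
    have : CompleteSpace E := FiniteDimensional.complete ℝ E
    have h1 : (fun y ↦ g y (Y y) ((W + W') y)) = fun y ↦ g y (Y y) (W y) + g y (Y y) (W' y) := by
      funext y; simp
    have h2 : (fun y ↦ g y (X y) ((W + W') y)) = fun y ↦ g y (X y) (W y) + g y (X y) (W' y) := by
      funext y; simp
    simp only [koszul]
    rw [h1, h2, mvfderiv_fun_add (hg.smooth.mdifferentiableAt_apply hY hW)
      (hg.smooth.mdifferentiableAt_apply hY hW'),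
      mvfderiv_fun_add (hg.smooth.mdifferentiableAt_apply hX hW)
      (hg.smooth.mdifferentiableAt_apply hX hW'), mlieBracket_add_right hW hW',
      mlieBracket_add_right hW hW']
    simp
    ring

theorem koszul_add (hg : IsPseudoRiemannian I g) {Y Y' X W : Π x : M, TangentSpace I x}
    {x : M} (hY : DiffFieldAt I Y x) (hY' : DiffFieldAt I Y' x) (hX : DiffFieldAt I X x)
    (hW : DiffFieldAt I W x) :
    koszul I g (Y + Y') x X W = koszul I g Y x X W + koszul I g Y' x X W := by
  have : CompleteSpace E := FiniteDimensional.complete ℝ E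
  have h1 : (fun y ↦ g y ((Y + Y') y) (W y)) = fun y ↦ g y (Y y) (W y) + g y (Y' y) (W y) := by
    funext y; simp
  have h2 : (fun y ↦ g y (X y) ((Y + Y') y)) = fun y ↦ g y (X y) (Y y) + g y (X y) (Y' y) := by
    funext y; simp
  simp only [koszul]
  rw [h1, h2, mvfderiv_fun_add (hg.smooth.mdifferentiableAt_apply hY hW)
    (hg.smooth.mdifferentiableAt_apply hY' hW),
    mvfderiv_fun_add (hg.smooth.mdifferentiableAt_apply hX hY)
    (hg.smooth.mdifferentiableAt_apply hX hY'), mlieBracket_add_right hY hY',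
    mlieBracket_add_left hY hY']
  simp
  ring

/-- The Leibniz rule for the right-hand side of the Koszul formula, including the factor `2`. -/
theorem koszul_smul (hg : IsPseudoRiemannian I g) {Y X W : Π x : M, TangentSpace I x} {f : M → ℝ}
    {x : M} (hf : MDifferentiableAt I 𝓘(ℝ, ℝ) f x) (hY : DiffFieldAt I Y x)
    (hX : DiffFieldAt I X x) (hW : DiffFieldAt I W x) :
    koszul I g (f • Y) x X W =
      f x * koszul I g Y x X W + 2 * (mvfderiv I f x (X x) * g x (Y x) (W x)) := by
  have : CompleteSpace E := FiniteDimensional.complete ℝ E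
  have h1 : (fun y ↦ g y ((f • Y) y) (W y)) = fun y ↦ f y * g y (Y y) (W y) := by
    funext y; simp
  have h2 : (fun y ↦ g y (X y) ((f • Y) y)) = fun y ↦ f y * g y (X y) (Y y) := by
    funext y; simp
  simp only [koszul]
  rw [h1, h2, mvfderiv_fun_mul hf (hg.smooth.mdifferentiableAt_apply hY hW),
    mvfderiv_fun_mul hf (hg.smooth.mdifferentiableAt_apply hX hY), mlieBracket_smul_right hf hY,
    mlieBracket_smul_left hf hY]
  simp [hg.symm x (Y x) (X x)]
  ring

/-- The bilinear form `(v, w) ↦ 2 g(D_v Y, w)`. -/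
def koszulForm (hg : IsPseudoRiemannian I g) (Y : Π x : M, TangentSpace I x) (x : M)
    (hY : DiffFieldAt I Y x) : TangentSpace I x →L[ℝ] TangentSpace I x →L[ℝ] ℝ :=
  TensorialAt.mkHom₂ (koszul I g Y x) x
    (fun _ hW ↦ koszul_tensorial_left hg hY hW) (fun _ hX ↦ koszul_tensorial_right hg hY hX)

theorem koszulForm_apply (hg : IsPseudoRiemannian I g) {Y X W : Π x : M, TangentSpace I x} {x : M}
    (hY : DiffFieldAt I Y x) (hX : DiffFieldAt I X x) (hW : DiffFieldAt I W x) :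
    koszulForm hg Y x hY (X x) (W x) = koszul I g Y x X W :=
  TensorialAt.mkHom₂_apply _ _ hX hW

open Classical in
/-- The Levi-Civita connection of `g` as an operator on vector fields; at a point where the field is
not differentiable the value is `0`. -/
def leviCivitaFun (hg : IsPseudoRiemannian I g) (Y : Π x : M, TangentSpace I x) (x : M) :
    TangentSpace I x →L[ℝ] TangentSpace I x :=
  if hY : DiffFieldAt I Y x then (1 / 2 : ℝ) • (g x).inverse.comp (koszulForm hg Y x hY) else 0

theorem leviCivitaFun_apply (hg : IsPseudoRiemannian I g) {Y X W : Π x : M, TangentSpace I x}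
    {x : M} (hY : DiffFieldAt I Y x) (hX : DiffFieldAt I X x) (hW : DiffFieldAt I W x) :
    2 * g x (leviCivitaFun hg Y x (X x)) (W x) = koszul I g Y x X W := by
  rw [leviCivitaFun, dif_pos hY, smul_apply, ContinuousLinearMap.comp_apply, map_smul,
    (hg.isInvertible x).self_apply_inverse, smul_apply, koszulForm_apply hg hY hX hW, smul_eq_mul]
  ring

/-- Tangent vectors are equal if they have the same products with all smooth fields. -/
theorem IsPseudoRiemannian.ext (hg : IsPseudoRiemannian I g) {x : M} {u v : TangentSpace I x}
    (h : ∀ W : Π x : M, TangentSpace I x, SmoothFieldAt I W x → g x u (W x) = g x v (W x)) :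
    u = v := by
  rw [← sub_eq_zero]
  refine hg.nondegenerate x _ fun w ↦ ?_
  obtain ⟨W, hW, rfl⟩ := exists_smoothFieldAt x w
  rw [map_sub, sub_apply, h W hW, sub_self]

/-- The Levi-Civita connection of a pseudo-Riemannian metric. -/
def leviCivita (hg : IsPseudoRiemannian I g) :
    CovariantDerivative I E (TangentSpace I : M → Type _) where
  toFun := leviCivitaFun hg
  isCovariantDerivativeOnUniv := by
    constructor
    · intro Y Y' x hY hY' _
      ext v
      obtain ⟨X, hX, rfl⟩ := exists_smoothFieldAt x v
      refine hg.ext fun W hW ↦ ?_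
      have hadd : DiffFieldAt I (Y + Y') x := mdifferentiableAt_add_section hY hY'
      have h1 := leviCivitaFun_apply hg hadd hX.diffFieldAt hW.diffFieldAt
      have h2 := leviCivitaFun_apply hg hY hX.diffFieldAt hW.diffFieldAt
      have h3 := leviCivitaFun_apply hg hY' hX.diffFieldAt hW.diffFieldAt
      rw [koszul_add hg hY hY' hX.diffFieldAt hW.diffFieldAt] at h1
      rw [add_apply, map_add, add_apply]
      linarith
    · intro Y f x hY hf _
      ext v
      obtain ⟨X, hX, rfl⟩ := exists_smoothFieldAt x v
      refine hg.ext fun W hW ↦ ?_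
      have hmul : DiffFieldAt I (f • Y) x := hf.smul_section hY
      have h1 := leviCivitaFun_apply hg hmul hX.diffFieldAt hW.diffFieldAt
      have h2 := leviCivitaFun_apply hg hY hX.diffFieldAt hW.diffFieldAt
      rw [koszul_smul hg hf hY hX.diffFieldAt hW.diffFieldAt] at h1
      rw [add_apply, map_add, add_apply, smul_apply, map_smul, smul_apply,
        ContinuousLinearMap.smulRight_apply, map_smul, smul_apply, smul_eq_mul, smul_eq_mul]
      linear_combination h1 / 2 - f x * h2 / 2

theorem leviCivita_apply (hg : IsPseudoRiemannian I g) {Y X W : Π x : M, TangentSpace I x}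
    {x : M} (hY : DiffFieldAt I Y x) (hX : DiffFieldAt I X x) (hW : DiffFieldAt I W x) :
    2 * g x (leviCivita hg Y x (X x)) (W x) = koszul I g Y x X W :=
  leviCivitaFun_apply hg hY hX hW

theorem isLeviCivita_leviCivita (hg : IsPseudoRiemannian I g) :
    IsLeviCivita I g (leviCivita hg) where
  torsion_eq_zero := by
    have : CompleteSpace E := FiniteDimensional.complete ℝ E
    funext x
    ext u v
    obtain ⟨X, hX, rfl⟩ := exists_smoothFieldAt x u
    obtain ⟨Y, hY, rfl⟩ := exists_smoothFieldAt x v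
    refine hg.ext fun W hW ↦ ?_
    have h1 := leviCivita_apply hg hY.diffFieldAt hX.diffFieldAt hW.diffFieldAt
    have h2 := leviCivita_apply hg hX.diffFieldAt hY.diffFieldAt hW.diffFieldAt
    have h3 := IsCovariantDerivativeOn.torsion_apply
      (leviCivita hg).isCovariantDerivativeOnUniv hX.diffFieldAt hY.diffFieldAt
    have h4 : (leviCivita hg).torsion x (X x) (Y x) = leviCivita hg Y x (X x)
      - leviCivita hg X x (Y x) - mlieBracket I X Y x := h3
    rw [h4]
    simp only [koszul] at h1 h2
    have e : (fun y ↦ g y (X y) (Y y)) = fun y ↦ g y (Y y) (X y) := by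
      funext y; exact hg.symm y _ _
    rw [e] at h1
    rw [mlieBracket_swap_apply (V := Y) (W := X)] at h2
    simp at h2 ⊢
    linarith
  metric x v X Y hX hY := by
    obtain ⟨W, hW, rfl⟩ := exists_smoothFieldAt x v
    have h1 := leviCivita_apply hg hX hW.diffFieldAt hY
    have h2 := leviCivita_apply hg hY hW.diffFieldAt hX
    rw [hg.symm x (X x)]
    simp only [koszul] at h1 h2
    have e : (fun y ↦ g y (Y y) (X y)) = fun y ↦ g y (X y) (Y y) := by
      funext y; exact hg.symm y _ _
    rw [e] at h2
    rw [mlieBracket_swap_apply (V := Y) (W := X)] at h2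
    simp at h2
    linarith

end LeviCivita

/-! ### Submersions with a vertical coframe -/

section Lifts

variable {E : Type*} [NormedAddCommGroup E] [NormedSpace ℝ E] [FiniteDimensional ℝ E]
  {H : Type*} [TopologicalSpace H] {I : ModelWithCorners ℝ E H}
  {M : Type*} [TopologicalSpace M] [ChartedSpace H M] [IsManifold I ∞ M]
  {E' : Type*} [NormedAddCommGroup E'] [NormedSpace ℝ E'] [FiniteDimensional ℝ E']
  {H' : Type*} [TopologicalSpace H'] {I' : ModelWithCorners ℝ E' H'}
  {N : Type*} [TopologicalSpace N] [ChartedSpace H' N] [IsManifold I' ∞ N]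
  {W : Type*} [NormedAddCommGroup W] [NormedSpace ℝ W] [FiniteDimensional ℝ W]
  {φ : N → M}

/-- The chain rule for functions with values in a vector space. -/
theorem mvfderiv_comp_mfderiv {F : Type*} [NormedAddCommGroup F] [NormedSpace ℝ F] {h : M → F}
    {q : N} (hh : MDifferentiableAt I 𝓘(ℝ, F) h (φ q)) (hφ : MDifferentiableAt I' I φ q)
    (v : TangentSpace I' q) :
    mvfderiv I' (fun y ↦ h (φ y)) q v = mvfderiv I h (φ q) (mfderiv I' I φ q v) :=
  mfderiv_comp_apply q hh hφ v

theorem mvfderiv_extChartAt_injective {x y : M} (hy : y ∈ (extChartAt I x).source) :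
    Function.Injective (mvfderiv I (extChartAt I x) y) := by
  obtain ⟨e, he⟩ := isInvertible_mfderiv_extChartAt (I := I) hy
  intro u v huv
  have : mfderiv I 𝓘(ℝ, E) (extChartAt I x) y u = mfderiv I 𝓘(ℝ, E) (extChartAt I x) y v := huv
  rw [← he] at this
  exact e.injective this

theorem contMDiffAt_extChartAt_of_mem {x y : M} (hy : y ∈ (extChartAt I x).source) :
    ContMDiffAt I 𝓘(ℝ, E) ∞ (extChartAt I x) y :=
  contMDiffAt_extChartAt' (by rwa [← extChartAt_source I])

/-- The bracket of `φ`-related vector fields is `φ`-related to the bracket. -/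
theorem mfderiv_mlieBracket_of_related [I.Boundaryless] [I'.Boundaryless] {q : N}
    (hφ : ContMDiff I' I ∞ φ) {V₁ V₂ : Π q : N, TangentSpace I' q}
    {X₁ X₂ : Π x : M, TangentSpace I x} (hV₁ : DiffFieldAt I' V₁ q) (hV₂ : DiffFieldAt I' V₂ q)
    (hX₁ : SmoothFieldAt I X₁ (φ q)) (hX₂ : SmoothFieldAt I X₂ (φ q))
    (h₁ : ∀ᶠ y in 𝓝 q, mfderiv I' I φ y (V₁ y) = X₁ (φ y))
    (h₂ : ∀ᶠ y in 𝓝 q, mfderiv I' I φ y (V₂ y) = X₂ (φ y)) :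
    mfderiv I' I φ q (mlieBracket I' V₁ V₂ q) = mlieBracket I X₁ X₂ (φ q) := by
  have hs := mem_extChartAt_source (I := I) (φ q)
  -- both sides are compared as derivations of the chart `ψ`, a vector-valued function
  apply mvfderiv_extChartAt_injective hs
  set ψ := extChartAt I (φ q) with hψ
  have hψs := contMDiffAt_extChartAt_of_mem (I := I) hs
  have hφd : ∀ y, MDifferentiableAt I' I φ y := fun y ↦ (hφ y).mdifferentiableAt (by simp)
  have hcomp : ContMDiffAt I' 𝓘(ℝ, E) ∞ (fun y ↦ ψ (φ y)) q := hψs.comp q (hφ q)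
  have h2 : (2 : WithTop ℕ∞) ≤ ∞ := WithTop.coe_le_coe.2 le_top
  have hev : ∀ᶠ y in 𝓝 q, φ y ∈ ψ.source :=
    (hφ.continuous.continuousAt (x := q)).eventually (extChartAt_source_mem_nhds (I := I) (φ q))
  have key : ∀ (V : Π q : N, TangentSpace I' q) (X : Π x : M, TangentSpace I x)
      (V' : Π q : N, TangentSpace I' q) (X' : Π x : M, TangentSpace I x),
      SmoothFieldAt I X (φ q) →
      (∀ᶠ y in 𝓝 q, mfderiv I' I φ y (V y) = X (φ y)) →
      (∀ᶠ y in 𝓝 q, mfderiv I' I φ y (V' y) = X' (φ y)) →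
      mvfderiv I' (fun y ↦ mvfderiv I' (fun z ↦ ψ (φ z)) y (V y)) q (V' q) =
        mvfderiv I (fun x ↦ mvfderiv I ψ x (X x)) (φ q) (X' (φ q)) := by
    intro V X V' X' hX hV hV'
    have e : (fun y ↦ mvfderiv I' (fun z ↦ ψ (φ z)) y (V y)) =ᶠ[𝓝 q]
        fun y ↦ (fun x ↦ mvfderiv I ψ x (X x)) (φ y) := by
      filter_upwards [hev, hV] with y hy hVy
      rw [mvfderiv_comp_mfderiv ((contMDiffAt_extChartAt_of_mem hy).mdifferentiableAt (by simp))
        (hφd y), hVy]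
    have hd : MDifferentiableAt I 𝓘(ℝ, E) (fun x ↦ mvfderiv I ψ x (X x)) (φ q) :=
      (contMDiffAt_mvfderiv_apply hψs le_rfl hX).mdifferentiableAt (by simp)
    rw [mvfderiv_congr e, mvfderiv_comp_mfderiv hd (hφd q), hV'.self_of_nhds]
  rw [← mvfderiv_comp_mfderiv (hψs.mdifferentiableAt (by simp)) (hφd q),
    mvfderiv_mlieBracket (hcomp.of_le h2) hV₁ hV₂,
    mvfderiv_mlieBracket (hψs.of_le h2) hX₁.diffFieldAt hX₂.diffFieldAt,
    key V₂ X₂ V₁ X₁ hX₂ h₂ h₁, key V₁ X₁ V₂ X₂ hX₁ h₁ h₂]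

variable (I I') in
/-- The one-form `lam` with values in a fixed vector space restricts to isomorphisms on the kernels
of the differential of the submersion `φ`, so that `(dφ, lam)` identifies the tangent space at `q`
with the product of the tangent space at `φ q` and a fixed vector space. -/
structure IsVerticalCoframe (φ : N → M) (lam : Π q : N, TangentSpace I' q →L[ℝ] W) : Prop where
  contMDiff : ContMDiff I' I ∞ φ
  smooth : ∀ (q : N) (V : Π q : N, TangentSpace I' q), SmoothFieldAt I' V q →
    ContMDiffAt I' 𝓘(ℝ, W) ∞ (fun y ↦ lam y (V y)) q
  injective : ∀ (q : N) (v : TangentSpace I' q), mfderiv I' I φ q v = 0 → lam q v = 0 → v = 0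
  surjective : ∀ (q : N) (u : TangentSpace I (φ q)) (c : W),
    ∃ v : TangentSpace I' q, mfderiv I' I φ q v = u ∧ lam q v = c

variable {lam : Π q : N, TangentSpace I' q →L[ℝ] W}

theorem IsVerticalCoframe.ext (h : IsVerticalCoframe I I' φ lam) {q : N} {v w : TangentSpace I' q}
    (h1 : mfderiv I' I φ q v = mfderiv I' I φ q w) (h2 : lam q v = lam q w) : v = w := by
  rw [← sub_eq_zero]
  exact h.injective q _ (by rw [map_sub, h1, sub_self]) (by rw [map_sub, h2, sub_self])

theorem IsVerticalCoframe.finrank_eq (h : IsVerticalCoframe I I' φ lam) (q : N) :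
    Module.finrank ℝ E' = Module.finrank ℝ (E × W) := by
  let L : E' →ₗ[ℝ] E × W :=
    ((mfderiv I' I φ q : E' →L[ℝ] E).prod (lam q : E' →L[ℝ] W)).toLinearMap
  refine (LinearEquiv.ofBijective L ⟨?_, ?_⟩).finrank_eq
  · intro v w hvw
    exact h.ext (q := q) (congrArg Prod.fst hvw) (congrArg Prod.snd hvw)
  · rintro ⟨u, c⟩
    obtain ⟨v, hv, hv'⟩ := h.surjective q u c
    exact ⟨v, Prod.ext hv hv'⟩

/-- A lift `V` of the vector field `X` with prescribed vertical components `c`. It is smooth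
wherever `X` and `c` are, because in a chart of `M` it solves a linear system with smooth coefficients. -/
theorem IsVerticalCoframe.exists_lift (h : IsVerticalCoframe I I' φ lam)
    (X : Π x : M, TangentSpace I x) (c : N → W) :
    ∃ V : Π q : N, TangentSpace I' q, (∀ q, mfderiv I' I φ q (V q) = X (φ q)) ∧
      (∀ q, lam q (V q) = c q) ∧
      ∀ q, SmoothFieldAt I X (φ q) → ContMDiffAt I' 𝓘(ℝ, W) ∞ c q → SmoothFieldAt I' V q := by
  choose V hV hV' using fun q ↦ h.surjective q (X (φ q)) (c q)
  refine ⟨V, hV, hV', fun q hX hc ↦ ?_⟩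
  have hs := mem_extChartAt_source (I := I) (φ q)
  set ψ := extChartAt I (φ q) with hψ
  have hψs := contMDiffAt_extChartAt_of_mem (I := I) hs
  have hφd : ∀ y, MDifferentiableAt I' I φ y := fun y ↦
    (h.contMDiff y).mdifferentiableAt (by simp)
  have hcomp : ContMDiffAt I' 𝓘(ℝ, E) ∞ (fun y ↦ ψ (φ y)) q := hψs.comp q (h.contMDiff q)
  have hev : ∀ᶠ y in 𝓝 q, φ y ∈ ψ.source :=
    (h.contMDiff.continuous.continuousAt (x := q)).eventually
      (extChartAt_source_mem_nhds (I := I) (φ q))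
  -- `V` is the preimage of a smooth map under the field of isomorphisms `A`
  let A : Π y : N, TangentSpace I' y →L[ℝ] E × W := fun y ↦
    (mvfderiv I' (fun z ↦ ψ (φ z)) y).prod (lam y)
  have hA : ∀ y, φ y ∈ ψ.source → Function.Injective (A y) := by
    intro y hy v w hvw
    have h1 : mvfderiv I' (fun z ↦ ψ (φ z)) y v = mvfderiv I' (fun z ↦ ψ (φ z)) y w :=
      congrArg Prod.fst hvw
    have hd := (contMDiffAt_extChartAt_of_mem hy).mdifferentiableAt (by simp)
    rw [mvfderiv_comp_mfderiv hd (hφd y), mvfderiv_comp_mfderiv hd (hφd y)] at h1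
    exact h.ext (mvfderiv_extChartAt_injective hy h1) (congrArg Prod.snd hvw)
  have hinv : ∀ y, φ y ∈ ψ.source → (A y).IsInvertible := fun y hy ↦
    isInvertible_of_injective_of_finrank_eq (V := E') (hA y hy) (h.finrank_eq y)
  have hVs := contMDiffAt_inverse_apply_const (I := I') (A := A) (x := q)
    (c := fun y ↦ (mvfderiv I ψ (φ y) (X (φ y)), c y))
    (fun Y hY ↦ (contMDiffAt_mvfderiv_apply hcomp le_rfl hY).prodMk_space (h.smooth q Y hY))
    (hev.mono hinv)
    (((contMDiffAt_mvfderiv_apply hψs le_rfl hX).comp q (h.contMDiff q)).prodMk_space hc)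
  refine ContMDiffAt.congr_of_eventuallyEq hVs ?_
  filter_upwards [hev] with y hy
  congr 1
  have hd := (contMDiffAt_extChartAt_of_mem hy).mdifferentiableAt (by simp)
  have e : (mvfderiv I ψ (φ y) (X (φ y)), c y) = A y (V y) :=
    Prod.ext (by rw [← hV y]; exact (mvfderiv_comp_mfderiv hd (hφd y) (V y)).symm) (hV' y).symm
  rw [e, (hinv y hy).inverse_apply_self]

end Lifts

/-! ### Pullback of the exterior derivative -/

section Pullback

variable {E : Type*} [NormedAddCommGroup E] [NormedSpace ℝ E] [FiniteDimensional ℝ E]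
  {H : Type*} [TopologicalSpace H] {I : ModelWithCorners ℝ E H}
  {M : Type*} [TopologicalSpace M] [ChartedSpace H M] [IsManifold I ∞ M]
  {E' : Type*} [NormedAddCommGroup E'] [NormedSpace ℝ E'] [FiniteDimensional ℝ E']
  {H' : Type*} [TopologicalSpace H'] {I' : ModelWithCorners ℝ E' H'}
  {N : Type*} [TopologicalSpace N] [ChartedSpace H' N] [IsManifold I' ∞ N]
  {W : Type*} [NormedAddCommGroup W] [NormedSpace ℝ W] [FiniteDimensional ℝ W]
  {φ : N → M} {lam : Π q : N, TangentSpace I' q →L[ℝ] W}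

theorem SmoothOneForm.pullback {α : Π x : M, TangentSpace I x →L[ℝ] ℝ} (hα : SmoothOneForm I α)
    (hφ : ContMDiff I' I ∞ φ) :
    SmoothOneForm I' (fun q ↦ (α (φ q)).comp (mfderiv I' I φ q)) :=
  smoothOneForm_of_apply fun q _ hV ↦
    hα.contMDiffAt_apply (hφ q) le_rfl (contMDiffAt_mfderiv_apply (hφ q) le_rfl hV)

/-- A lift whose value at one point is prescribed, with constant vertical part. -/
theorem IsVerticalCoframe.exists_lift_eq (h : IsVerticalCoframe I I' φ lam) {q : N}
    (v : TangentSpace I' q) :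
    ∃ (X : Π x : M, TangentSpace I x) (V : Π q : N, TangentSpace I' q),
      SmoothFieldAt I X (φ q) ∧ SmoothFieldAt I' V q ∧ V q = v ∧
      (∀ y, mfderiv I' I φ y (V y) = X (φ y)) ∧ ∀ y, lam y (V y) = lam q v := by
  obtain ⟨X, hX, hXv⟩ := exists_smoothFieldAt (I := I) (φ q) (mfderiv I' I φ q v)
  obtain ⟨V, hV, hV', hVs⟩ := h.exists_lift X (fun _ ↦ lam q v)
  exact ⟨X, V, hX, hVs q hX contMDiffAt_const, h.ext ((hV q).trans hXv) (hV' q), hV, hV'⟩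

/-- The exterior derivative commutes with the pullback along `φ`. -/
theorem IsVerticalCoframe.extDerivOne_pullback [I.Boundaryless] [I'.Boundaryless]
    (h : IsVerticalCoframe I I' φ lam)
    {α : Π x : M, TangentSpace I x →L[ℝ] ℝ} (hα : SmoothOneForm I α) (q : N)
    (u v : TangentSpace I' q) :
    extDerivOne I' (fun q ↦ (α (φ q)).comp (mfderiv I' I φ q)) q u v =
      extDerivOne I α (φ q) (mfderiv I' I φ q u) (mfderiv I' I φ q v) := by
  obtain ⟨X, U, hX, hU, rfl, hUX, -⟩ := h.exists_lift_eq u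
  obtain ⟨Y, V, hY, hV, rfl, hVY, -⟩ := h.exists_lift_eq v
  have hφd := (h.contMDiff q).mdifferentiableAt (by simp)
  rw [extDerivOne_apply I' ((hα.pullback h.contMDiff).diffOneFormAt q) hU.diffFieldAt
    hV.diffFieldAt, hUX, hVY, extDerivOne_apply I (hα.diffOneFormAt _) hX.diffFieldAt
    hY.diffFieldAt]
  have e1 : (fun y ↦ ((α (φ y)).comp (mfderiv I' I φ y)) (V y)) = fun y ↦
      (fun x ↦ α x (Y x)) (φ y) := by
    funext y; exact congrArg (α (φ y)) (hVY y)
  have e2 : (fun y ↦ ((α (φ y)).comp (mfderiv I' I φ y)) (U y)) = fun y ↦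
      (fun x ↦ α x (X x)) (φ y) := by
    funext y; exact congrArg (α (φ y)) (hUX y)
  rw [e1, e2, mvfderiv_comp_mfderiv ((hα.contMDiffAt_apply_field hY).mdifferentiableAt (by simp))
    hφd, mvfderiv_comp_mfderiv ((hα.contMDiffAt_apply_field hX).mdifferentiableAt (by simp)) hφd,
    hUX, hVY, ContinuousLinearMap.comp_apply, mfderiv_mlieBracket_of_related h.contMDiff
    hU.diffFieldAt hV.diffFieldAt hX hY (Eventually.of_forall hUX) (Eventually.of_forall hVY)]

end Pullback

/-! ### Hamiltonian Killing fields on pseudo-Kähler manifolds -/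

section Hamiltonian

variable {E : Type*} [NormedAddCommGroup E] [NormedSpace ℝ E] [FiniteDimensional ℝ E]
  {H : Type*} [TopologicalSpace H] {I : ModelWithCorners ℝ E H}
  {M : Type*} [TopologicalSpace M] [ChartedSpace H M] [IsManifold I ∞ M]
  {g : Π x : M, TangentSpace I x →L[ℝ] TangentSpace I x →L[ℝ] ℝ}
  {J : Π x : M, TangentSpace I x →L[ℝ] TangentSpace I x}
  {Z : Π x : M, TangentSpace I x} {f : M → ℝ}

theorem IsPseudoRiemannian.smoothOneForm_betaForm (hg : IsPseudoRiemannian I g)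
    (hZ : ∀ x, SmoothFieldAt I Z x) : SmoothOneForm I (betaForm I g Z) :=
  smoothOneForm_of_apply fun x _ hX ↦
    hg.smooth.contMDiffAt_apply contMDiffAt_id le_rfl (hZ x) hX

section

variable (hK : IsPseudoKahler I g J)
  (hf' : ∀ x v, mvfderiv I f x v = - fundamentalForm I g J x (Z x) v)
include hK hf'

/-- The Hamiltonian condition in the form `β ∘ J = df`. -/
theorem betaForm_comp_eq_mvfderiv (x : M) (v : TangentSpace I x) :
    betaForm I g Z x (J x v) = mvfderiv I f x v := by
  have := hK.skew x (Z x) v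
  rw [hf']
  change g x (Z x) (J x v) = - g x (J x (Z x)) v
  rw [this, neg_neg]

theorem mvfderiv_comp_eq_neg_betaForm (x : M) (v : TangentSpace I x) :
    mvfderiv I f x (J x v) = - betaForm I g Z x v := by
  rw [← betaForm_comp_eq_mvfderiv hK hf', hK.sq_eq_neg, map_neg]

/-- As `β = - df ∘ J`, its exterior derivative is of type `(1, 1)`. -/
theorem extDerivOne_betaForm_comp [I.Boundaryless] (hf : ContMDiff I 𝓘(ℝ, ℝ) ∞ f)
    (hZ : ∀ x, SmoothFieldAt I Z x) (x : M) (u v : TangentSpace I x) :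
    extDerivOne I (betaForm I g Z) x (J x u) (J x v) = extDerivOne I (betaForm I g Z) x u v := by
  obtain ⟨X, hX, rfl⟩ := exists_smoothFieldAt x u
  obtain ⟨Y, hY, rfl⟩ := exists_smoothFieldAt x v
  have hJX := hK.smooth.diffFieldAt_apply hX.diffFieldAt
  have hJY := hK.smooth.diffFieldAt_apply hY.diffFieldAt
  have hβ := (hK.metric.smoothOneForm_betaForm hZ).diffOneFormAt x
  have hf2 : ContMDiffAt I 𝓘(ℝ, ℝ) 2 f x := (hf x).of_le (WithTop.coe_le_coe.2 le_top)
  have h1 := extDerivOne_apply I hβ hJX hJY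
  have h2 := extDerivOne_apply I hβ hX.diffFieldAt hY.diffFieldAt
  have h3 := congrArg (betaForm I g Z x) (hK.integrable x X Y hX hY)
  have h4 := mvfderiv_mlieBracket hf2 hJX hY.diffFieldAt
  have h5 := mvfderiv_mlieBracket hf2 hX.diffFieldAt hJY
  simp only [map_sub, betaForm_comp_eq_mvfderiv hK hf', mvfderiv_comp_eq_neg_betaForm hK hf',
    map_zero] at h1 h3 h4 h5
  have e : ∀ X : Π x : M, TangentSpace I x, mvfderiv I (fun y ↦ - betaForm I g Z y (X y)) x =
    - mvfderiv I (fun y ↦ betaForm I g Z y (X y)) x := fun X ↦ mvfderiv_fun_neg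
  rw [e, neg_apply] at h4 h5
  linarith

/-- A Hamiltonian Killing field is holomorphic. -/
theorem mlieBracket_comp_eq [I.Boundaryless] (hZ : IsKilling I g Z)
    (hf : ContMDiff I 𝓘(ℝ, ℝ) ∞ f) {x : M} {X : Π x : M, TangentSpace I x}
    (hX : SmoothFieldAt I X x) :
    mlieBracket I Z (fun y ↦ J y (X y)) x = J x (mlieBracket I Z X x) := by
  -- both `L_Z g = 0` and `L_Z ω = 0` hold, the latter by Cartan's formula as `ω` is closed and
  -- the contraction of `ω` with `Z` is exact
  refine hK.metric.ext fun Y hY ↦ ?_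
  have hJX : SmoothFieldAt I (fun y ↦ J y (X y)) x := hK.smooth.contMDiffAt_apply le_rfl hX
  have h1 := hZ.lie_eq_zero x _ Y hJX hY
  have h2 := hK.closed x Z X Y (hZ.smooth x) hX hY
  have hf2 : ContMDiffAt I 𝓘(ℝ, ℝ) 2 f x := (hf x).of_le (WithTop.coe_le_coe.2 le_top)
  have h3 := mvfderiv_mlieBracket hf2 hX.diffFieldAt hY.diffFieldAt
  have e : ∀ X : Π x : M, TangentSpace I x,
      mvfderiv I (fun y ↦ fundamentalForm I g J y (Z y) (X y)) x =
        - mvfderiv I (fun y ↦ mvfderiv I f y (X y)) x := by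
    intro X
    rw [← mvfderiv_fun_neg]
    congr 1
    funext y
    rw [hf', neg_neg]
  have h4 : fundamentalForm I g J x (mlieBracket I X Y x) (Z x) =
      mvfderiv I f x (mlieBracket I X Y x) := by
    rw [hf']
    change g x (J x _) (Z x) = - g x (J x (Z x)) _
    rw [hK.skew, hK.metric.symm x (J x (Z x))]
  rw [e, e, neg_apply, neg_apply, h4, h3] at h2
  change mvfderiv I (fun y ↦ g y (J y (X y)) (Y y)) x (Z x) - _ + _ -
    g x (J x (mlieBracket I Z X x)) (Y x) + g x (J x (mlieBracket I Z Y x)) (X x) - _ = 0 at h2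
  rw [hK.skew x (mlieBracket I Z Y x), hK.metric.symm x (mlieBracket I Z Y x)] at h2
  linarith

/-- The curvature form `ω - dβ / 2` contracted with `Z` is `- df₁`. -/
theorem mvfderiv_fOne [I.Boundaryless] (hZ : IsKilling I g Z)
    (hf : ContMDiff I 𝓘(ℝ, ℝ) ∞ f) (x : M) (v : TangentSpace I x) :
    mvfderiv I (fOne I g Z f) x v =
      - (fundamentalForm I g J x - (1 / 2 : ℝ) • extDerivOne I (betaForm I g Z) x) (Z x) v := by
  obtain ⟨X, hX, rfl⟩ := exists_smoothFieldAt x v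
  have hβ := hK.metric.smoothOneForm_betaForm hZ.smooth
  have h1 := extDerivOne_apply I (hβ.diffOneFormAt x) (hZ.smooth x).diffFieldAt hX.diffFieldAt
  have h2 := hZ.lie_eq_zero x Z X (hZ.smooth x) hX
  have hd := (hβ.contMDiffAt_apply_field (hZ.smooth x)).mdifferentiableAt (by simp)
  have e : fOne I g Z f = fun x ↦ f x - (1 / 2 : ℝ) * betaForm I g Z x (Z x) := by
    funext y; simp only [fOne, betaForm]; ring
  have hd2 : MDifferentiableAt I 𝓘(ℝ, ℝ) (fun x ↦ (1 / 2 : ℝ) * betaForm I g Z x (Z x)) x :=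
    mdifferentiableAt_const.mul hd
  rw [e, mvfderiv_fun_sub ((hf x).mdifferentiableAt (by simp)) hd2,
    mvfderiv_fun_mul mdifferentiableAt_const hd]
  rw [mlieBracket_self] at h2
  change mvfderiv I (fun y ↦ betaForm I g Z y (X y)) x (Z x) - _ - betaForm I g Z x _ = 0 at h2
  simp [mvfderiv_const, hf', h1] at h2 ⊢
  linarith

end

end Hamiltonian

/-! ### The Nijenhuis tensor -/

section Nijenhuis

variable {E : Type*} [NormedAddCommGroup E] [NormedSpace ℝ E] [FiniteDimensional ℝ E]
  {H : Type*} [TopologicalSpace H] {I : ModelWithCorners ℝ E H}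
  {M : Type*} [TopologicalSpace M] [ChartedSpace H M] [IsManifold I ∞ M]
  {J : Π x : M, TangentSpace I x →L[ℝ] TangentSpace I x}

variable (I J) in
/-- The Nijenhuis tensor of `J` evaluated on two vector fields. -/
def nijenhuis (x : M) (X Y : Π x : M, TangentSpace I x) : TangentSpace I x :=
  mlieBracket I (fun y ↦ J y (X y)) (fun y ↦ J y (Y y)) x
    - J x (mlieBracket I (fun y ↦ J y (X y)) Y x)
    - J x (mlieBracket I X (fun y ↦ J y (Y y)) x)
    - mlieBracket I X Y x

theorem nijenhuis_swap (x : M) (X Y : Π x : M, TangentSpace I x) :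
    nijenhuis I J x X Y = - nijenhuis I J x Y X := by
  simp only [nijenhuis]
  rw [mlieBracket_swap_apply (V := fun y ↦ J y (X y)) (W := fun y ↦ J y (Y y)),
    mlieBracket_swap_apply (V := fun y ↦ J y (X y)) (W := Y),
    mlieBracket_swap_apply (V := X) (W := fun y ↦ J y (Y y)),
    mlieBracket_swap_apply (V := X) (W := Y), map_neg, map_neg]
  abel

variable (hJ : SmoothEndo I J) (hsq : ∀ (x : M) (v : TangentSpace I x), J x (J x v) = -v)
include hJ hsq

/-- In the Leibniz rule the derivatives of the factor cancel because of `J² = -1`. -/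
theorem nijenhuis_tensorial_right {X : Π x : M, TangentSpace I x} {x : M}
    (_ : DiffFieldAt I X x) : TensorialAt I E (nijenhuis I J x X) x where
  smul {f Y} hf hY := by
    have : CompleteSpace E := FiniteDimensional.complete ℝ E
    have hJY : DiffFieldAt I (fun y ↦ J y (Y y)) x := hJ.diffFieldAt_apply hY
    have h1 : (fun y ↦ J y ((f • Y) y)) = f • fun y ↦ J y (Y y) := by
      funext y; simp
    simp only [nijenhuis]
    rw [h1, mlieBracket_smul_right hf hY, mlieBracket_smul_right hf hY,
      mlieBracket_smul_right hf hJY, mlieBracket_smul_right hf hJY]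
    simp only [map_add, map_smul, hsq]
    module
  add {Y Y'} hY hY' := by
    have : CompleteSpace E := FiniteDimensional.complete ℝ E
    have hJY : DiffFieldAt I (fun y ↦ J y (Y y)) x := hJ.diffFieldAt_apply hY
    have hJY' : DiffFieldAt I (fun y ↦ J y (Y' y)) x := hJ.diffFieldAt_apply hY'
    have h1 : (fun y ↦ J y ((Y + Y') y)) = (fun y ↦ J y (Y y)) + fun y ↦ J y (Y' y) := by
      funext y; simp
    simp only [nijenhuis]
    rw [h1, mlieBracket_add_right hY hY', mlieBracket_add_right hY hY',
      mlieBracket_add_right hJY hJY', mlieBracket_add_right hJY hJY']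
    simp only [map_add]
    module

theorem nijenhuis_tensorial_left {Y : Π x : M, TangentSpace I x} {x : M}
    (hY : DiffFieldAt I Y x) : TensorialAt I E (fun X ↦ nijenhuis I J x X Y) x where
  smul {f X} hf hX := by
    simp only [nijenhuis_swap x _ Y, (nijenhuis_tensorial_right hJ hsq hY).smul hf hX, smul_neg]
  add {X X'} hX hX' := by
    simp only [nijenhuis_swap x _ Y, (nijenhuis_tensorial_right hJ hsq hY).add hX hX', neg_add]

/-- The Nijenhuis tensor of an almost complex structure as a bilinear map on the tangent space. -/
def nijenhuisForm (x : M) : TangentSpace I x →L[ℝ] TangentSpace I x →L[ℝ] TangentSpace I x :=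
  TensorialAt.mkHom₂ (nijenhuis I J x) x
    (fun _ hY ↦ nijenhuis_tensorial_left hJ hsq hY)
    (fun _ hX ↦ nijenhuis_tensorial_right hJ hsq hX)

theorem nijenhuisForm_apply {x : M} {X Y : Π x : M, TangentSpace I x}
    (hX : DiffFieldAt I X x) (hY : DiffFieldAt I Y x) :
    nijenhuisForm hJ hsq x (X x) (Y x) = nijenhuis I J x X Y :=
  TensorialAt.mkHom₂_apply _ _ hX hY

theorem nijenhuisForm_swap (x : M) (u v : TangentSpace I x) :
    nijenhuisForm hJ hsq x u v = - nijenhuisForm hJ hsq x v u := by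
  obtain ⟨X, hX, rfl⟩ := exists_smoothFieldAt x u
  obtain ⟨Y, hY, rfl⟩ := exists_smoothFieldAt x v
  rw [nijenhuisForm_apply hJ hsq hX.diffFieldAt hY.diffFieldAt,
    nijenhuisForm_apply hJ hsq hY.diffFieldAt hX.diffFieldAt, nijenhuis_swap]

/-- The Nijenhuis tensor is complex antilinear. -/
theorem nijenhuisForm_comp (x : M) (u v : TangentSpace I x) :
    nijenhuisForm hJ hsq x (J x u) v = - J x (nijenhuisForm hJ hsq x u v) := by
  have : CompleteSpace E := FiniteDimensional.complete ℝ E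
  obtain ⟨X, hX, rfl⟩ := exists_smoothFieldAt x u
  obtain ⟨Y, hY, rfl⟩ := exists_smoothFieldAt x v
  have hJX := hJ.diffFieldAt_apply hX.diffFieldAt
  rw [nijenhuisForm_apply hJ hsq hX.diffFieldAt hY.diffFieldAt]
  refine (nijenhuisForm_apply hJ hsq hJX hY.diffFieldAt).trans ?_
  have h1 : (fun y ↦ J y (J y (X y))) = (-1 : ℝ) • X := by
    funext y; simp [hsq]
  simp only [nijenhuis]
  rw [h1, mlieBracket_const_smul_left hX.diffFieldAt, mlieBracket_const_smul_left hX.diffFieldAt]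
  simp only [map_sub, map_smul, hsq]
  module

theorem isIntegrable_of_nijenhuisForm_eq_zero (h : ∀ x u v, nijenhuisForm hJ hsq x u v = 0) :
    IsIntegrable I J := fun x _ _ hX hY ↦
  (nijenhuisForm_apply hJ hsq hX.diffFieldAt hY.diffFieldAt).symm.trans (h x _ _)

end Nijenhuis

/-! ### The conification over a manifold with a vertical coframe -/

section Cone

variable {E : Type*} [NormedAddCommGroup E] [NormedSpace ℝ E] [FiniteDimensional ℝ E]
  {H : Type*} [TopologicalSpace H] {I : ModelWithCorners ℝ E H}
  {M : Type*} [TopologicalSpace M] [ChartedSpace H M] [IsManifold I ∞ M]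
  {E' : Type*} [NormedAddCommGroup E'] [NormedSpace ℝ E'] [FiniteDimensional ℝ E']
  {H' : Type*} [TopologicalSpace H'] {I' : ModelWithCorners ℝ E' H'}
  {N : Type*} [TopologicalSpace N] [ChartedSpace H' N] [IsManifold I' ∞ N]
  {g : Π x : M, TangentSpace I x →L[ℝ] TangentSpace I x →L[ℝ] ℝ}
  {J : Π x : M, TangentSpace I x →L[ℝ] TangentSpace I x}
  {Z : Π x : M, TangentSpace I x} {f : M → ℝ}
  {φ : N → M} {η : Π q : N, TangentSpace I' q →L[ℝ] ℝ} {t : N → ℝ}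
  {G : Π q : N, TangentSpace I' q →L[ℝ] TangentSpace I' q →L[ℝ] ℝ}
  {θ : Π q : N, TangentSpace I' q →L[ℝ] ℝ}

variable (I I') in
/-- The data of the conification, with the total space `P × ℝ` replaced by a manifold `N` over `M`
with a one-form `η` and a function `t` such that `(dφ, η, dt)` trivializes the tangent bundle of `N`
along the fibres. The metric `G` and the one-form `θ` are described by their values. -/
structure IsConification (g : Π x : M, TangentSpace I x →L[ℝ] TangentSpace I x →L[ℝ] ℝ)
    (J : Π x : M, TangentSpace I x →L[ℝ] TangentSpace I x)
    (Z : Π x : M, TangentSpace I x) (f : M → ℝ) (φ : N → M)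
    (η : Π q : N, TangentSpace I' q →L[ℝ] ℝ) (t : N → ℝ)
    (G : Π q : N, TangentSpace I' q →L[ℝ] TangentSpace I' q →L[ℝ] ℝ)
    (θ : Π q : N, TangentSpace I' q →L[ℝ] ℝ) : Prop where
  kahler : IsPseudoKahler I g J
  killing : IsKilling I g Z
  contMDiff_f : ContMDiff I 𝓘(ℝ, ℝ) ∞ f
  hamiltonian : ∀ x v, mvfderiv I f x v = - fundamentalForm I g J x (Z x) v
  f_ne_zero : ∀ x, f x ≠ 0
  fOne_ne_zero : ∀ x, fOne I g Z f x ≠ 0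
  coframe : IsVerticalCoframe I I' φ fun q ↦ (η q).prod (mvfderiv I' t q)
  smooth_eta : SmoothOneForm I' η
  contMDiff_t : ContMDiff I' 𝓘(ℝ, ℝ) ∞ t
  extDerivOne_eta : ∀ (q : N) (u v : TangentSpace I' q), extDerivOne I' η q u v =
    (fundamentalForm I g J (φ q) - (1 / 2 : ℝ) • extDerivOne I (betaForm I g Z) (φ q))
      (mfderiv I' I φ q u) (mfderiv I' I φ q v)
  metric_apply : ∀ (q : N) (u v : TangentSpace I' q), G q u v =
    Real.exp (2 * t q) * (2 / fOne I g Z f (φ q) * (η q u * η q v)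
      + g (φ q) (mfderiv I' I φ q u) (mfderiv I' I φ q v)
      + 2 * f (φ q) * (mvfderiv I' t q u * mvfderiv I' t q v)
      + (mvfderiv I f (φ q) (mfderiv I' I φ q u) * mvfderiv I' t q v
        + mvfderiv I' t q u * mvfderiv I f (φ q) (mfderiv I' I φ q v)))
  theta_apply : ∀ (q : N) (v : TangentSpace I' q), θ q v =
    Real.exp (2 * t q) * (η q v + 1 / 2 * betaForm I g Z (φ q) (mfderiv I' I φ q v))

namespace IsConification

variable (h : IsConification I I' g J Z f φ η t G θ)
include h

theorem ext {q : N} {u v : TangentSpace I' q}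
    (h1 : mfderiv I' I φ q u = mfderiv I' I φ q v) (h2 : η q u = η q v)
    (h3 : mvfderiv I' t q u = mvfderiv I' t q v) : u = v :=
  h.coframe.ext h1 (Prod.ext h2 h3)

theorem surjective (q : N) (u : TangentSpace I (φ q)) (a s : ℝ) : ∃ v : TangentSpace I' q,
    mfderiv I' I φ q v = u ∧ η q v = a ∧ mvfderiv I' t q v = s := by
  obtain ⟨v, hv, hv'⟩ := h.coframe.surjective q u (a, s)
  exact ⟨v, hv, congrArg Prod.fst hv', congrArg Prod.snd hv'⟩

/-- The lift of the field `X` with the components `a`, a function on `M`, and `s`, a constant. -/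
theorem exists_lift (X : Π x : M, TangentSpace I x) (a : M → ℝ) (s : ℝ) :
    ∃ V : Π q : N, TangentSpace I' q, (∀ q, mfderiv I' I φ q (V q) = X (φ q)) ∧
      (∀ q, η q (V q) = a (φ q)) ∧ (∀ q, mvfderiv I' t q (V q) = s) ∧
      ∀ q, SmoothFieldAt I X (φ q) → ContMDiffAt I 𝓘(ℝ, ℝ) ∞ a (φ q) → SmoothFieldAt I' V q := by
  obtain ⟨V, h1, h2, h3⟩ := h.coframe.exists_lift X fun q ↦ (a (φ q), s)
  exact ⟨V, h1, fun q ↦ congrArg Prod.fst (h2 q), fun q ↦ congrArg Prod.snd (h2 q),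
    fun q hX ha ↦ h3 q hX
      ((ContMDiffAt.comp q ha (h.coframe.contMDiff q)).prodMk_space contMDiffAt_const)⟩

theorem mdifferentiableAt_proj (q : N) : MDifferentiableAt I' I φ q :=
  (h.coframe.contMDiff q).mdifferentiableAt (by simp)

/-- The derivative of a function on `M` scaled by `exp(2t)`. -/
theorem mvfderiv_exp_mul {k : M → ℝ} {q : N} (hk : MDifferentiableAt I 𝓘(ℝ, ℝ) k (φ q))
    (v : TangentSpace I' q) :
    mvfderiv I' (fun y ↦ Real.exp (2 * t y) * k (φ y)) q v = Real.exp (2 * t q) *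
      (2 * mvfderiv I' t q v * k (φ q) + mvfderiv I k (φ q) (mfderiv I' I φ q v)) := by
  have ht : MDifferentiableAt I' 𝓘(ℝ, ℝ) t q := (h.contMDiff_t q).mdifferentiableAt (by simp)
  have hE : MDifferentiableAt 𝓘(ℝ, ℝ) 𝓘(ℝ, ℝ) (fun s : ℝ ↦ Real.exp (2 * s)) (t q) :=
    (by fun_prop : DifferentiableAt ℝ (fun s : ℝ ↦ Real.exp (2 * s)) (t q)).mdifferentiableAt
  have h1 : MDifferentiableAt I' 𝓘(ℝ, ℝ) (fun y ↦ Real.exp (2 * t y)) q := hE.comp q ht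
  have h2 : MDifferentiableAt I' 𝓘(ℝ, ℝ) (fun y ↦ k (φ y)) q :=
    hk.comp q (h.mdifferentiableAt_proj q)
  have h3 : mvfderiv I' (fun y ↦ Real.exp (2 * t y)) q v =
      2 * Real.exp (2 * t q) * mvfderiv I' t q v := by
    rw [mvfderiv_comp_mfderiv hE ht]
    have hd : HasDerivAt (fun s : ℝ ↦ Real.exp (2 * s)) (Real.exp (2 * t q) * (2 * 1)) (t q) :=
      ((hasDerivAt_id (t q)).const_mul 2).exp
    change mfderiv 𝓘(ℝ, ℝ) 𝓘(ℝ, ℝ) (fun s : ℝ ↦ Real.exp (2 * s)) (t q) (mvfderiv I' t q v) = _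
    rw [mfderiv_eq_fderiv, hd.hasFDerivAt.fderiv]
    change mvfderiv I' t q v * _ = _
    ring
  rw [mvfderiv_fun_mul h1 h2]
  simp only [add_apply, smul_apply, smul_eq_mul]
  rw [h3, mvfderiv_comp_mfderiv hk (h.mdifferentiableAt_proj q)]
  ring

section Bracket

variable [I.Boundaryless] [I'.Boundaryless] {q : N} {X Y : Π x : M, TangentSpace I x} {a b : M → ℝ}
  {s r : ℝ} {U V : Π q : N, TangentSpace I' q}
  (hX : SmoothFieldAt I X (φ q)) (hY : SmoothFieldAt I Y (φ q))
  (hU : SmoothFieldAt I' U q) (hV : SmoothFieldAt I' V q)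

include hU hV in
theorem mvfderiv_t_mlieBracket (hUt : ∀ q, mvfderiv I' t q (U q) = s)
    (hVt : ∀ q, mvfderiv I' t q (V q) = r) : mvfderiv I' t q (mlieBracket I' U V q) = 0 := by
  rw [mvfderiv_mlieBracket ((h.contMDiff_t q).of_le (WithTop.coe_le_coe.2 le_top)) hU.diffFieldAt
    hV.diffFieldAt]
  simp [hUt, hVt, mvfderiv_const]

include hU hV hX hY in
theorem mfderiv_mlieBracket (hUX : ∀ q, mfderiv I' I φ q (U q) = X (φ q))
    (hVY : ∀ q, mfderiv I' I φ q (V q) = Y (φ q)) :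
    mfderiv I' I φ q (mlieBracket I' U V q) = mlieBracket I X Y (φ q) :=
  mfderiv_mlieBracket_of_related h.coframe.contMDiff hU.diffFieldAt hV.diffFieldAt hX hY
    (Eventually.of_forall hUX) (Eventually.of_forall hVY)

include hU hV in
theorem eta_mlieBracket (hUX : ∀ q, mfderiv I' I φ q (U q) = X (φ q))
    (hVY : ∀ q, mfderiv I' I φ q (V q) = Y (φ q))
    (hUa : ∀ q, η q (U q) = a (φ q)) (hVb : ∀ q, η q (V q) = b (φ q))
    (ha : MDifferentiableAt I 𝓘(ℝ, ℝ) a (φ q)) (hb : MDifferentiableAt I 𝓘(ℝ, ℝ) b (φ q)) :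
    η q (mlieBracket I' U V q) = mvfderiv I b (φ q) (X (φ q)) - mvfderiv I a (φ q) (Y (φ q)) -
      (fundamentalForm I g J (φ q) - (1 / 2 : ℝ) • extDerivOne I (betaForm I g Z) (φ q))
        (X (φ q)) (Y (φ q)) := by
  have h1 := extDerivOne_apply I' (h.smooth_eta.diffOneFormAt q) hU.diffFieldAt hV.diffFieldAt
  rw [h.extDerivOne_eta, hUX, hVY] at h1
  simp only [hUa, hVb] at h1
  rw [mvfderiv_comp_mfderiv ha (h.mdifferentiableAt_proj q),
    mvfderiv_comp_mfderiv hb (h.mdifferentiableAt_proj q), hUX, hVY] at h1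
  linarith

end Bracket

/-- Every tangent vector extends to a lift whose vertical components are constant. -/
theorem exists_const_lift {q : N} (u : TangentSpace I' q) :
    ∃ (X : Π x : M, TangentSpace I x) (U : Π q : N, TangentSpace I' q),
      SmoothFieldAt I X (φ q) ∧ SmoothFieldAt I' U q ∧ U q = u ∧
      (∀ y, mfderiv I' I φ y (U y) = X (φ y)) ∧ (∀ y, η y (U y) = η q u) ∧
      ∀ y, mvfderiv I' t y (U y) = mvfderiv I' t q u := by
  obtain ⟨X, U, h1, h2, h3, h4, h5⟩ := h.coframe.exists_lift_eq u
  exact ⟨X, U, h1, h2, h3, h4, fun q ↦ congrArg Prod.fst (h5 q), fun q ↦ congrArg Prod.snd (h5 q)⟩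

theorem smoothOneForm_beta : SmoothOneForm I (betaForm I g Z) :=
  h.kahler.metric.smoothOneForm_betaForm h.killing.smooth

theorem contMDiffAt_exp (q : N) :
    ContMDiffAt I' 𝓘(ℝ, ℝ) ∞ (fun y ↦ Real.exp (2 * t y)) q :=
  (Real.contDiff_exp.comp (contDiff_const.mul contDiff_id)).contMDiff.contMDiffAt.comp q
    (h.contMDiff_t q)

theorem smoothOneForm_theta : SmoothOneForm I' θ := by
  refine smoothOneForm_of_apply fun q V hV ↦ ?_
  simp only [h.theta_apply]
  refine (h.contMDiffAt_exp q).mul ((h.smooth_eta.contMDiffAt_apply_field hV).add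
    (contMDiffAt_const.mul ?_))
  exact (h.smoothOneForm_beta.pullback h.coframe.contMDiff).contMDiffAt_apply_field hV

theorem contMDiff_fOne : ContMDiff I 𝓘(ℝ, ℝ) ∞ (fOne I g Z f) := fun x ↦ by
  have h1 := h.smoothOneForm_beta.contMDiffAt_apply_field (h.killing.smooth x)
  have e : fOne I g Z f = fun x ↦ f x - (1 / 2 : ℝ) * betaForm I g Z x (Z x) := by
    funext y; simp only [fOne, betaForm]; ring
  rw [e]
  exact (h.contMDiff_f x).sub (contMDiffAt_const.mul h1)

theorem smoothBilin_metric : SmoothBilin I' G := by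
  refine smoothBilin_of_apply fun q U V hU hV ↦ ?_
  simp only [h.metric_apply]
  have hφ := h.coframe.contMDiff q
  have dφ : ∀ {V : Π q : N, TangentSpace I' q}, SmoothFieldAt I' V q → ContMDiffAt I' I.tangent ∞
      (fun y ↦ (⟨φ y, mfderiv I' I φ y (V y)⟩ : TangentBundle I M)) q :=
    fun hV ↦ contMDiffAt_mfderiv_apply hφ le_rfl hV
  have dt : ∀ {V : Π q : N, TangentSpace I' q}, SmoothFieldAt I' V q →
      ContMDiffAt I' 𝓘(ℝ, ℝ) ∞ (fun y ↦ mvfderiv I' t y (V y)) q :=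
    fun hV ↦ contMDiffAt_mvfderiv_apply (h.contMDiff_t q) le_rfl hV
  have hfφ : ContMDiffAt I' 𝓘(ℝ, ℝ) ∞ (fun y ↦ f (φ y)) q := (h.contMDiff_f (φ q)).comp q hφ
  have df : ∀ {V : Π q : N, TangentSpace I' q}, SmoothFieldAt I' V q →
      ContMDiffAt I' 𝓘(ℝ, ℝ) ∞ (fun y ↦ mvfderiv I f (φ y) (mfderiv I' I φ y (V y))) q := by
    intro V hV
    have := contMDiffAt_mvfderiv_apply hfφ le_rfl hV
    refine this.congr_of_eventuallyEq (Eventually.of_forall fun y ↦ ?_)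
    exact (mvfderiv_comp_mfderiv ((h.contMDiff_f _).mdifferentiableAt (by simp))
      (h.mdifferentiableAt_proj y) _).symm
  have hη : ∀ {V : Π q : N, TangentSpace I' q}, SmoothFieldAt I' V q →
      ContMDiffAt I' 𝓘(ℝ, ℝ) ∞ (fun y ↦ η y (V y)) q :=
    fun hV ↦ h.smooth_eta.contMDiffAt_apply_field hV
  have hf1 : ContMDiffAt I' 𝓘(ℝ, ℝ) ∞ (fun y ↦ 2 / fOne I g Z f (φ y)) q :=
    contMDiffAt_const.div₀ ((h.contMDiff_fOne (φ q)).comp q hφ) (h.fOne_ne_zero _)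
  exact (h.contMDiffAt_exp q).mul ((((hf1.mul ((hη hU).mul (hη hV))).add
    (h.kahler.metric.smooth.contMDiffAt_apply hφ le_rfl (dφ hU) (dφ hV))).add
    ((contMDiffAt_const.mul hfφ).mul ((dt hU).mul (dt hV)))).add
    (((df hU).mul (dt hV)).add ((dt hU).mul (df hV))))

theorem metric_symm (q : N) (u v : TangentSpace I' q) : G q u v = G q v u := by
  rw [h.metric_apply, h.metric_apply, h.kahler.metric.symm]
  ring

theorem mvfderiv_f_eq (x : M) (v : TangentSpace I x) : mvfderiv I f x v = - g x (J x (Z x)) v :=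
  h.hamiltonian x v

theorem mvfderiv_f_field (x : M) : mvfderiv I f x (Z x) = 0 := by
  have h1 := h.mvfderiv_f_eq x (Z x)
  rw [h.kahler.skew, neg_neg, h.kahler.metric.symm] at h1
  linarith [h.mvfderiv_f_eq x (Z x)]

theorem mvfderiv_f_comp (x : M) (v : TangentSpace I x) :
    mvfderiv I f x (J x v) = - g x (Z x) v :=
  mvfderiv_comp_eq_neg_betaForm h.kahler h.hamiltonian x v

theorem metric_nondegenerate (q : N) (u : TangentSpace I' q) (hu : ∀ v, G q u v = 0) : u = 0 := by
  have key : ∀ (Y : TangentSpace I (φ q)) (b r : ℝ),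
      2 / fOne I g Z f (φ q) * (η q u * b) + g (φ q) (mfderiv I' I φ q u) Y
      + 2 * f (φ q) * (mvfderiv I' t q u * r)
      + (mvfderiv I f (φ q) (mfderiv I' I φ q u) * r
        + mvfderiv I' t q u * mvfderiv I f (φ q) Y) = 0 := by
    intro Y b r
    obtain ⟨v, rfl, rfl, rfl⟩ := h.surjective q Y b r
    have := hu v
    rw [h.metric_apply] at this
    exact (mul_eq_zero.1 this).resolve_left (Real.exp_pos _).ne'
  have hf1 := h.fOne_ne_zero (φ q)
  -- test with the vertical vector, the horizontal vectors and `∂_t`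
  have ha : η q u = 0 := by
    have := key 0 1 0
    simpa [hf1] using this
  have hX : mfderiv I' I φ q u = mvfderiv I' t q u • J (φ q) (Z (φ q)) := by
    rw [← sub_eq_zero]
    refine h.kahler.metric.nondegenerate _ _ fun Y ↦ ?_
    have := key Y 0 0
    rw [h.mvfderiv_f_eq _ Y] at this
    simp only [map_sub, map_smul, sub_apply, smul_apply, smul_eq_mul]
    linarith
  have ht : mvfderiv I' t q u = 0 := by
    have := key 0 0 1
    rw [hX, map_smul (mvfderiv I f (φ q)), h.mvfderiv_f_comp, map_zero, map_zero,
      smul_eq_mul] at this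
    have h2 : mvfderiv I' t q u * (2 * fOne I g Z f (φ q)) = 0 := by
      rw [fOne]; linarith
    exact (mul_eq_zero.1 h2).resolve_right (mul_ne_zero two_ne_zero hf1)
  refine h.ext ?_ ?_ ?_
  · rw [hX, ht, zero_smul, map_zero]
  · rw [ha, map_zero]
  · rw [ht, map_zero]

theorem isPseudoRiemannian : IsPseudoRiemannian I' G where
  smooth := h.smoothBilin_metric
  symm := h.metric_symm
  nondegenerate := h.metric_nondegenerate

/-- The exterior derivative of `θ`, evaluated on lifts with constant vertical components. The terms
in `dβ` cancel between `dβ / 2` and the curvature `dη`. -/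
theorem extDerivOne_theta [I.Boundaryless] [I'.Boundaryless] (q : N) (u v : TangentSpace I' q) :
    extDerivOne I' θ q u v = Real.exp (2 * t q) *
      (2 * mvfderiv I' t q u * (η q v + 1 / 2 * g (φ q) (Z (φ q)) (mfderiv I' I φ q v))
      - 2 * mvfderiv I' t q v * (η q u + 1 / 2 * g (φ q) (Z (φ q)) (mfderiv I' I φ q u))
      + g (φ q) (J (φ q) (mfderiv I' I φ q u)) (mfderiv I' I φ q v)) := by
  obtain ⟨X, U, hX, hU, rfl, hUX, hUa, hUt⟩ := h.exists_const_lift u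
  obtain ⟨Y, V, hY, hV, rfl, hVY, hVb, hVt⟩ := h.exists_const_lift v
  rw [extDerivOne_apply I' (h.smoothOneForm_theta.diffOneFormAt q) hU.diffFieldAt hV.diffFieldAt]
  have hβ := h.smoothOneForm_beta
  have hd : ∀ {X : Π x : M, TangentSpace I x} (c : ℝ), SmoothFieldAt I X (φ q) →
      MDifferentiableAt I 𝓘(ℝ, ℝ) (fun x ↦ c + 1 / 2 * betaForm I g Z x (X x)) (φ q) ∧
      ∀ w, mvfderiv I (fun x ↦ c + 1 / 2 * betaForm I g Z x (X x)) (φ q) w =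
        1 / 2 * mvfderiv I (fun x ↦ betaForm I g Z x (X x)) (φ q) w := by
    intro X c hX
    have h1 : MDifferentiableAt I 𝓘(ℝ, ℝ) (fun x ↦ betaForm I g Z x (X x)) (φ q) :=
      (hβ.contMDiffAt_apply_field hX).mdifferentiableAt (by simp)
    have h2 : MDifferentiableAt I 𝓘(ℝ, ℝ) (fun x ↦ 1 / 2 * betaForm I g Z x (X x)) (φ q) :=
      mdifferentiableAt_const.mul h1
    refine ⟨mdifferentiableAt_const.add h2, fun w ↦ ?_⟩
    rw [mvfderiv_fun_add mdifferentiableAt_const h2, mvfderiv_fun_mul mdifferentiableAt_const h1]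
    simp [mvfderiv_const]
  have e : ∀ {V : Π q : N, TangentSpace I' q} {X : Π x : M, TangentSpace I x} {c : ℝ},
      (∀ y, mfderiv I' I φ y (V y) = X (φ y)) → (∀ y, η y (V y) = c) →
      (fun y ↦ θ y (V y)) = fun y ↦ Real.exp (2 * t y) *
        (fun x ↦ c + 1 / 2 * betaForm I g Z x (X x)) (φ y) := by
    intro V X c h1 h2
    funext y
    rw [h.theta_apply, h1, h2]
  have hη := h.eta_mlieBracket hU hV hUX hVY (a := fun _ ↦ η q (U q)) (b := fun _ ↦ η q (V q))
    hUa hVb mdifferentiableAt_const mdifferentiableAt_const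
  rw [e hVY hVb, e hUX hUa, h.mvfderiv_exp_mul (hd _ hY).1, h.mvfderiv_exp_mul (hd _ hX).1,
    h.theta_apply, hη, (hd _ hY).2, (hd _ hX).2, h.mfderiv_mlieBracket hX hY hU hV hUX hVY, hUX,
    hVY, sub_apply, sub_apply, smul_apply, smul_apply,
    extDerivOne_apply I (hβ.diffOneFormAt _) hX.diffFieldAt hY.diffFieldAt]
  simp only [mvfderiv_const, betaForm, fundamentalForm, ContinuousLinearMap.comp_apply, zero_apply,
    smul_eq_mul]
  ring

end IsConification

end Cone

/-! ### The complex structure of the conification -/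

section Cone

variable {E : Type*} [NormedAddCommGroup E] [NormedSpace ℝ E] [FiniteDimensional ℝ E]
  {H : Type*} [TopologicalSpace H] {I : ModelWithCorners ℝ E H}
  {M : Type*} [TopologicalSpace M] [ChartedSpace H M] [IsManifold I ∞ M]
  {E' : Type*} [NormedAddCommGroup E'] [NormedSpace ℝ E'] [FiniteDimensional ℝ E']
  {H' : Type*} [TopologicalSpace H'] {I' : ModelWithCorners ℝ E' H'}
  {N : Type*} [TopologicalSpace N] [ChartedSpace H' N] [IsManifold I' ∞ N]
  {g : Π x : M, TangentSpace I x →L[ℝ] TangentSpace I x →L[ℝ] ℝ}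
  {J : Π x : M, TangentSpace I x →L[ℝ] TangentSpace I x}
  {Z : Π x : M, TangentSpace I x} {f : M → ℝ}
  {φ : N → M} {η : Π q : N, TangentSpace I' q →L[ℝ] ℝ} {t : N → ℝ}
  {G : Π q : N, TangentSpace I' q →L[ℝ] TangentSpace I' q →L[ℝ] ℝ}
  {θ : Π q : N, TangentSpace I' q →L[ℝ] ℝ}

variable (I') in
/-- The endomorphism field `G⁻¹ dθ`, where `G` and `dθ` are seen as maps from vectors to
covectors. -/
def complexStructure (G : Π q : N, TangentSpace I' q →L[ℝ] TangentSpace I' q →L[ℝ] ℝ)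
    (θ : Π q : N, TangentSpace I' q →L[ℝ] ℝ) (q : N) : TangentSpace I' q →L[ℝ] TangentSpace I' q :=
  (ContinuousLinearMap.inverse (G q)).comp (extDerivOne I' θ q)

namespace IsConification

variable (h : IsConification I I' g J Z f φ η t G θ)
include h

theorem metric_complexStructure (q : N) (u : TangentSpace I' q) :
    G q (complexStructure I' G θ q u) = extDerivOne I' θ q u :=
  (h.isPseudoRiemannian.isInvertible q).self_apply_inverse _

theorem smoothEndo : SmoothEndo I' (complexStructure I' G θ) :=
  h.smoothBilin_metric.smoothEndo_inverse_comp h.isPseudoRiemannian.isInvertible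
    h.smoothOneForm_theta.extDerivOne

variable [I.Boundaryless] [I'.Boundaryless]

/-- The components of the endomorphism field `G⁻¹ dθ`: it maps `∂_t` to the lift of `Z` with
`η`-component `f₁`, and a horizontal vector to its rotation by `J`. -/
theorem complexStructure_components (q : N) (u : TangentSpace I' q) :
    mfderiv I' I φ q (complexStructure I' G θ q u) = J (φ q) (mfderiv I' I φ q u)
      + mvfderiv I' t q u • Z (φ q) - (η q u / fOne I g Z f (φ q)) • J (φ q) (Z (φ q)) ∧
    η q (complexStructure I' G θ q u) = fOne I g Z f (φ q) * mvfderiv I' t q u ∧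
    mvfderiv I' t q (complexStructure I' G θ q u) = - (η q u / fOne I g Z f (φ q)) := by
  obtain ⟨w, h1, h2, h3⟩ := h.surjective q (J (φ q) (mfderiv I' I φ q u)
      + mvfderiv I' t q u • Z (φ q) - (η q u / fOne I g Z f (φ q)) • J (φ q) (Z (φ q)))
    (fOne I g Z f (φ q) * mvfderiv I' t q u) (- (η q u / fOne I g Z f (φ q)))
  -- the vector `w` with the stated components satisfies `G(w, ·) = dθ(u, ·)`
  suffices e : complexStructure I' G θ q u = w by rw [e]; exact ⟨h1, h2, h3⟩
  have hf1 := h.fOne_ne_zero (φ q)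
  rw [← sub_eq_zero]
  refine h.metric_nondegenerate q _ fun v ↦ ?_
  rw [map_sub, sub_apply, h.metric_complexStructure, sub_eq_zero, h.extDerivOne_theta,
    h.metric_apply, h1, h2, h3]
  simp only [map_add, map_sub, map_smul, add_apply, sub_apply, smul_apply, smul_eq_mul,
    h.mvfderiv_f_comp, h.mvfderiv_f_field]
  rw [h.mvfderiv_f_eq]
  have e2 : g (φ q) (Z (φ q)) (Z (φ q)) = 2 * (f (φ q) - fOne I g Z f (φ q)) := by
    rw [fOne]; ring
  rw [e2]
  congr 1
  field_simp
  ring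

theorem complexStructure_sq (q : N) (u : TangentSpace I' q) :
    complexStructure I' G θ q (complexStructure I' G θ q u) = - u := by
  obtain ⟨h1, h2, h3⟩ := h.complexStructure_components q (complexStructure I' G θ q u)
  obtain ⟨k1, k2, k3⟩ := h.complexStructure_components q u
  have hf1 := h.fOne_ne_zero (φ q)
  refine h.ext ?_ ?_ ?_
  · rw [h1, k1, k2, k3]
    simp only [map_add, map_sub, map_smul, map_neg, h.kahler.sq_eq_neg]
    rw [mul_div_cancel_left₀ _ hf1]
    module
  · rw [h2, k3, map_neg]
    field_simp
  · rw [h3, k2, map_neg, mul_div_cancel_left₀ _ hf1]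

theorem isAlmostPseudoKahler : IsAlmostPseudoKahler I' G (complexStructure I' G θ) where
  metric := h.isPseudoRiemannian
  smooth := h.smoothEndo
  sq_eq_neg := h.complexStructure_sq
  skew q u v := by
    rw [h.metric_complexStructure, h.metric_symm q u, h.metric_complexStructure,
      extDerivOne_swap q (h.smoothOneForm_theta.diffOneFormAt q)]
  closed := by
    have : fundamentalForm I' G (complexStructure I' G θ) = extDerivOne I' θ := by
      funext q
      ext u v
      exact congrArg (· v) (h.metric_complexStructure q u)
    rw [this]
    exact h.smoothOneForm_theta.isClosedTwoForm_extDerivOne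

/-- The curvature form `ω - dβ / 2` is of type `(1, 1)`. -/
theorem curvature_comp (x : M) (u v : TangentSpace I x) :
    (fundamentalForm I g J x - (1 / 2 : ℝ) • extDerivOne I (betaForm I g Z) x) (J x u) (J x v) =
      (fundamentalForm I g J x - (1 / 2 : ℝ) • extDerivOne I (betaForm I g Z) x) u v := by
  have h1 := extDerivOne_betaForm_comp h.kahler h.hamiltonian h.contMDiff_f h.killing.smooth x u v
  simp only [sub_apply, smul_apply, h1]
  congr 1
  change g x (J x (J x u)) (J x v) = g x (J x u) v
  rw [h.kahler.skew, h.kahler.sq_eq_neg, map_neg, neg_neg]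

/-- Vector fields on `N` with prescribed components have a bracket with known components. -/
theorem mlieBracket_components {q : N} {X Y : Π x : M, TangentSpace I x} {a b : M → ℝ}
    {s r : ℝ} {U V : Π q : N, TangentSpace I' q}
    (hX : SmoothFieldAt I X (φ q)) (hY : SmoothFieldAt I Y (φ q))
    (hU : SmoothFieldAt I' U q) (hV : SmoothFieldAt I' V q)
    (ha : MDifferentiableAt I 𝓘(ℝ, ℝ) a (φ q)) (hb : MDifferentiableAt I 𝓘(ℝ, ℝ) b (φ q))
    (hUc : ∀ q, mfderiv I' I φ q (U q) = X (φ q) ∧ η q (U q) = a (φ q) ∧ mvfderiv I' t q (U q) = s)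
    (hVc : ∀ q, mfderiv I' I φ q (V q) = Y (φ q) ∧ η q (V q) = b (φ q) ∧
      mvfderiv I' t q (V q) = r) :
    mfderiv I' I φ q (mlieBracket I' U V q) = mlieBracket I X Y (φ q) ∧
    η q (mlieBracket I' U V q) = mvfderiv I b (φ q) (X (φ q)) - mvfderiv I a (φ q) (Y (φ q)) -
      (fundamentalForm I g J (φ q) - (1 / 2 : ℝ) • extDerivOne I (betaForm I g Z) (φ q))
        (X (φ q)) (Y (φ q)) ∧
    mvfderiv I' t q (mlieBracket I' U V q) = 0 :=
  ⟨h.mfderiv_mlieBracket hX hY hU hV (fun q ↦ (hUc q).1) fun q ↦ (hVc q).1,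
    h.eta_mlieBracket hU hV (fun q ↦ (hUc q).1) (fun q ↦ (hVc q).1) (fun q ↦ (hUc q).2.1)
      (fun q ↦ (hVc q).2.1) ha hb,
    h.mvfderiv_t_mlieBracket hU hV (fun q ↦ (hUc q).2.2) fun q ↦ (hVc q).2.2⟩

omit [I.Boundaryless] [I'.Boundaryless] in
theorem exists_horizontal_lift {q : N} {u : TangentSpace I' q} (hη : η q u = 0)
    (ht : mvfderiv I' t q u = 0) :
    ∃ (X : Π x : M, TangentSpace I x) (U : Π q : N, TangentSpace I' q),
      SmoothFieldAt I X (φ q) ∧ SmoothFieldAt I' U q ∧ U q = u ∧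
      ∀ y, mfderiv I' I φ y (U y) = X (φ y) ∧ η y (U y) = 0 ∧ mvfderiv I' t y (U y) = 0 := by
  obtain ⟨X, U, h1, h2, h3, h4, h5, h6⟩ := h.exists_const_lift u
  exact ⟨X, U, h1, h2, h3, fun y ↦ ⟨h4 y, (h5 y).trans hη, (h6 y).trans ht⟩⟩

theorem complexStructure_horizontal {q : N} {u : TangentSpace I' q} {v : TangentSpace I (φ q)}
    (hu : mfderiv I' I φ q u = v ∧ η q u = 0 ∧ mvfderiv I' t q u = 0) :
    mfderiv I' I φ q (complexStructure I' G θ q u) = J (φ q) v ∧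
      η q (complexStructure I' G θ q u) = 0 ∧
      mvfderiv I' t q (complexStructure I' G θ q u) = 0 := by
  obtain ⟨k1, k2, k3⟩ := h.complexStructure_components q u
  rw [hu.1, hu.2.1, hu.2.2] at k1
  rw [hu.2.2] at k2
  rw [hu.2.1] at k3
  refine ⟨by simpa using k1, by simpa using k2, by simpa using k3⟩

/-- On horizontal vectors the Nijenhuis tensor vanishes because `J` is integrable and the curvature
is of type `(1, 1)`. -/
theorem nijenhuis_horizontal {q : N} {u v : TangentSpace I' q} (hu : η q u = 0)
    (hu' : mvfderiv I' t q u = 0) (hv : η q v = 0) (hv' : mvfderiv I' t q v = 0) :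
    nijenhuisForm h.smoothEndo h.complexStructure_sq q u v = 0 := by
  obtain ⟨X, U, hX, hU, rfl, hUX⟩ := h.exists_horizontal_lift hu hu'
  obtain ⟨Y, V, hY, hV, rfl, hVY⟩ := h.exists_horizontal_lift hv hv'
  rw [nijenhuisForm_apply _ _ hU.diffFieldAt hV.diffFieldAt]
  have hJX : SmoothFieldAt I (fun y ↦ J y (X y)) (φ q) :=
    h.kahler.smooth.contMDiffAt_apply le_rfl hX
  have hJY : SmoothFieldAt I (fun y ↦ J y (Y y)) (φ q) :=
    h.kahler.smooth.contMDiffAt_apply le_rfl hY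
  have hJU : SmoothFieldAt I' (fun y ↦ complexStructure I' G θ y (U y)) q :=
    h.smoothEndo.contMDiffAt_apply le_rfl hU
  have hJV : SmoothFieldAt I' (fun y ↦ complexStructure I' G θ y (V y)) q :=
    h.smoothEndo.contMDiffAt_apply le_rfl hV
  have hJUX := fun y ↦ h.complexStructure_horizontal (hUX y)
  have hJVY := fun y ↦ h.complexStructure_horizontal (hVY y)
  have c : MDifferentiableAt I 𝓘(ℝ, ℝ) (fun _ : M ↦ (0 : ℝ)) (φ q) := mdifferentiableAt_const
  obtain ⟨a1, a2, a3⟩ := h.mlieBracket_components hJX hJY hJU hJV c c hJUX hJVY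
  obtain ⟨b1, b2, b3⟩ := h.mlieBracket_components hJX hY hJU hV c c hJUX hVY
  obtain ⟨c1, c2, c3⟩ := h.mlieBracket_components hX hJY hU hJV c c hUX hJVY
  obtain ⟨d1, d2, d3⟩ := h.mlieBracket_components hX hY hU hV c c hUX hVY
  obtain ⟨b1', b2', b3'⟩ := h.complexStructure_components q
    (mlieBracket I' (fun y ↦ complexStructure I' G θ y (U y)) V q)
  obtain ⟨c1', c2', c3'⟩ := h.complexStructure_components q
    (mlieBracket I' U (fun y ↦ complexStructure I' G θ y (V y)) q)
  have i := h.kahler.integrable _ X Y hX hY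
  have F1 := h.curvature_comp (φ q) (X (φ q)) (Y (φ q))
  have F2 := h.curvature_comp (φ q) (J (φ q) (X (φ q))) (Y (φ q))
  rw [h.kahler.sq_eq_neg, map_neg, neg_apply] at F2
  simp only [mvfderiv_const, zero_apply, sub_zero, zero_sub, F1, ← F2] at a2 b2 c2 d2
  rw [nijenhuis]
  refine h.ext ?_ ?_ ?_
  · simp only [map_sub, a1, b1', c1', d1, b1, c1, b2, c2, b3, c3]
    rw [map_zero, ← i]
    module
  · simp only [map_sub, a2, b2', c2', d2, b3, c3]
    simp
  · simp only [map_sub, a3, b3', c3', d3, b2, c2]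
    simp
    ring

theorem complexStructure_vertical {q : N} {w : TangentSpace I' q}
    (hw : mfderiv I' I φ q w = 0 ∧ η q w = 0 ∧ mvfderiv I' t q w = 1) :
    mfderiv I' I φ q (complexStructure I' G θ q w) = Z (φ q) ∧
      η q (complexStructure I' G θ q w) = fOne I g Z f (φ q) ∧
      mvfderiv I' t q (complexStructure I' G θ q w) = 0 := by
  obtain ⟨k1, k2, k3⟩ := h.complexStructure_components q w
  rw [hw.1, hw.2.1, hw.2.2] at k1
  rw [hw.2.2] at k2
  rw [hw.2.1] at k3
  refine ⟨by simpa using k1, by simpa using k2, by simpa using k3⟩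

omit [I.Boundaryless] [I'.Boundaryless] in
theorem exists_vertical_lift {q : N} {w : TangentSpace I' q}
    (hw : mfderiv I' I φ q w = 0 ∧ η q w = 0 ∧ mvfderiv I' t q w = 1) :
    ∃ W : Π q : N, TangentSpace I' q, SmoothFieldAt I' W q ∧ W q = w ∧
      ∀ y, mfderiv I' I φ y (W y) = 0 ∧ η y (W y) = 0 ∧ mvfderiv I' t y (W y) = 1 := by
  obtain ⟨W, hW1, hW2, hW3, hWs⟩ := h.exists_lift 0 0 1
  have hzero : SmoothFieldAt I (0 : Π x : M, TangentSpace I x) (φ q) :=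
    Bundle.contMDiff_zeroSection ℝ (TangentSpace I : M → Type _) (φ q)
  exact ⟨W, hWs q hzero contMDiffAt_const, h.ext ((hW1 q).trans hw.1.symm)
    ((hW2 q).trans hw.2.1.symm) ((hW3 q).trans hw.2.2.symm), fun y ↦ ⟨hW1 y, hW2 y, hW3 y⟩⟩

/-- The field `∂_t` commutes with the lifts with constant vertical components. -/
theorem mlieBracket_vertical {q : N} {X : Π x : M, TangentSpace I x}
    {W U : Π q : N, TangentSpace I' q} {a s : ℝ} (hX : SmoothFieldAt I X (φ q))
    (hW : SmoothFieldAt I' W q) (hU : SmoothFieldAt I' U q)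
    (hWc : ∀ y, mfderiv I' I φ y (W y) = 0 ∧ η y (W y) = 0 ∧ mvfderiv I' t y (W y) = 1)
    (hUc : ∀ y, mfderiv I' I φ y (U y) = X (φ y) ∧ η y (U y) = a ∧ mvfderiv I' t y (U y) = s) :
    mlieBracket I' W U q = 0 := by
  have hzero : SmoothFieldAt I (0 : Π x : M, TangentSpace I x) (φ q) :=
    Bundle.contMDiff_zeroSection ℝ (TangentSpace I : M → Type _) (φ q)
  obtain ⟨h1, h2, h3⟩ := h.mlieBracket_components (X := 0) (Y := X) (a := fun _ ↦ 0)
    (b := fun _ ↦ a) hzero hX hW hU mdifferentiableAt_const mdifferentiableAt_const hWc hUc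
  refine h.ext ?_ ?_ ?_
  · rw [h1, mlieBracket_zero_left, map_zero]
    rfl
  · rw [h2, map_zero]
    simp [mvfderiv_const]
  · rw [h3, map_zero]

/-- The image of `∂_t` under the complex structure is the lift of `Z` with `η`-component `f₁`. Its
bracket with a horizontal lift is horizontal as `df₁` is the negative of the contraction of the
curvature with `Z`. -/
theorem nijenhuis_vertical {q : N} {w u : TangentSpace I' q}
    (hw : mfderiv I' I φ q w = 0 ∧ η q w = 0 ∧ mvfderiv I' t q w = 1)
    (hu : η q u = 0) (hu' : mvfderiv I' t q u = 0) :
    nijenhuisForm h.smoothEndo h.complexStructure_sq q w u = 0 := by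
  obtain ⟨X, U, hX, hU, rfl, hUX⟩ := h.exists_horizontal_lift hu hu'
  obtain ⟨W, hW, rfl, hWc⟩ := h.exists_vertical_lift hw
  rw [nijenhuisForm_apply _ _ hW.diffFieldAt hU.diffFieldAt]
  have hJX : SmoothFieldAt I (fun y ↦ J y (X y)) (φ q) :=
    h.kahler.smooth.contMDiffAt_apply le_rfl hX
  have hJU : SmoothFieldAt I' (fun y ↦ complexStructure I' G θ y (U y)) q :=
    h.smoothEndo.contMDiffAt_apply le_rfl hU
  have hJW : SmoothFieldAt I' (fun y ↦ complexStructure I' G θ y (W y)) q :=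
    h.smoothEndo.contMDiffAt_apply le_rfl hW
  have hJUX := fun y ↦ h.complexStructure_horizontal (hUX y)
  have hJWZ := fun y ↦ h.complexStructure_vertical (hWc y)
  have c : MDifferentiableAt I 𝓘(ℝ, ℝ) (fun _ : M ↦ (0 : ℝ)) (φ q) := mdifferentiableAt_const
  have c1 : MDifferentiableAt I 𝓘(ℝ, ℝ) (fOne I g Z f) (φ q) :=
    (h.contMDiff_fOne _).mdifferentiableAt (by simp)
  obtain ⟨a1, a2, a3⟩ := h.mlieBracket_components (h.killing.smooth _) hJX hJW hJU c1 c hJWZ hJUX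
  obtain ⟨b1, b2, b3⟩ := h.mlieBracket_components (h.killing.smooth _) hX hJW hU c1 c hJWZ hUX
  rw [mvfderiv_fOne h.kahler h.hamiltonian h.killing h.contMDiff_f, mvfderiv_const, zero_apply,
    zero_sub, neg_neg, sub_self] at a2 b2
  rw [mlieBracket_comp_eq h.kahler h.hamiltonian h.killing h.contMDiff_f hX] at a1
  obtain ⟨d1, d2, d3⟩ := h.complexStructure_horizontal ⟨b1, b2, b3⟩
  rw [nijenhuis, h.mlieBracket_vertical hJX hW hJU hWc hJUX,
    h.mlieBracket_vertical hX hW hU hWc hUX, map_zero, sub_zero, sub_zero, sub_eq_zero]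
  exact h.ext (a1.trans d1.symm) (a2.trans d2.symm) (a3.trans d3.symm)

/-- The tangent spaces of `N` are spanned by the horizontal vectors, `∂_t` and its image under the
complex structure. -/
theorem exists_decomposition {q : N} {w : TangentSpace I' q}
    (hw : mfderiv I' I φ q w = 0 ∧ η q w = 0 ∧ mvfderiv I' t q w = 1) (u : TangentSpace I' q) :
    ∃ (u' : TangentSpace I' q) (a s : ℝ), η q u' = 0 ∧ mvfderiv I' t q u' = 0 ∧
      u = u' + s • w + a • complexStructure I' G θ q w := by
  obtain ⟨h1, h2, h3⟩ := h.complexStructure_vertical hw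
  refine ⟨u - mvfderiv I' t q u • w - (η q u / fOne I g Z f (φ q)) • complexStructure I' G θ q w,
    η q u / fOne I g Z f (φ q), mvfderiv I' t q u, ?_, ?_, by module⟩
  · have := h.fOne_ne_zero (φ q)
    rw [map_sub, map_sub, map_smul, map_smul, h2, hw.2.1, smul_eq_mul, smul_eq_mul]
    field_simp
    ring
  · rw [map_sub, map_sub, map_smul, map_smul, h3, hw.2.2, smul_eq_mul, smul_eq_mul]
    ring

/-- The Nijenhuis tensor vanishes on all vectors as it is skew-symmetric and complex antilinear. -/
theorem isIntegrable : IsIntegrable I' (complexStructure I' G θ) := by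
  refine isIntegrable_of_nijenhuisForm_eq_zero h.smoothEndo h.complexStructure_sq fun q u v ↦ ?_
  obtain ⟨w, hw⟩ := h.surjective q 0 0 1
  set B := nijenhuisForm h.smoothEndo h.complexStructure_sq q
  have swap : ∀ u v, B u v = - B v u := nijenhuisForm_swap _ _ q
  have comp : ∀ u v, B (complexStructure I' G θ q u) v = - complexStructure I' G θ q (B u v) :=
    nijenhuisForm_comp _ _ q
  have hww : B w w = 0 := by
    have h1 : B w w + B w w = 0 := by nth_rewrite 1 [swap]; exact neg_add_cancel _
    calc B w w = (1 / 2 : ℝ) • (B w w + B w w) := by module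
      _ = 0 := by rw [h1, smul_zero]
  have hvert : ∀ v, B w v = 0 := by
    intro v
    obtain ⟨v', a, s, h1, h2, rfl⟩ := h.exists_decomposition hw v
    have h3 : B w (complexStructure I' G θ q w) = 0 := by
      rw [swap, comp, hww, map_zero, neg_zero, neg_zero]
    rw [map_add, map_add, map_smul, map_smul, hww, h3, h.nijenhuis_vertical hw h1 h2]
    simp
  have hvert' : ∀ v, B (complexStructure I' G θ q w) v = 0 := fun v ↦ by
    rw [comp, hvert, map_zero, neg_zero]
  obtain ⟨u', a, s, h1, h2, rfl⟩ := h.exists_decomposition hw u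
  obtain ⟨v', b, r, h3, h4, rfl⟩ := h.exists_decomposition hw v
  have h5 : B u' w = 0 := by rw [swap, hvert, neg_zero]
  have h6 : B u' (complexStructure I' G θ q w) = 0 := by rw [swap, hvert', neg_zero]
  have h7 : B u' v' = 0 := h.nijenhuis_horizontal h1 h2 h3 h4
  simp only [map_add, map_smul, add_apply, smul_apply, hvert, hvert', h5, h6, h7, smul_zero,
    add_zero]

theorem isPseudoKahler : IsPseudoKahler I' G (complexStructure I' G θ) where
  toIsAlmostPseudoKahler := h.isAlmostPseudoKahler
  integrable := h.isIntegrable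

theorem isConical {ξ : Π q : N, TangentSpace I' q}
    (hξ : ∀ q, mfderiv I' I φ q (ξ q) = 0 ∧ η q (ξ q) = 0 ∧ mvfderiv I' t q (ξ q) = 1) :
    IsConical I' G ξ := by
  have hξs : ∀ q, SmoothFieldAt I' ξ q := by
    intro q
    obtain ⟨W, hW, -, hWc⟩ := h.exists_vertical_lift (hξ q)
    have : W = ξ := funext fun y ↦ h.ext ((hWc y).1.trans (hξ y).1.symm)
      ((hWc y).2.1.trans (hξ y).2.1.symm) ((hWc y).2.2.trans (hξ y).2.2.symm)
    rwa [← this]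
  have hdf : ∀ x, MDifferentiableAt I 𝓘(ℝ, ℝ) f x := fun x ↦
    (h.contMDiff_f x).mdifferentiableAt (by simp)
  -- the one-form dual to `∂_t` is exact
  have hξd : ∀ q v, G q (ξ q) v = mvfderiv I' (fun y ↦ Real.exp (2 * t y) * f (φ y)) q v := by
    intro q v
    rw [h.metric_apply, (hξ q).1, (hξ q).2.1, (hξ q).2.2, h.mvfderiv_exp_mul (hdf _)]
    simp
    ring
  refine ⟨h.isPseudoRiemannian, hξs, fun q ↦ ?_, leviCivita h.isPseudoRiemannian,
    isLeviCivita_leviCivita _, fun q v ↦ ?_⟩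
  · rw [h.metric_apply, (hξ q).1, (hξ q).2.1, (hξ q).2.2]
    simp [h.f_ne_zero]
  rw [← sub_eq_zero]
  refine h.metric_nondegenerate q _ fun w ↦ ?_
  obtain ⟨X, U, hX, hU, rfl, hUX, hUa, hUt⟩ := h.exists_const_lift v
  obtain ⟨Y, V, hY, hV, rfl, hVY, hVb, hVt⟩ := h.exists_const_lift w
  have key := leviCivita_apply h.isPseudoRiemannian (hξs q).diffFieldAt hU.diffFieldAt
    hV.diffFieldAt
  have hf2 : ContMDiffAt I' 𝓘(ℝ, ℝ) 2 (fun y ↦ Real.exp (2 * t y) * f (φ y)) q :=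
    ((h.contMDiffAt_exp q).mul ((h.contMDiff_f _).comp q (h.coframe.contMDiff q))).of_le
      (WithTop.coe_le_coe.2 le_top)
  have hbr := mvfderiv_mlieBracket hf2 hU.diffFieldAt hV.diffFieldAt
  have hUξ : mlieBracket I' ξ U q = 0 :=
    h.mlieBracket_vertical hX (hξs q) hU hξ fun y ↦ ⟨hUX y, hUa y, hUt y⟩
  have hVξ : mlieBracket I' ξ V q = 0 :=
    h.mlieBracket_vertical hY (hξs q) hV hξ fun y ↦ ⟨hVY y, hVb y, hVt y⟩
  let k : M → ℝ := fun x ↦ 2 / fOne I g Z f x * (η q (U q) * η q (V q)) + g x (X x) (Y x)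
      + 2 * f x * (mvfderiv I' t q (U q) * mvfderiv I' t q (V q))
      + (mvfderiv I f x (X x) * mvfderiv I' t q (V q)
        + mvfderiv I' t q (U q) * mvfderiv I f x (Y x))
  have hk : MDifferentiableAt I 𝓘(ℝ, ℝ) k (φ q) := by
    have s1 : ContMDiffAt I 𝓘(ℝ, ℝ) ∞ (fun x ↦ 2 / fOne I g Z f x) (φ q) :=
      contMDiffAt_const.div₀ (h.contMDiff_fOne (φ q)) (h.fOne_ne_zero _)
    have s2 : ContMDiffAt I 𝓘(ℝ, ℝ) ∞ (fun x ↦ g x (X x) (Y x)) (φ q) :=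
      h.kahler.metric.smooth.contMDiffAt_apply contMDiffAt_id le_rfl hX hY
    have s3 := contMDiffAt_mvfderiv_apply (h.contMDiff_f (φ q)) le_rfl hX
    have s4 := contMDiffAt_mvfderiv_apply (h.contMDiff_f (φ q)) le_rfl hY
    have s : ContMDiffAt I 𝓘(ℝ, ℝ) ∞ k (φ q) := (((s1.mul contMDiffAt_const).add s2).add
      ((contMDiffAt_const.mul (h.contMDiff_f _)).mul contMDiffAt_const)).add
      ((s3.mul contMDiffAt_const).add (contMDiffAt_const.mul s4))
    exact s.mdifferentiableAt (by simp)
  have hGk : ∀ y, G y (U y) (V y) = Real.exp (2 * t y) * k (φ y) := by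
    intro y
    rw [h.metric_apply, hUX, hVY, hUa, hVb, hUt, hVt]
  -- the Koszul formula: `∂_t` commutes with the lifts and scales the metric
  rw [koszul, mlieBracket_swap_apply (V := U) (W := ξ), hUξ, hVξ] at key
  simp only [h.metric_symm _ _ (ξ _), hξd] at key
  simp only [hGk] at key
  rw [h.mvfderiv_exp_mul hk, (hξ q).1, (hξ q).2.2, hbr] at key
  simp only [map_zero, neg_zero, zero_apply] at key
  rw [map_sub, sub_apply, hGk]
  linarith

end IsConification

end Cone

/-! ### Signatures -/

section Signature

variable {V V₀ : Type*} [AddCommGroup V] [Module ℝ V] [AddCommGroup V₀] [Module ℝ V₀]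

/-- Diagonalizations of a quadratic form `Q₀` and of `Q = Q₀ + c x²`, where the weights of the
latter are those of the former and `c`. -/
theorem exists_weights_add_sq [FiniteDimensional ℝ V₀] {Q : QuadraticForm ℝ V}
    {Q₀ : QuadraticForm ℝ V₀} (L : V ≃ₗ[ℝ] V₀ × ℝ) {c : ℝ}
    (h : ∀ v, Q v = Q₀ (L v).1 + c * ((L v).2 * (L v).2)) :
    ∃ (n : ℕ) (w : Fin n → ℝ), sigPos Q₀ = {i | 0 < w i}.ncard ∧ sigNeg Q₀ = {i | w i < 0}.ncard ∧
      sigPos Q = {i : Option (Fin n) | 0 < i.elim c w}.ncard ∧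
      sigNeg Q = {i : Option (Fin n) | i.elim c w < 0}.ncard := by
  have : Invertible (2 : ℝ) := invertibleOfNonzero two_ne_zero
  obtain ⟨w, ⟨e⟩⟩ := Q₀.equivalent_weightedSumSquares
  let e' : V ≃ₗ[ℝ] (Option (Fin (Module.finrank ℝ V₀)) → ℝ) :=
    L ≪≫ₗ LinearEquiv.prodComm ℝ V₀ ℝ ≪≫ₗ
      (LinearEquiv.refl ℝ ℝ).prodCongr e.toLinearEquiv ≪≫ₗ
      (LinearEquiv.piOptionEquivProd ℝ (M := fun _ ↦ ℝ)).symm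
  have hQ : Q.Equivalent (QuadraticMap.weightedSumSquares ℝ
      fun i : Option (Fin (Module.finrank ℝ V₀)) ↦ i.elim c w) := by
    refine ⟨⟨e', fun v ↦ ?_⟩⟩
    rw [h, QuadraticMap.weightedSumSquares_apply, Fintype.sum_option, ← e.map_app,
      QuadraticMap.weightedSumSquares_apply, add_comm]
    rfl
  exact ⟨_, w, QuadraticForm.sigPos_of_equiv_weightedSumSquares ⟨e⟩,
    QuadraticForm.sigNeg_of_equiv_weightedSumSquares ⟨e⟩,
    QuadraticForm.sigPos_of_equiv_weightedSumSquares hQ,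
    QuadraticForm.sigNeg_of_equiv_weightedSumSquares hQ⟩

/-- The number of indices with a property when one index is adjoined. -/
theorem ncard_option {n : ℕ} (p : Fin n → Prop) (p₀ : Prop) [Decidable p₀] :
    {i : Option (Fin n) | i.elim p₀ p}.ncard = {i | p i}.ncard + if p₀ then 1 else 0 := by
  have e : some '' {i | p i} = {i : Option (Fin n) | i.elim False p} := by
    ext i; cases i <;> simp
  rw [← Set.ncard_image_of_injective {i | p i} (Option.some_injective _), e]
  split_ifs with h
  · rw [← Set.ncard_insert_of_notMem (a := none) (by simp)]
    congr 1
    ext i; cases i <;> simp [h]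
  · simp [h]

/-- Adding a square to a quadratic form. -/
theorem sigPos_sigNeg_add_sq [FiniteDimensional ℝ V₀] {Q : QuadraticForm ℝ V}
    {Q₀ : QuadraticForm ℝ V₀} (L : V ≃ₗ[ℝ] V₀ × ℝ) {c : ℝ}
    (h : ∀ v, Q v = Q₀ (L v).1 + c * ((L v).2 * (L v).2)) :
    sigPos Q = sigPos Q₀ + (if 0 < c then 1 else 0) ∧
      sigNeg Q = sigNeg Q₀ + (if c < 0 then 1 else 0) := by
  obtain ⟨n, w, h1, h2, h3, h4⟩ := exists_weights_add_sq L h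
  rw [h1, h2, h3, h4, ← ncard_option, ← ncard_option]
  constructor <;> congr 1 <;> ext i <;> cases i <;> simp

/-- Adding two squares with the same sign to a quadratic form. -/
theorem sigPos_sigNeg_add_two_sq [FiniteDimensional ℝ V₀] {Q : QuadraticForm ℝ V}
    {Q₀ : QuadraticForm ℝ V₀} (ℓ : V →ₗ[ℝ] V₀) (a b : V →ₗ[ℝ] ℝ)
    (hinj : ∀ v, ℓ v = 0 → a v = 0 → b v = 0 → v = 0)
    (hsurj : ∀ u x y, ∃ v, ℓ v = u ∧ a v = x ∧ b v = y) {c d : ℝ}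
    (h : ∀ v, Q v = Q₀ (ℓ v) + c * (a v * a v) + d * (b v * b v)) :
    sigPos Q = sigPos Q₀ + (if 0 < c then 1 else 0) + (if 0 < d then 1 else 0) ∧
      sigNeg Q = sigNeg Q₀ + (if c < 0 then 1 else 0) + (if d < 0 then 1 else 0) := by
  let L : V ≃ₗ[ℝ] (V₀ × ℝ) × ℝ := LinearEquiv.ofBijective ((ℓ.prod a).prod b) <| by
    constructor
    · rw [← LinearMap.ker_eq_bot, LinearMap.ker_eq_bot']
      intro v hv
      have h1 : (ℓ v, a v) = 0 := congrArg Prod.fst hv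
      exact hinj v (congrArg Prod.fst h1) (congrArg Prod.snd h1) (congrArg Prod.snd hv)
    · rintro ⟨⟨u, x⟩, y⟩
      obtain ⟨v, rfl, rfl, rfl⟩ := hsurj u x y
      exact ⟨v, rfl⟩
  let Q₁ : QuadraticForm ℝ (V₀ × ℝ) := Q₀.prod (c • QuadraticMap.sq)
  have h1 := sigPos_sigNeg_add_sq (Q := Q) (Q₀ := Q₁) L (c := d) fun v ↦ by
    rw [h]; rfl
  have h2 := sigPos_sigNeg_add_sq (Q := Q₁) (Q₀ := Q₀) (LinearEquiv.refl ℝ _) (c := c) fun v ↦ rfl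
  rw [h1.1, h1.2, h2.1, h2.2]
  exact ⟨rfl, rfl⟩

/-- The signature of a nondegenerate form with a skew-symmetric complex structure is even. -/
theorem exists_even_signature (n : ℕ) {V : Type*} [AddCommGroup V] [Module ℝ V]
    [FiniteDimensional ℝ V] (hn : Module.finrank ℝ V = n) (B : LinearMap.BilinForm ℝ V)
    (J : V →ₗ[ℝ] V) (hs : ∀ u v, B u v = B v u) (hJ : ∀ v, J (J v) = - v)
    (hBJ : ∀ u v, B (J u) v = - B u (J v)) (hB : ∀ u, (∀ v, B u v = 0) → u = 0) :
    ∃ k l : ℕ, sigPos (LinearMap.BilinMap.toQuadraticMap B) = 2 * k ∧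
      sigNeg (LinearMap.BilinMap.toQuadraticMap B) = 2 * l := by
  induction n using Nat.strong_induction_on generalizing V with
  | _ n ih =>
  -- a totally isotropic form is zero, so the space is trivial; otherwise split off a complex line
  by_cases hall : ∀ v, B v v = 0
  · have hz : ∀ u v, B u v = 0 := by
      intro u v
      have := hall (u + v)
      simp only [map_add, LinearMap.add_apply, hall, hs v u] at this
      linarith
    have hsub : Subsingleton V := ⟨fun u v ↦ by rw [hB u (hz u), hB v (hz v)]⟩
    have h0 : Module.finrank ℝ V = 0 := Module.finrank_zero_of_subsingleton
    refine ⟨0, 0, ?_, ?_⟩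
    · have := sigPos_le_finrank (LinearMap.BilinMap.toQuadraticMap B); omega
    · have := sigPos_le_finrank (-(LinearMap.BilinMap.toQuadraticMap B))
      rw [sigPos_neg] at this; omega
  push Not at hall
  obtain ⟨v₀, hv₀⟩ := hall
  set c := B v₀ v₀ with hc
  have e1 : B (J v₀) (J v₀) = c := by rw [hBJ, hJ, map_neg, neg_neg]
  have e2 : B v₀ (J v₀) = 0 := by
    have := hBJ v₀ v₀
    rw [hs] at this; linarith
  have e3 : B (J v₀) v₀ = 0 := by rw [hs, e2]
  -- the orthogonal complement of the complex line through `v₀`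
  let U : Submodule ℝ V := LinearMap.ker (B v₀) ⊓ LinearMap.ker (B (J v₀))
  have hU : ∀ u, u ∈ U ↔ B v₀ u = 0 ∧ B (J v₀) u = 0 := fun u ↦ by
    simp [U, Submodule.mem_inf, LinearMap.mem_ker]
  let ℓ₀ : V →ₗ[ℝ] V := LinearMap.id - (c⁻¹ • B v₀).smulRight v₀
    - (c⁻¹ • B (J v₀)).smulRight (J v₀)
  have hℓ₀ : ∀ v, ℓ₀ v = v - (c⁻¹ * B v₀ v) • v₀ - (c⁻¹ * B (J v₀) v) • J v₀ := fun v ↦ rfl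
  let ℓ : V →ₗ[ℝ] U := ℓ₀.codRestrict U fun v ↦ by
    rw [hU, hℓ₀]
    simp only [map_sub, map_smul, smul_eq_mul, ← hc, e1, e2, e3]
    constructor <;> field_simp <;> ring
  have hJU : ∀ u ∈ U, J u ∈ U := fun u hu ↦ by
    rw [hU] at hu ⊢
    have h1 := hBJ v₀ u
    have h2 := hBJ (J v₀) u
    rw [hJ, map_neg, LinearMap.neg_apply] at h2
    constructor <;> linarith [hu.1, hu.2]
  have hlt : Module.finrank ℝ U < n := by
    rw [← hn]
    refine Submodule.finrank_lt fun htop ↦ hv₀ ?_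
    exact ((hU v₀).1 (htop ▸ Submodule.mem_top)).1
  obtain ⟨k, l, hk, hl⟩ := ih _ hlt rfl (B.domRestrict₁₂ U U) (J.restrict hJU)
    (fun u v ↦ hs u v) (fun v ↦ Subtype.ext (hJ v)) (fun u v ↦ hBJ u v) fun u hu ↦ by
      refine Subtype.ext (hB u fun v ↦ ?_)
      have h1 := hu (ℓ v)
      have h2 := (hU u).1 u.2
      change B u (ℓ₀ v) = 0 at h1
      rw [hℓ₀, map_sub, map_sub, map_smul, map_smul, hs u v₀, hs u (J v₀), h2.1, h2.2] at h1
      simpa using h1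
  obtain ⟨h1, h2⟩ := sigPos_sigNeg_add_two_sq (Q := LinearMap.BilinMap.toQuadraticMap B)
    (Q₀ := LinearMap.BilinMap.toQuadraticMap (B.domRestrict₁₂ U U)) ℓ (B v₀) (B (J v₀))
    (c := c⁻¹) (d := c⁻¹)
    (fun v hv ha hb ↦ by
      have : ℓ₀ v = 0 := congrArg Subtype.val hv
      rw [hℓ₀, ha, hb] at this
      simpa using this)
    (fun u x y ↦ by
      have hu := (hU u).1 u.2
      refine ⟨u + (c⁻¹ * x) • v₀ + (c⁻¹ * y) • J v₀, Subtype.ext ?_, ?_, ?_⟩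
      · change ℓ₀ _ = u
        rw [hℓ₀]
        simp only [map_add, map_smul, smul_eq_mul, ← hc, e1, e2, e3, hu.1, hu.2]
        match_scalars <;> field_simp <;> ring
      · simp only [map_add, map_smul, smul_eq_mul, ← hc, e2, hu.1]
        field_simp; ring
      · simp only [map_add, map_smul, smul_eq_mul, e1, e3, hu.2]
        field_simp; ring)
    (fun v ↦ by
      change B v v = B (ℓ₀ v) (ℓ₀ v) + _ + _
      rw [hℓ₀]
      simp only [map_sub, map_smul, LinearMap.sub_apply, LinearMap.smul_apply, smul_eq_mul, ← hc,
        e1, e2, e3, hs v v₀, hs v (J v₀)]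
      field_simp
      ring)
  rw [hk] at h1
  rw [hl] at h2
  rcases lt_or_gt_of_ne hv₀ with h | h
  · exact ⟨k, l + 1, by rw [h1]; simp [h.not_gt], by rw [h2]; simp [h]; ring⟩
  · exact ⟨k + 1, l, by rw [h1]; simp [h]; ring, by rw [h2]; simp [h.not_gt]⟩

end Signature

/-! ### The signature of the conification -/

section Cone

variable {E : Type*} [NormedAddCommGroup E] [NormedSpace ℝ E] [FiniteDimensional ℝ E]
  {H : Type*} [TopologicalSpace H] {I : ModelWithCorners ℝ E H}
  {M : Type*} [TopologicalSpace M] [ChartedSpace H M] [IsManifold I ∞ M]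
  {E' : Type*} [NormedAddCommGroup E'] [NormedSpace ℝ E'] [FiniteDimensional ℝ E']
  {H' : Type*} [TopologicalSpace H'] {I' : ModelWithCorners ℝ E' H'}
  {N : Type*} [TopologicalSpace N] [ChartedSpace H' N] [IsManifold I' ∞ N]
  {g : Π x : M, TangentSpace I x →L[ℝ] TangentSpace I x →L[ℝ] ℝ}
  {J : Π x : M, TangentSpace I x →L[ℝ] TangentSpace I x}
  {Z : Π x : M, TangentSpace I x} {f : M → ℝ}
  {φ : N → M} {η : Π q : N, TangentSpace I' q →L[ℝ] ℝ} {t : N → ℝ}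
  {G : Π q : N, TangentSpace I' q →L[ℝ] TangentSpace I' q →L[ℝ] ℝ}
  {θ : Π q : N, TangentSpace I' q →L[ℝ] ℝ}

theorem IsAlmostPseudoKahler.exists_even_signature (hK : IsAlmostPseudoKahler I g J) (x : M) :
    ∃ k l : ℕ, HasSignature (g x) (2 * k) (2 * l) :=
  have : FiniteDimensional ℝ (TangentSpace I x) := inferInstanceAs (FiniteDimensional ℝ E)
  Conification.exists_even_signature _ rfl (g x).toLinearMap₁₂ (J x).toLinearMap
    (hK.metric.symm x) (hK.sq_eq_neg x) (hK.skew x) (hK.metric.nondegenerate x)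

/-- Completing the square with `X - τ J Z` diagonalizes the two vertical directions of `G`. -/
theorem IsConification.hasSignature (h : IsConification I I' g J Z f φ η t G θ) (q : N) {p r : ℕ}
    (hpr : HasSignature (g (φ q)) p r) :
    (0 < fOne I g Z f (φ q) → HasSignature (G q) (p + 2) r) ∧
      (fOne I g Z f (φ q) < 0 → HasSignature (G q) p (r + 2)) := by
  have hf1 := h.fOne_ne_zero (φ q)
  set x := φ q with hx
  set c := Real.exp (t q) with hc
  have hc0 : c ≠ 0 := (Real.exp_pos _).ne'
  have hcc : Real.exp (2 * t q) = c * c := by rw [hc, ← Real.exp_add]; ring_nf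
  let ℓ : TangentSpace I' q →L[ℝ] TangentSpace I x :=
    c • (mfderiv I' I φ q - (mvfderiv I' t q).smulRight (J x (Z x)))
  have hℓ : ∀ v, ℓ v = c • (mfderiv I' I φ q v - mvfderiv I' t q v • J x (Z x)) := fun v ↦ rfl
  have : FiniteDimensional ℝ (TangentSpace I x) := inferInstanceAs (FiniteDimensional ℝ E)
  have key := sigPos_sigNeg_add_two_sq
    (Q := LinearMap.BilinMap.toQuadraticMap (G q).toLinearMap₁₂)
    (Q₀ := LinearMap.BilinMap.toQuadraticMap (g x).toLinearMap₁₂) ℓ.toLinearMap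
    (c • η q).toLinearMap (c • mvfderiv I' t q).toLinearMap (c := 2 / fOne I g Z f x)
    (d := 2 * fOne I g Z f x)
    (fun v h1 h2 h3 ↦ by
      replace h1 : ℓ v = 0 := h1
      replace h2 : c * η q v = 0 := h2
      replace h3 : c * mvfderiv I' t q v = 0 := h3
      rw [mul_eq_zero, or_iff_right hc0] at h2 h3
      rw [hℓ, smul_eq_zero_iff_right hc0, h3, zero_smul, sub_zero] at h1
      exact h.ext (h1.trans (map_zero _).symm) (h2.trans (map_zero _).symm)
        (h3.trans (map_zero _).symm))
    (fun u a s ↦ by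
      obtain ⟨v, h1, h2, h3⟩ := h.surjective q (c⁻¹ • u + (c⁻¹ * s) • J x (Z x)) (c⁻¹ * a) (c⁻¹ * s)
      refine ⟨v, ?_, ?_, ?_⟩
      · change ℓ v = u
        rw [hℓ, h1, h3]
        match_scalars
        · field_simp
        · field_simp
          ring
      · change c * η q v = a
        rw [h2]; field_simp
      · change c * mvfderiv I' t q v = s
        rw [h3]; field_simp)
    (fun v ↦ by
      change G q v v = g x (ℓ v) (ℓ v) + 2 / fOne I g Z f x * (c * η q v * (c * η q v)) +
        2 * fOne I g Z f x * (c * mvfderiv I' t q v * (c * mvfderiv I' t q v))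
      rw [h.metric_apply, hℓ, hcc, h.mvfderiv_f_eq]
      have e1 : g x (J x (Z x)) (J x (Z x)) = 2 * (f x - fOne I g Z f x) := by
        rw [h.kahler.skew, h.kahler.sq_eq_neg, map_neg, fOne]; ring
      simp only [map_sub, map_smul, sub_apply, smul_apply, smul_eq_mul, e1,
        h.kahler.metric.symm x (mfderiv I' I φ q v) (J x (Z x))]
      ring)
  rw [HasSignature] at hpr
  constructor <;> intro hpos <;> rw [HasSignature, key.1, key.2]
  · refine ⟨?_, ?_⟩
    · rw [if_pos (by positivity), if_pos (by positivity)]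
      exact congrArg (· + 1 + 1) hpr.1
    · rw [if_neg (not_lt.2 (by positivity)), if_neg (not_lt.2 (by positivity))]
      exact hpr.2
  · have h1 : 2 / fOne I g Z f x < 0 := div_neg_of_pos_of_neg two_pos hpos
    have h2 : 2 * fOne I g Z f x < 0 := by linarith
    refine ⟨?_, ?_⟩
    · rw [if_neg h1.not_gt, if_neg h2.not_gt]
      exact hpr.1
    · rw [if_pos h1, if_pos h2]
      exact congrArg (· + 1 + 1) hpr.2

end Cone

/-! ### Principal circle bundles with connection -/

section CircleBundle

variable {E : Type*} [NormedAddCommGroup E] [NormedSpace ℝ E]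
  {H : Type*} [TopologicalSpace H] {I : ModelWithCorners ℝ E H}
  {M : Type*} [TopologicalSpace M] [ChartedSpace H M]
  {E' : Type*} [NormedAddCommGroup E'] [NormedSpace ℝ E']
  {H' : Type*} [TopologicalSpace H'] {I' : ModelWithCorners ℝ E' H'}
  {P : Type*} [TopologicalSpace P] [ChartedSpace H' P] [MulAction Circle P] {π : P → M}

namespace IsPrincipalCircleBundle

variable (hπ : IsPrincipalCircleBundle I I' π)
include hπ

theorem mdifferentiableAt_proj (p : P) : MDifferentiableAt I' I π p :=
  (hπ.contMDiff_proj p).mdifferentiableAt (by simp)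

theorem exists_mfderiv_trivialization (p : P) : ∃ e : Trivialization Circle π, p ∈ e.source ∧
    e.toOpenPartialHomeomorph.MDifferentiable I' (I.prod (𝓡 1)) := by
  obtain ⟨e, he, h1, h2, -⟩ := hπ.exists_trivialization (π p)
  exact ⟨e, e.mem_source.2 he, h1.mdifferentiableOn (by simp), h2.mdifferentiableOn (by simp)⟩

theorem mfderiv_surjective (p : P) : Function.Surjective (mfderiv I' I π p) := by
  obtain ⟨e, hp, he⟩ := hπ.exists_mfderiv_trivialization p
  have h1 : π =ᶠ[𝓝 p] fun y ↦ (e y).1 := by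
    filter_upwards [e.open_source.mem_nhds hp] with y hy using (e.proj_toFun y hy).symm
  have h2 : mfderiv I' I π p = (mfderiv (I.prod (𝓡 1)) I Prod.fst (e p)).comp
      (mfderiv I' (I.prod (𝓡 1)) e p) := by
    rw [h1.mfderiv_eq]
    exact mfderiv_comp p mdifferentiableAt_fst (he.mdifferentiableAt hp)
  intro u
  obtain ⟨v, hv⟩ := he.mfderiv_surjective hp ((u, 0) : E × EuclideanSpace ℝ (Fin 1))
  refine ⟨v, ?_⟩
  rw [h2, mfderiv_fst]
  exact congrArg Prod.fst hv

theorem finrank_eq [FiniteDimensional ℝ E] (p : P) :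
    Module.finrank ℝ E' = Module.finrank ℝ E + 1 := by
  obtain ⟨e, hp, he⟩ := hπ.exists_mfderiv_trivialization p
  have h : Module.finrank ℝ E' = Module.finrank ℝ (E × EuclideanSpace ℝ (Fin 1)) :=
    (he.mfderiv hp).toLinearEquiv.finrank_eq
  rw [h, Module.finrank_prod, finrank_euclideanSpace_fin]

theorem mfderiv_fundamentalField (p : P) : mfderiv I' I π p (fundamentalField I' p) = 0 := by
  have h1 : MDifferentiableAt 𝓘(ℝ, ℝ) ((𝓡 1).prod I') (fun s : ℝ ↦ (Circle.exp s, p)) 0 :=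
    ((contMDiff_circleExp (m := 1)) 0).mdifferentiableAt (by simp) |>.prodMk
      mdifferentiableAt_const
  have h2 : MDifferentiableAt 𝓘(ℝ, ℝ) I' (fun s : ℝ ↦ Circle.exp s • p) 0 :=
    ((hπ.contMDiff_smul _).mdifferentiableAt (by simp)).comp (0 : ℝ) h1
  have h3 := mfderiv_comp (I'' := I) (0 : ℝ)
    (hπ.mdifferentiableAt_proj (Circle.exp 0 • p)) h2
  have h4 : π ∘ (fun s : ℝ ↦ Circle.exp s • p) = fun _ ↦ π p := by
    funext s; exact hπ.proj_smul _ _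
  rw [h4, mfderiv_const, Circle.exp_zero, one_smul] at h3
  exact (DFunLike.congr_fun h3 (1 : ℝ)).symm

/-- The kernel of `dπ` is one-dimensional by the trivializations, so it is spanned by `X_P`. -/
theorem exists_eq_smul_fundamentalField [FiniteDimensional ℝ E] [FiniteDimensional ℝ E'] {p : P}
    (h0 : fundamentalField I' p ≠ 0) {v : TangentSpace I' p} (hv : mfderiv I' I π p v = 0) :
    ∃ c : ℝ, v = c • fundamentalField I' p := by
  let A : E' →ₗ[ℝ] E := (mfderiv I' I π p).toLinearMap
  have hr : LinearMap.range A = ⊤ := LinearMap.range_eq_top.2 (hπ.mfderiv_surjective p)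
  have hk : Module.finrank ℝ (LinearMap.ker A) = 1 := by
    have h1 := A.finrank_range_add_finrank_ker
    rw [hr, finrank_top, hπ.finrank_eq p] at h1
    omega
  let w : LinearMap.ker A := ⟨fundamentalField I' p, hπ.mfderiv_fundamentalField p⟩
  obtain ⟨c, hc⟩ := (finrank_eq_one_iff_of_nonzero' w
    fun hw ↦ h0 (congrArg Subtype.val hw)).1 hk ⟨v, hv⟩
  exact ⟨c, (congrArg Subtype.val hc).symm⟩

end IsPrincipalCircleBundle

omit [MulAction Circle P] in
theorem dProjP_apply (q : P × ℝ) (v : TangentSpace (I'.prod 𝓘(ℝ, ℝ)) q) :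
    dProjP I' q v = Prod.fst (α := E') (β := ℝ) v := by
  rw [dProjP, mfderiv_fst]
  rfl

omit [MulAction Circle P] in
theorem dtForm_apply (q : P × ℝ) (v : TangentSpace (I'.prod 𝓘(ℝ, ℝ)) q) :
    dtForm I' q v = Prod.snd (α := E') (β := ℝ) v := by
  change mfderiv (I'.prod 𝓘(ℝ, ℝ)) 𝓘(ℝ, ℝ) (Prod.snd : P × ℝ → ℝ) q v = _
  rw [mfderiv_snd]
  rfl

omit [MulAction Circle P] in
theorem xiField_eq (q : P × ℝ) : xiField I' q = ((0, 1) : E' × ℝ) := by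
  rw [xiField, mfderiv_prod_right]
  rfl

omit [MulAction Circle P] in
theorem dProjP_xiField (q : P × ℝ) : dProjP I' q (xiField I' q) = 0 := by
  rw [dProjP_apply, xiField_eq]
  rfl

omit [MulAction Circle P] in
theorem dIncl_apply (t : ℝ) (p : P) (v : TangentSpace I' p) :
    dIncl I' t p v = ((v, 0) : E' × ℝ) := by
  rw [dIncl, mfderiv_prod_left]
  rfl

omit [MulAction Circle P] in
theorem mem_range_dIncl {t : ℝ} {p : P} {u : TangentSpace (I'.prod 𝓘(ℝ, ℝ)) (p, t)} :
    u ∈ LinearMap.range (dIncl I' t p).toLinearMap ↔ dtForm I' (p, t) u = 0 := by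
  constructor
  · rintro ⟨v, rfl⟩
    rw [dtForm_apply]
    exact congrArg Prod.snd (dIncl_apply t p v)
  · intro hu
    rw [dtForm_apply] at hu
    refine ⟨Prod.fst (α := E') (β := ℝ) u, (dIncl_apply t p _).trans ?_⟩
    exact Prod.ext rfl hu.symm

omit [MulAction Circle P] in
theorem dProjHat_apply (hπ : ContMDiff I' I ∞ π) (q : P × ℝ)
    (v : TangentSpace (I'.prod 𝓘(ℝ, ℝ)) q) :
    dProjHat I I' π q v = mfderiv I' I π q.1 (dProjP I' q v) :=
  mfderiv_comp_apply (I' := I') (g := π) (f := Prod.fst) q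
    ((hπ q.1).mdifferentiableAt (by simp)) mdifferentiableAt_fst v

end CircleBundle

section Total

variable {E : Type*} [NormedAddCommGroup E] [NormedSpace ℝ E] [FiniteDimensional ℝ E]
  {H : Type*} [TopologicalSpace H] {I : ModelWithCorners ℝ E H}
  {M : Type*} [TopologicalSpace M] [ChartedSpace H M] [IsManifold I ∞ M]
  {E' : Type*} [NormedAddCommGroup E'] [NormedSpace ℝ E'] [FiniteDimensional ℝ E']
  {H' : Type*} [TopologicalSpace H'] {I' : ModelWithCorners ℝ E' H'}
  {P : Type*} [TopologicalSpace P] [ChartedSpace H' P] [IsManifold I' ∞ P]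

variable (I' P) in
theorem isVerticalCoframe_fst :
    IsVerticalCoframe I' (I'.prod 𝓘(ℝ, ℝ)) (Prod.fst : P × ℝ → P) (dtForm I') where
  contMDiff := contMDiff_fst
  smooth q _ hV := contMDiffAt_mvfderiv_apply (contMDiff_snd q) le_rfl hV
  injective q v h1 h2 := by
    have h1 : dProjP I' q v = 0 := h1
    rw [dProjP_apply] at h1
    rw [dtForm_apply] at h2
    exact Prod.ext h1 h2
  surjective q u c := ⟨((u, c) : E' × ℝ), dProjP_apply q _, dtForm_apply q _⟩

variable [MulAction Circle P] {π : P → M} {η : Π p : P, TangentSpace I' p →L[ℝ] ℝ}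

theorem IsPrincipalConnection.fundamentalField_ne_zero (hη : IsPrincipalConnection I' η) (p : P) :
    fundamentalField I' p ≠ 0 := fun h ↦ by
  have := hη.apply_fundamentalField p
  rw [h, map_zero] at this
  exact zero_ne_one this

/-- The components `(dπ̂, η, dt)` trivialize the tangent bundle of `P × ℝ` along the fibres. -/
theorem isVerticalCoframe_projHat (hπ : IsPrincipalCircleBundle I I' π)
    (hη : IsPrincipalConnection I' η) :
    IsVerticalCoframe I (I'.prod 𝓘(ℝ, ℝ)) (projHat π)
      fun q ↦ ((η q.1).comp (dProjP I' q)).prod (dtForm I' q) where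
  contMDiff := hπ.contMDiff_proj.comp contMDiff_fst
  smooth q _ hV :=
    ((hη.smooth.pullback (I' := I'.prod 𝓘(ℝ, ℝ)) (φ := Prod.fst)
      contMDiff_fst).contMDiffAt_apply_field hV).prodMk_space
      (contMDiffAt_mvfderiv_apply (contMDiff_snd q) le_rfl hV)
  injective q v h1 h2 := by
    have h3 : η q.1 (dProjP I' q v) = 0 := congrArg Prod.fst h2
    have h4 : dtForm I' q v = 0 := congrArg Prod.snd h2
    have h5 := (dProjHat_apply hπ.contMDiff_proj q v).symm.trans h1
    obtain ⟨c, hc⟩ := hπ.exists_eq_smul_fundamentalField (hη.fundamentalField_ne_zero q.1) h5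
    rw [hc, map_smul, hη.apply_fundamentalField, smul_eq_mul, mul_one] at h3
    rw [h3, zero_smul] at hc
    exact (isVerticalCoframe_fst I' P).injective q v hc h4
  surjective q u c := by
    obtain ⟨v, hv⟩ := hπ.mfderiv_surjective q.1 u
    obtain ⟨w, hw, hw'⟩ := (isVerticalCoframe_fst I' P).surjective q
      (v + (c.1 - η q.1 v) • fundamentalField I' q.1) c.2
    replace hw : dProjP I' q w = v + (c.1 - η q.1 v) • fundamentalField I' q.1 := hw
    refine ⟨w, (dProjHat_apply hπ.contMDiff_proj q w).trans ?_, Prod.ext ?_ hw'⟩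
    · rw [hw, map_add, map_smul, hπ.mfderiv_fundamentalField, smul_zero, add_zero, hv]
    · change η q.1 (dProjP I' q w) = c.1
      rw [hw, map_add, map_smul, hη.apply_fundamentalField, smul_eq_mul, mul_one,
        add_sub_cancel]

variable {g : Π x : M, TangentSpace I x →L[ℝ] TangentSpace I x →L[ℝ] ℝ}
  {J : Π x : M, TangentSpace I x →L[ℝ] TangentSpace I x}
  {Z : Π x : M, TangentSpace I x} {f : M → ℝ}

/-- The conification data on `P × ℝ`. -/
theorem isConification_product [I.Boundaryless] [I'.Boundaryless]
    (hgJ : IsPseudoKahler I g J) (hZ : IsKilling I g Z)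
    (hf : ContMDiff I 𝓘(ℝ, ℝ) ∞ f)
    (hf_hamiltonian : ∀ x v, mvfderiv I f x v = - fundamentalForm I g J x (Z x) v)
    (hf_ne_zero : ∀ x, f x ≠ 0) (hf₁_ne_zero : ∀ x, fOne I g Z f x ≠ 0)
    (hπ : IsPrincipalCircleBundle I I' π) (hη : IsPrincipalConnection I' η)
    (hη_curvature : ∀ (p : P) (u v : TangentSpace I' p),
      extDerivOne I' η p u v =
        pullBilin (fundamentalForm I g J (π p)
            - (1 / 2 : ℝ) • extDerivOne I (betaForm I g Z) (π p)) (mfderiv I' I π p) u v) :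
    IsConification I (I'.prod 𝓘(ℝ, ℝ)) g J Z f (projHat π) (fun q ↦ (η q.1).comp (dProjP I' q))
      (fun q ↦ q.2) (metricHat I I' g Z f π η) (thetaForm I I' g Z π η) where
  kahler := hgJ
  killing := hZ
  contMDiff_f := hf
  hamiltonian := hf_hamiltonian
  f_ne_zero := hf_ne_zero
  fOne_ne_zero := hf₁_ne_zero
  coframe := isVerticalCoframe_projHat hπ hη
  smooth_eta := hη.smooth.pullback (φ := Prod.fst) contMDiff_fst
  contMDiff_t := contMDiff_snd
  extDerivOne_eta q u v := by
    have h1 := (isVerticalCoframe_fst I' P).extDerivOne_pullback hη.smooth q u v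
    refine h1.trans ((hη_curvature _ _ _).trans ?_)
    rw [← dProjHat, dProjHat_apply hπ.contMDiff_proj, dProjHat_apply hπ.contMDiff_proj]
    rfl
  metric_apply q u v := by
    rw [← dProjHat, dProjHat_apply hπ.contMDiff_proj, dProjHat_apply hπ.contMDiff_proj]
    simp only [metricHat, metricP, pullBilin, tensorOne, add_apply, smul_apply,
      ContinuousLinearMap.comp_apply, ContinuousLinearMap.smulRight_apply, smul_eq_mul,
      dProjHat_apply hπ.contMDiff_proj]
    rfl
  theta_apply q v := rfl

end Total

end Conification

/-! ### The conification of a pseudo-Kähler manifold -/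

theorem theorem1
    {E : Type*} [NormedAddCommGroup E] [NormedSpace ℝ E] [FiniteDimensional ℝ E]
    {M : Type*} [TopologicalSpace M] [ChartedSpace E M] [IsManifold 𝓘(ℝ, E) ∞ M]
    {F : Type*} [NormedAddCommGroup F] [NormedSpace ℝ F] [FiniteDimensional ℝ F]
    {P : Type*} [TopologicalSpace P] [ChartedSpace F P] [IsManifold 𝓘(ℝ, F) ∞ P]
    [MulAction Circle P]
    (g : Π x : M, TangentSpace 𝓘(ℝ, E) x →L[ℝ] TangentSpace 𝓘(ℝ, E) x →L[ℝ] ℝ)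
    (J : Π x : M, TangentSpace 𝓘(ℝ, E) x →L[ℝ] TangentSpace 𝓘(ℝ, E) x)
    (Z : Π x : M, TangentSpace 𝓘(ℝ, E) x)
    (f : M → ℝ)
    (π : P → M)
    (η : Π p : P, TangentSpace 𝓘(ℝ, F) p →L[ℝ] ℝ)
    (hgJ : IsPseudoKahler 𝓘(ℝ, E) g J)
    (hZ : IsKilling 𝓘(ℝ, E) g Z)
    (hZ_not_null : ∀ x, g x (Z x) (Z x) ≠ 0)
    (hf : ContMDiff 𝓘(ℝ, E) 𝓘(ℝ, ℝ) ∞ f)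
    (hf_hamiltonian : ∀ x v,
      mvfderiv 𝓘(ℝ, E) f x v = - fundamentalForm 𝓘(ℝ, E) g J x (Z x) v)
    (hf_ne_zero : ∀ x, f x ≠ 0)
    (hf₁_ne_zero : ∀ x, fOne 𝓘(ℝ, E) g Z f x ≠ 0)
    (hπ : IsPrincipalCircleBundle 𝓘(ℝ, E) 𝓘(ℝ, F) π)
    (hη : IsPrincipalConnection 𝓘(ℝ, F) η)
    (hη_curvature : ∀ (p : P) (u v : TangentSpace 𝓘(ℝ, F) p),
      extDerivOne 𝓘(ℝ, F) η p u v =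
        pullBilin
          (fundamentalForm 𝓘(ℝ, E) g J (π p)
            - (1 / 2 : ℝ) • extDerivOne 𝓘(ℝ, E) (betaForm 𝓘(ℝ, E) g Z) (π p))
          (mfderiv 𝓘(ℝ, F) 𝓘(ℝ, E) π p) u v) :
    -- the conical pseudo-Kähler structure with Kähler form `dθ`
    IsPseudoKahler (𝓘(ℝ, F).prod 𝓘(ℝ, ℝ)) (metricHat 𝓘(ℝ, E) 𝓘(ℝ, F) g Z f π η)
      (jHat 𝓘(ℝ, E) 𝓘(ℝ, F) g Z f π η) ∧
    (∀ q, fundamentalForm (𝓘(ℝ, F).prod 𝓘(ℝ, ℝ)) (metricHat 𝓘(ℝ, E) 𝓘(ℝ, F) g Z f π η)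
      (jHat 𝓘(ℝ, E) 𝓘(ℝ, F) g Z f π η) q = omegaHat 𝓘(ℝ, E) 𝓘(ℝ, F) g Z π η q) ∧
    IsConical (𝓘(ℝ, F).prod 𝓘(ℝ, ℝ)) (metricHat 𝓘(ℝ, E) 𝓘(ℝ, F) g Z f π η) (xiField 𝓘(ℝ, F)) ∧
    -- the induced CR structure is the horizontal distribution
    (∀ t p, crDistribution 𝓘(ℝ, F) (jHat 𝓘(ℝ, E) 𝓘(ℝ, F) g Z f π η) t p =
      LinearMap.ker (η p).toLinearMap) ∧
    -- the projection of `P` is holomorphic on the horizontal distribution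
    (∀ t p v, η p v = 0 → ∃ w, η p w = 0 ∧
      jHat 𝓘(ℝ, E) 𝓘(ℝ, F) g Z f π η (p, t) (dIncl 𝓘(ℝ, F) t p v) = dIncl 𝓘(ℝ, F) t p w ∧
      mfderiv 𝓘(ℝ, F) 𝓘(ℝ, E) π p w = J (π p) (mfderiv 𝓘(ℝ, F) 𝓘(ℝ, E) π p v)) ∧
    -- the projection of `P × ℝ` is not holomorphic, its kernel is not invariant
    (∀ p t, LinearMap.ker (dProjHat 𝓘(ℝ, E) 𝓘(ℝ, F) π (p, t)).toLinearMap =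
        Submodule.span ℝ {dIncl 𝓘(ℝ, F) t p (fundamentalField 𝓘(ℝ, F) p),
          xiField 𝓘(ℝ, F) (p, t)}) ∧
    (∀ q, ∃ v, dProjHat 𝓘(ℝ, E) 𝓘(ℝ, F) π q v = 0 ∧
      dProjHat 𝓘(ℝ, E) 𝓘(ℝ, F) π q (jHat 𝓘(ℝ, E) 𝓘(ℝ, F) g Z f π η q v) ≠ 0) ∧
    (∀ q, ∃ v, dProjHat 𝓘(ℝ, E) 𝓘(ℝ, F) π q (jHat 𝓘(ℝ, E) 𝓘(ℝ, F) g Z f π η q v) ≠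
      J (projHat π q) (dProjHat 𝓘(ℝ, E) 𝓘(ℝ, F) π q v)) ∧
    -- the signature
    (∀ q, ∃ k l : ℕ,
      HasSignature (g (projHat π q)) (2 * k) (2 * l) ∧
      (0 < fOne 𝓘(ℝ, E) g Z f (projHat π q) →
        HasSignature (metricHat 𝓘(ℝ, E) 𝓘(ℝ, F) g Z f π η q) (2 * k + 2) (2 * l)) ∧
      (fOne 𝓘(ℝ, E) g Z f (projHat π q) < 0 →
        HasSignature (metricHat 𝓘(ℝ, E) 𝓘(ℝ, F) g Z f π η q) (2 * k) (2 * l + 2))) := by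
  have h := isConification_product hgJ hZ hf hf_hamiltonian hf_ne_zero hf₁_ne_zero hπ hη
    hη_curvature
  have hξ : ∀ q : P × ℝ, dProjHat 𝓘(ℝ, E) 𝓘(ℝ, F) π q (xiField 𝓘(ℝ, F) q) = 0 ∧
      ((η q.1).comp (dProjP 𝓘(ℝ, F) q)) (xiField 𝓘(ℝ, F) q) = 0 ∧
      dtForm 𝓘(ℝ, F) q (xiField 𝓘(ℝ, F) q) = 1 := by
    intro q
    have h1 := dProjP_xiField (I' := 𝓘(ℝ, F)) q
    refine ⟨?_, ?_, ?_⟩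
    · rw [dProjHat_apply hπ.contMDiff_proj, h1]
      exact map_zero _
    · rw [ContinuousLinearMap.comp_apply, h1, map_zero]
    · rw [dtForm_apply, xiField_eq]
  have hJξ : ∀ q, dProjHat 𝓘(ℝ, E) 𝓘(ℝ, F) π q
      (jHat 𝓘(ℝ, E) 𝓘(ℝ, F) g Z f π η q (xiField 𝓘(ℝ, F) q)) = Z (projHat π q) :=
    fun q ↦ (h.complexStructure_vertical (hξ q)).1
  have hZ0 : ∀ x, Z x ≠ 0 := fun x hx ↦ hZ_not_null x (by rw [hx, map_zero])
  have hP : ∀ t p (v : TangentSpace 𝓘(ℝ, F) p),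
      dProjP 𝓘(ℝ, F) ((p, t) : P × ℝ) (dIncl 𝓘(ℝ, F) t p v) = v := fun t p v ↦ by
    rw [dProjP_apply, dIncl_apply]
  have ht : ∀ t p (v : TangentSpace 𝓘(ℝ, F) p),
      dtForm 𝓘(ℝ, F) ((p, t) : P × ℝ) (dIncl 𝓘(ℝ, F) t p v) = 0 := fun t p v ↦
    mem_range_dIncl.1 ⟨v, rfl⟩
  refine ⟨h.isPseudoKahler, fun q ↦ ContinuousLinearMap.ext (h.metric_complexStructure q),
    h.isConical hξ, fun t p ↦ ?_, fun t p v hv ↦ ?_, fun p t ↦ ?_,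
    fun q ↦ ⟨xiField 𝓘(ℝ, F) q, (hξ q).1, ?_⟩, fun q ↦ ⟨xiField 𝓘(ℝ, F) q, ?_⟩, fun q ↦ ?_⟩
  · ext v
    have h1 := (h.complexStructure_components (p, t) (dIncl 𝓘(ℝ, F) t p v)).2.2
    refine mem_range_dIncl.trans ?_
    refine (Eq.congr_left h1).trans ?_
    rw [ContinuousLinearMap.comp_apply, hP, neg_eq_zero, div_eq_zero_iff,
      or_iff_left (hf₁_ne_zero _)]
    rfl
  · have hv' : dProjHat 𝓘(ℝ, E) 𝓘(ℝ, F) π (p, t) (dIncl 𝓘(ℝ, F) t p v) =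
        mfderiv 𝓘(ℝ, F) 𝓘(ℝ, E) π p v := by
      rw [dProjHat_apply hπ.contMDiff_proj, hP]
    obtain ⟨h1, h2, h3⟩ := h.complexStructure_horizontal (q := (p, t))
      (u := dIncl 𝓘(ℝ, F) t p v) ⟨hv', (congrArg (η p) (hP t p v)).trans hv, ht t p v⟩
    obtain ⟨w, hw⟩ := mem_range_dIncl.2 h3
    have hw : dIncl 𝓘(ℝ, F) t p w =
      jHat 𝓘(ℝ, E) 𝓘(ℝ, F) g Z f π η (p, t) (dIncl 𝓘(ℝ, F) t p v) := hw
    have hPw : dProjP 𝓘(ℝ, F) ((p, t) : P × ℝ)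
      (jHat 𝓘(ℝ, E) 𝓘(ℝ, F) g Z f π η (p, t) (dIncl 𝓘(ℝ, F) t p v)) = w := by rw [← hw, hP]
    refine ⟨w, (congrArg (η p) hPw).symm.trans h2, hw.symm, ?_⟩
    refine (congrArg (mfderiv 𝓘(ℝ, F) 𝓘(ℝ, E) π p) hPw).symm.trans ?_
    exact (dProjHat_apply hπ.contMDiff_proj (p, t) _).symm.trans h1
  · ext v
    rw [Submodule.mem_span_pair]
    constructor
    · intro hv
      have h1 := (dProjHat_apply hπ.contMDiff_proj (p, t) v).symm.trans hv
      obtain ⟨c, hc⟩ := hπ.exists_eq_smul_fundamentalField (hη.fundamentalField_ne_zero p) h1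
      refine ⟨c, dtForm 𝓘(ℝ, F) (p, t) v, (isVerticalCoframe_fst 𝓘(ℝ, F) P).ext ?_ ?_⟩
      · change dProjP 𝓘(ℝ, F) (p, t) _ = dProjP 𝓘(ℝ, F) (p, t) v
        rw [map_add, map_smul, map_smul, hP, hc, dProjP_xiField]
        exact (congrArg (c • fundamentalField 𝓘(ℝ, F) p + ·) (smul_zero _)).trans (add_zero _)
      · rw [map_add, map_smul, map_smul, ht, (hξ _).2.2]
        simp
    · rintro ⟨a, b, rfl⟩
      change dProjHat 𝓘(ℝ, E) 𝓘(ℝ, F) π (p, t) _ = 0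
      rw [map_add, map_smul, map_smul, (hξ _).1, dProjHat_apply hπ.contMDiff_proj, hP,
        hπ.mfderiv_fundamentalField, smul_zero, add_zero]
      exact smul_zero (A := E) a
  · rw [hJξ]; exact hZ0 _
  · rw [hJξ, (hξ q).1, map_zero]; exact hZ0 _
  · obtain ⟨k, l, hkl⟩ := hgJ.exists_even_signature (projHat π q)
    exact ⟨k, l, hkl, h.hasSignature q hkl⟩
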